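/- Valuations $v$ are Krull valuations, written additively; $vK$ and $Kv$ denote the value group and the residue field of $(K,v)$. A valued field is henselian if its valuation ring satisfies Hensel's Lemma, and algebraically maximal if it has no nontrivial immediate algebraic extension (immediate: value group and residue field remain unchanged). A valued field $(L,v)$ is a Kaplansky field if $\operatorname{char} Lv=0$, or if $\operatorname{char} Lv=p>0$, $vL$ is $p$-divisible, and every polynomial $f+c$ with $c\in Lv$ and $0\neq f=\sum_{i=0}^n c_iX^{p^i}\in Lv[X]$ has a zero in $Lv$. For a henselian field $(K,v)$ fix an extension of $v$ to an algebraic closure $\tilde K$, and let $K^{\rm sep}\subseteq\tilde K$ be the separable closure. The absolute ramification field of $(K,v)$ is the fixed field in $K^{\rm sep}$ of $$G^r=\{\sigma\in\operatorname{Gal}(K^{\rm sep}|K)\mid v(\sigma a-a)>va \text{ for all } a\in\mathcal O_{K^{\rm sep}}\setminus\{0\}\}.$$ An algebraic extension $(E|K,v)$ of a henselian field $(K,v)$ is tame if for every finite subextension $F|K$ the index $(vF:vK)$ is prime to $p$ if $\operatorname{char}Kv=p>0$, the extension $Fv|Kv$ is separable, and $[F:K]=(vF:vK)[Fv:Kv]$.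 It is purely wild if it is linearly disjoint over $K$ from the absolute ramification field of $(K,v)$. **Proposition.** Let $(L,v)$ be an algebraically maximal Kaplansky field and $K$ a subfield of $L$ such that $(K,v)$ is henselian and $L|K$ is algebraic. Fix an extension of $v$ to an algebraic closure $\tilde L$ of $L$ (which is also one of $K$). Let $Z\subseteq\tilde L$ be the absolute ramification field of $(K,v)$, and set $Z_0=Z\cap L$. Then: a) $(Z_0,v)$ is a tame extension of $(K,v)$, maximal with respect to being contained in $L$; b) $(L,v)$ is a maximal purely wild extension of $(Z_0,v)$, i.e. $L|Z_0$ is purely wild and no proper extension field of $L$ inside $\tilde L$ is a purely wild extension of $(Z_0,v)$; c) (K3) holds for $(Z_0,v)$: the residue field $Z_0v$ admits no finite separable extension of degree divisible by $p=\operatorname{char}Z_0v$ (void if $p=0$). -/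

import Mathlib

/-! Valued fields are fields `K` together with a valuation ring `A : ValuationSubring K`, i.e. Krull
valuations up to equivalence.  The valuation of `A` is `A.valuation` (written multiplicatively), its
value group is `(A.ValueGroup)ˣ`, its residue field is `IsLocalRing.ResidueField A`.
If `E` is an extension field of `K` and `B : ValuationSubring E`, then the restriction of the
valuation to `K` has the valuation ring `B.comap (algebraMap K E)`. -/

open Polynomial IsLocalRing

namespace ValuedField

universe u

section Absolute

variable {K : Type u} [Field K] (A : ValuationSubring K)

/-- The characteristic of the residue field. -/
noncomputable def residueChar : ℕ := ringChar (ResidueField A)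

/-- `(K, v)` is henselian: its valuation ring satisfies Hensel's Lemma. -/
def IsHenselian : Prop := HenselianLocalRing A

/-- The additive polynomials over a field of characteristic `p > 0`: those of the form
`∑ i ≤ n, c i * X ^ (p ^ i)`. -/
def IsAdditivePolynomial {k : Type*} [Field k] (p : ℕ) (f : k[X]) : Prop :=
  ∃ (n : ℕ) (c : ℕ → k), f = ∑ i ∈ Finset.range (n + 1), C (c i) * X ^ (p ^ i)

/-- Every `p`-polynomial `f + c` over `k`, with `f` a nonzero additive polynomial and `c ∈ k`, has a
zero in `k`.  (For `f = 0` one would get the nonzero constants, which never have a zero.) -/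
def PPolynomialsHaveZeros (k : Type*) [Field k] (p : ℕ) : Prop :=
  ∀ (f : k[X]) (c : k), IsAdditivePolynomial p f → f ≠ 0 → ∃ x : k, (f + C c).IsRoot x

/-- The value group is `p`-divisible (written multiplicatively). -/
def ValueGroupDivisible (p : ℕ) : Prop :=
  ∀ γ : (A.ValueGroup)ˣ, ∃ δ : (A.ValueGroup)ˣ, δ ^ p = γ

/-- Kaplansky fields: residue characteristic `0`, or residue characteristic `p > 0` and Kaplansky's
hypothesis A. -/
def IsKaplansky : Prop :=
  residueChar A = 0 ∨
    (PPolynomialsHaveZeros (ResidueField A) (residueChar A) ∧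
      ValueGroupDivisible A (residueChar A))

/-- Condition (K3): the residue field admits no finite separable extension of degree divisible by
its characteristic `p`.  (For `p = 0` this is void, since `0` divides no positive degree.) -/
def K3 : Prop :=
  ∀ (F : Type u) [Field F] [Algebra (ResidueField A) F] [FiniteDimensional (ResidueField A) F]
    [Algebra.IsSeparable (ResidueField A) F],
    ¬ residueChar A ∣ Module.finrank (ResidueField A) F

end Absolute

section Extension

variable (K : Type*) {E : Type*} [Field K] [Field E] [Algebra K E] (B : ValuationSubring E)

/-- The inclusion of the valuation ring of `K` in that of `E`. -/
def restrictHom : B.comap (algebraMap K E) →+* B where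
  toFun x := ⟨algebraMap K E x, x.2⟩
  map_one' := Subtype.ext (map_one (algebraMap K E))
  map_mul' x y := Subtype.ext (map_mul (algebraMap K E) (x : K) (y : K))
  map_zero' := Subtype.ext (map_zero (algebraMap K E))
  map_add' x y := Subtype.ext (map_add (algebraMap K E) (x : K) (y : K))

instance isLocalHom_restrictHom : IsLocalHom (restrictHom K B) where
  map_nonunit a ha := by
    obtain ⟨b, hb⟩ := ha.exists_right_inv
    have hb' : algebraMap K E (a : K) * (b : E) = 1 := congrArg Subtype.val hb
    have hmem : (a : K)⁻¹ ∈ B.comap (algebraMap K E) := by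
      rw [ValuationSubring.mem_comap, map_inv₀, ← eq_inv_of_mul_eq_one_right hb']
      exact b.2
    have ha0 : (a : K) ≠ 0 := by
      intro h
      rw [h, map_zero, zero_mul] at hb'
      exact zero_ne_one hb'
    exact IsUnit.of_mul_eq_one (⟨(a : K)⁻¹, hmem⟩ : B.comap (algebraMap K E))
      (Subtype.ext (mul_inv_cancel₀ ha0))

/-- The canonical embedding of residue fields `Kv → Ev`. -/
noncomputable def residueMap : ResidueField (B.comap (algebraMap K E)) →+* ResidueField B :=
  ResidueField.map (restrictHom K B)

/-- The value group `vK`, as a subgroup of the value group `vE`. -/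
noncomputable def valueSubgroup : Subgroup (B.ValueGroup)ˣ :=
  ((Units.map (B.valuation : E →* B.ValueGroup)).comp
    (Units.map (algebraMap K E : K →* E))).range

/-- The extension `(E|K, v)` is immediate: `vK = vE` and `Kv = Ev`. -/
def IsImmediate : Prop :=
  valueSubgroup K B = ⊤ ∧ Function.Surjective (residueMap K B)

/-- The ramification index `(vE : vK)`. -/
noncomputable def ramificationIndex : ℕ := (valueSubgroup K B).index

/-- The inertia degree `[Ev : Kv]`. -/
noncomputable def inertiaDegree : ℕ :=
  letI := (residueMap K B).toAlgebra
  Module.finrank (ResidueField (B.comap (algebraMap K E))) (ResidueField B)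

/-- The residue field extension `Ev|Kv` is separable. -/
def ResidueSeparable : Prop :=
  letI := (residueMap K B).toAlgebra
  Algebra.IsSeparable (ResidueField (B.comap (algebraMap K E))) (ResidueField B)

/-- A finite extension `(E|K, v)`, with `(K, v)` henselian, is defectless:
`[E : K] = (vE : vK) * [Ev : Kv]`. -/
def IsDefectless : Prop :=
  Module.finrank K E = ramificationIndex K B * inertiaDegree K B

/-- `(E|K, v)` is a tame extension: an algebraic extension of the henselian field `(K, v)` (so `(E, v)`
is automatically henselian) such that for every finite subextension `F|K`: `(vF : vK)` is prime to
the residue characteristic if the latter is positive, `Fv|Kv` is separable, and `(F|K, v)` is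
defectless. -/
structure IsTameExtension : Prop where
  henselian : IsHenselian (B.comap (algebraMap K E))
  algebraic : Algebra.IsAlgebraic K E
  te1 : ∀ F : IntermediateField K E, FiniteDimensional K F →
    0 < residueChar (B.comap (algebraMap K E)) →
      (ramificationIndex K (B.comap (algebraMap F E))).Coprime
        (residueChar (B.comap (algebraMap K E)))
  te2 : ∀ F : IntermediateField K E, FiniteDimensional K F →
    ResidueSeparable K (B.comap (algebraMap F E))
  te3 : ∀ F : IntermediateField K E, FiniteDimensional K F →
    IsDefectless K (B.comap (algebraMap F E))

end Extension

/-- `(K, v)` is algebraically maximal: it admits no nontrivial immediate algebraic extension. -/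
def IsAlgebraicallyMaximal {K : Type u} [Field K] (A : ValuationSubring K) : Prop :=
  ∀ (E : Type u) [Field E] [Algebra K E] [Algebra.IsAlgebraic K E] (B : ValuationSubring E),
    B.comap (algebraMap K E) = A → IsImmediate K B → Function.Surjective (algebraMap K E)

section Ramification

variable (K : Type*) {S : Type*} [Field K] [Field S] [Algebra K S] (B : ValuationSubring S)

variable {K B} in
lemma valuation_map_eq {σ : S ≃ₐ[K] S}
    (hσ : ∀ a ∈ B, a ≠ 0 → B.valuation (σ a - a) < B.valuation a) {a : S} (ha : a ∈ B) :
    B.valuation (σ a) = B.valuation a := by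
  rcases eq_or_ne a 0 with rfl | h0
  · simp
  · have := Valuation.map_add_eq_of_lt_right B.valuation (hσ a ha h0)
    simpa using this

/-- The group of all `σ ∈ Aut(S|K)` such that `v(σ a - a) > v a` for all nonzero `a` in the
valuation ring of `S`.  (In multiplicative notation the inequality is reversed.) -/
def ramificationGroup : Subgroup (S ≃ₐ[K] S) where
  carrier := {σ | ∀ a ∈ B, a ≠ 0 → B.valuation (σ a - a) < B.valuation a}
  one_mem' a _ h0 := by
    simpa [zero_lt_iff] using h0
  mul_mem' {σ τ} hσ hτ a ha h0 := by
    have h1 := valuation_map_eq hτ ha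
    have hτa : τ a ∈ B := by
      rw [← ValuationSubring.valuation_le_one_iff] at ha ⊢
      rwa [h1]
    have h2 := hσ (τ a) hτa (by simpa using h0)
    rw [h1] at h2
    have h3 := Valuation.map_add_lt B.valuation h2 (hτ a ha h0)
    simpa using h3
  inv_mem' {σ} hσ a ha h0 := by
    obtain ⟨b, rfl⟩ := σ.surjective a
    have hb0 : b ≠ 0 := by rintro rfl; simp at h0
    have hb : b ∈ B := by
      rcases B.mem_or_inv_mem b with h | h
      · exact h
      · have h1 := valuation_map_eq hσ h
        rw [map_inv₀, map_inv₀, map_inv₀, inv_inj] at h1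
        rw [← ValuationSubring.valuation_le_one_iff] at ha ⊢
        rwa [← h1]
    have h1 : (σ⁻¹ : S ≃ₐ[K] S) (σ b) = b := σ.symm_apply_apply b
    rw [h1, Valuation.map_sub_swap, valuation_map_eq hσ hb]
    exact hσ b hb hb0

end Ramification

section AlgebraicClosure

variable (K : Type*) {Ω : Type*} [Field K] [Field Ω] [Algebra K Ω] (C : ValuationSubring Ω)

/-- The absolute ramification field of `(K, v)`, inside of an algebraic closure `Ω` of `K` that is
equipped with an extension of `v`: the fixed field in the separable closure `K^sep ⊆ Ω` of the
ramification group in `Gal(K^sep|K)`. -/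
noncomputable def absoluteRamificationField : IntermediateField K Ω :=
  IntermediateField.lift (IntermediateField.fixedField
    (ramificationGroup K (C.comap (algebraMap (separableClosure K Ω) Ω))))

/-- An extension `E` of `K` inside of an algebraic closure `Ω` of `K` is purely wild: `(K, v)` is
henselian, and `E|K` is algebraic and linearly disjoint from the absolute ramification field of
`(K, v)`. -/
structure IsPurelyWild (E : IntermediateField K Ω) : Prop where
  henselian : IsHenselian (C.comap (algebraMap K Ω))
  algebraic : Algebra.IsAlgebraic K E
  linearDisjoint : E.LinearDisjoint (absoluteRamificationField K C)

end AlgebraicClosure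

end ValuedField

/-! Write `Z` for the absolute ramification field of `K`, and `a ~ b` for equality up to a one-unit
(`Sim`). An automorphism is in the ramification group iff `σ a ~ a` for all `a ≠ 0`; an extension is
immediate if every nonzero element is `~` to one of the base field; in residue characteristic `p`,
`a ^ p ~ b ^ p` implies `a ~ b`. Henselianity is used in the form that all automorphisms of `Ω` over
`K` preserve the valuation ring (`Stable`).

Part a) holds because the finite tame extensions of `K` inside `Ω` are exactly the finite
subextensions of `Z`. A finite Galois extension inside `Z` has trivial ramification group, so its
inertia group embeds into the characters of the quotient of value groups; comparing orders with the
fundamental inequality gives tameness (`isFiniteTame_of_ramificationGroup_eq_bot`). Conversely, if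
`E` is finite and tame, Hensel's Lemma shows that `E ∩ Z` has the same residue field and value group
as `E`, and defectlessness forces `E ∩ Z = E`
(`Stable.mem_absoluteRamificationField_of_isFiniteTame`).

For b), the heart is that `L` and `Z` generate `Ω`: an automorphism over `L` that fixes `Z` is in
the ramification group of `L`, and this group is trivial
(`IsAlgebraicallyMaximal.ramificationGroup_eq_bot`). Indeed, in a finite Galois extension of `L` the
ramification group is a normal `p`-group, of index prime to `p` by Kaplansky's hypothesis; the fixed
field of a Schur-Zassenhaus complement is immediate over `L`, hence equal to `L`. Since `Z` is
Galois over `Z₀ = L ∩ Z`, it is linearly disjoint from `L`; a field above `L` that is still linearly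
disjoint from `Z` cannot exceed `L`, as `L` and `Z` already generate everything.

For c), elements of `Lv` separable over `Z₀v` lift into `L ∩ Z = Z₀`, so `Lv` is purely inseparable
over `Z₀v` and separable extensions of `Z₀v` keep their degree over `Lv`. There, a normal basis and
a suitable additive polynomial exclude degrees divisible by `p`
(`PPolynomialsHaveZeros.not_dvd_finrank`). -/

namespace ValuedField

open scoped Pointwise

/-! ### Equality up to one-units -/

section OneUnits

variable {E : Type*} [Field E] (B : ValuationSubring E)

/-- `a` and `b` agree up to a one-unit: `v (a - b) > v b` in additive notation. -/
def Sim (a b : E) : Prop := B.valuation (a - b) < B.valuation b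

variable {B}

lemma Sim.ne_zero {a b : E} (h : Sim B a b) : b ≠ 0 := by
  rintro rfl
  simp [Sim] at h

lemma Sim.valuation_eq {a b : E} (h : Sim B a b) : B.valuation a = B.valuation b := by
  have := Valuation.map_add_eq_of_lt_right B.valuation h
  simpa using this

lemma Sim.ne_zero' {a b : E} (h : Sim B a b) : a ≠ 0 := by
  rintro rfl
  have := h.valuation_eq
  rw [map_zero, eq_comm, map_eq_zero] at this
  exact h.ne_zero this

lemma Sim.refl {a : E} (ha : a ≠ 0) : Sim B a a := by
  simpa [Sim, zero_lt_iff] using ha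

lemma Sim.symm {a b : E} (h : Sim B a b) : Sim B b a := by
  have h1 := h.valuation_eq
  unfold Sim at *
  rw [Valuation.map_sub_swap, h1]
  exact h

lemma Sim.trans {a b c : E} (h : Sim B a b) (h' : Sim B b c) : Sim B a c := by
  have h1 := h'.valuation_eq
  unfold Sim at *
  rw [h1] at h
  simpa using Valuation.map_add_lt B.valuation h h'

lemma Sim.mul {a b c d : E} (h : Sim B a b) (h' : Sim B c d) : Sim B (a * c) (b * d) := by
  have h1 := h'.valuation_eq
  have h2 := h.ne_zero
  have h3 := h'.ne_zero
  unfold Sim at *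
  have e : a * c - b * d = (a - b) * c + b * (c - d) := by ring
  rw [e]
  refine Valuation.map_add_lt B.valuation ?_ ?_
  · rw [map_mul, map_mul, h1]
    exact mul_lt_mul_of_pos_right h (by simpa [zero_lt_iff] using h3)
  · rw [map_mul, map_mul]
    exact mul_lt_mul_of_pos_left h' (by simpa [zero_lt_iff] using h2)

lemma Sim.inv {a b : E} (h : Sim B a b) : Sim B a⁻¹ b⁻¹ := by
  have h1 := (h.symm.mul (Sim.refl (inv_ne_zero h.ne_zero'))).mul
    (Sim.refl (inv_ne_zero h.ne_zero))
  have ha := h.ne_zero'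
  have hb := h.ne_zero
  have e1 : b * a⁻¹ * b⁻¹ = a⁻¹ := by field_simp
  have e2 : a * a⁻¹ * b⁻¹ = b⁻¹ := by field_simp
  rwa [e1, e2] at h1

lemma Sim.div {a b c d : E} (h : Sim B a b) (h' : Sim B c d) : Sim B (a / c) (b / d) := by
  rw [div_eq_mul_inv, div_eq_mul_inv]
  exact h.mul h'.inv

lemma Sim.pow {a b : E} (h : Sim B a b) (n : ℕ) : Sim B (a ^ n) (b ^ n) := by
  induction n with
  | zero => simpa using Sim.refl (B := B) (one_ne_zero (α := E))
  | succ n ih => rw [pow_succ, pow_succ]; exact ih.mul h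

lemma Sim.prod {ι : Type*} (s : Finset ι) {f g : ι → E} (h : ∀ i ∈ s, Sim B (f i) (g i)) :
    Sim B (∏ i ∈ s, f i) (∏ i ∈ s, g i) := by
  classical
  induction s using Finset.induction_on with
  | empty => simpa using Sim.refl (B := B) (one_ne_zero (α := E))
  | insert i s hi ih =>
    rw [Finset.prod_insert hi, Finset.prod_insert hi]
    exact (h i (Finset.mem_insert_self i s)).mul
      (ih fun j hj => h j (Finset.mem_insert_of_mem hj))

lemma sim_div_iff {a b c d : E} (hc : c ≠ 0) (hb : b ≠ 0) (hd : d ≠ 0) :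
    Sim B (a / b) (c / d) ↔ Sim B (a * d) (c * b) := by
  have e1 : a / b * (b * d) = a * d := by field_simp
  have e2 : c / d * (b * d) = c * b := by field_simp
  have e3 : a * d / (b * d) = a / b := by field_simp
  have e4 : c * b / (b * d) = c / d := by field_simp
  constructor
  · intro h
    have := h.mul (Sim.refl (B := B) (mul_ne_zero hb hd))
    rwa [e1, e2] at this
  · intro h
    have := h.div (Sim.refl (B := B) (mul_ne_zero hb hd))
    rwa [e3, e4] at this

lemma sim_one_iff {a b : E} (hb : b ≠ 0) : Sim B (a / b) 1 ↔ Sim B a b := by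
  have := sim_div_iff (B := B) (a := a) (b := b) (c := 1) (d := 1) one_ne_zero hb one_ne_zero
  simpa using this

lemma sim_one_def {a : E} : Sim B a 1 ↔ B.valuation (a - 1) < 1 := by
  simp [Sim]

lemma sim_iff_residue_eq {a b : B} (hb : IsUnit b) :
    Sim B (a : E) b ↔ residue B a = residue B b := by
  rw [Sim, (B.valuation_eq_one_iff b).1 hb, ← sub_eq_zero, ← map_sub, residue_eq_zero_iff,
    ValuationSubring.valuation_lt_one_iff]
  rfl

lemma isUnit_iff_residue_ne_zero {a : B} : IsUnit a ↔ residue B a ≠ 0 :=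
  (residue_ne_zero_iff_isUnit a).symm

lemma mem_of_valuation_eq_one {a : E} (h : B.valuation a = 1) : a ∈ B :=
  (B.valuation_le_one_iff a).1 h.le

instance charP_residueChar : CharP (ResidueField B) (residueChar B) :=
  ringChar.charP _

lemma residueChar_prime_or_zero : (residueChar B).Prime ∨ residueChar B = 0 :=
  CharP.char_is_prime_or_zero (ResidueField B) _

/-- In residue characteristic `p`, raising to the power `p` is injective modulo one-units. -/
lemma Sim.of_pow_residueChar (hp : (residueChar B).Prime) {a b : E} (hb : b ≠ 0)
    (h : Sim B (a ^ residueChar B) (b ^ residueChar B)) : Sim B a b := by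
  rw [← sim_one_iff hb]
  rw [← sim_one_iff (pow_ne_zero _ hb), ← div_pow] at h
  set x := a / b
  have hx1 : B.valuation x = 1 := by
    have := h.valuation_eq
    rw [map_one, map_pow] at this
    exact (pow_eq_one_iff_of_nonneg zero_le hp.ne_zero).1 this
  have hxB : x ∈ B := mem_of_valuation_eq_one hx1
  have : Sim B (((⟨x, hxB⟩ : B) ^ residueChar B : B) : E) ((1 : B) : E) := by simpa using h
  rw [sim_iff_residue_eq isUnit_one, map_pow, map_one] at this
  have hf : Fact (residueChar B).Prime := ⟨hp⟩
  have h2 : residue B ⟨x, hxB⟩ = 1 := by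
    apply frobenius_inj (ResidueField B) (residueChar B)
    simpa [frobenius_def] using this
  have := (sim_iff_residue_eq (B := B) (a := ⟨x, hxB⟩) (b := 1) isUnit_one).2 (by simpa using h2)
  simpa using this

lemma Sim.of_pow_residueChar_pow (hp : (residueChar B).Prime) {a b : E} (hb : b ≠ 0) (n : ℕ)
    (h : Sim B (a ^ residueChar B ^ n) (b ^ residueChar B ^ n)) : Sim B a b := by
  induction n generalizing a b with
  | zero => simpa using h
  | succ n ih =>
    refine Sim.of_pow_residueChar hp hb (ih (pow_ne_zero _ hb) ?_)
    rwa [← pow_mul, ← pow_mul, ← pow_succ']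

lemma valuation_natCast_eq_one {m : ℕ} (hm : ¬ residueChar B ∣ m) : B.valuation (m : E) = 1 := by
  have h : residue B (m : B) ≠ 0 := by
    rw [map_natCast]
    rwa [Ne, CharP.cast_eq_zero_iff (ResidueField B) (residueChar B)]
  have := (B.valuation_eq_one_iff _).1 (isUnit_iff_residue_ne_zero.2 h)
  simpa using this

/-- Roots of unity of order prime to the residue characteristic are determined by their residue. -/
lemma Sim.eq_of_pow_eq {m : ℕ} (hm : ¬ residueChar B ∣ m) {a b : E} (h : Sim B a b)
    (hab : a ^ m = b ^ m) : a = b := by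
  have hb := h.ne_zero
  have h1 : Sim B (a / b) 1 := (sim_one_iff hb).2 h
  set x := a / b with hx
  have hxm : x ^ m = 1 := by rw [hx, div_pow, hab, div_self (pow_ne_zero _ hb)]
  by_contra hne
  have hx1 : x - 1 ≠ 0 := fun h0 => hne ((div_eq_one_iff_eq hb).1 (sub_eq_zero.1 h0))
  have hsum : ∑ i ∈ Finset.range m, x ^ i = 0 := by
    have := geom_sum_mul x m
    rw [hxm, sub_self] at this
    exact (mul_eq_zero.1 this).resolve_right hx1
  -- If `x ≠ 1`, the sum `1 + x + ... + x ^ (m - 1)` vanishes although every summand is a one-unit;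
  -- this would put `m` into the maximal ideal.
  have h2 : B.valuation (∑ i ∈ Finset.range m, (1 - x ^ i)) < 1 := by
    refine Valuation.map_sum_lt B.valuation one_ne_zero fun i _ => ?_
    have := h1.pow i
    rw [one_pow, sim_one_def, Valuation.map_sub_swap] at this
    exact this
  rw [Finset.sum_sub_distrib, hsum] at h2
  simp [valuation_natCast_eq_one hm] at h2

section Comap

variable {F : Type*} [Field F]

/-- The two valuations take values in different types, so only comparisons can be transported; each
reduces to membership of `x / y` in the ring. -/
lemma comap_valuation_le_iff (φ : F →+* E) {x y : F} :
    (B.comap φ).valuation x ≤ (B.comap φ).valuation y ↔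
      B.valuation (φ x) ≤ B.valuation (φ y) := by
  rcases eq_or_ne y 0 with rfl | hy
  · simp
  · have h1 : 0 < (B.comap φ).valuation y := by simpa [zero_lt_iff] using hy
    have h2 : 0 < B.valuation (φ y) := by simpa [zero_lt_iff] using hy
    rw [← div_le_one₀ h1, ← div_le_one₀ h2, ← map_div₀, ← map_div₀, ← map_div₀,
      ValuationSubring.valuation_le_one_iff, ValuationSubring.valuation_le_one_iff,
      ValuationSubring.mem_comap]

lemma comap_valuation_lt_iff (φ : F →+* E) {x y : F} :
    (B.comap φ).valuation x < (B.comap φ).valuation y ↔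
      B.valuation (φ x) < B.valuation (φ y) := by
  rw [← not_le, ← not_le, comap_valuation_le_iff]

lemma comap_valuation_eq_iff (φ : F →+* E) {x y : F} :
    (B.comap φ).valuation x = (B.comap φ).valuation y ↔
      B.valuation (φ x) = B.valuation (φ y) := by
  rw [le_antisymm_iff, le_antisymm_iff, comap_valuation_le_iff, comap_valuation_le_iff]

lemma comap_valuation_lt_one_iff (φ : F →+* E) {x : F} :
    (B.comap φ).valuation x < 1 ↔ B.valuation (φ x) < 1 := by
  have := comap_valuation_lt_iff (B := B) φ (x := x) (y := 1)
  simpa using this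

lemma comap_valuation_eq_one_iff (φ : F →+* E) {x : F} :
    (B.comap φ).valuation x = 1 ↔ B.valuation (φ x) = 1 := by
  have := comap_valuation_eq_iff (B := B) φ (x := x) (y := 1)
  simpa using this

lemma sim_comap_iff (φ : F →+* E) {x y : F} : Sim (B.comap φ) x y ↔ Sim B (φ x) (φ y) := by
  rw [Sim, comap_valuation_lt_iff, map_sub, Sim]

end Comap

end OneUnits

/-! ### Residue characteristic of subfields -/

section ResidueMap

variable (K : Type*) {E : Type*} [Field K] [Field E] [Algebra K E] (B : ValuationSubring E)

lemma residueChar_comap : residueChar (B.comap (algebraMap K E)) = residueChar B := by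
  have := (RingHom.charP_iff (residueMap K B) (residueMap K B).injective
    (residueChar B)).2 inferInstance
  exact ringChar.eq_iff.2 this

end ResidueMap

/-! ### Additive polynomials and separable extensions in characteristic `p` -/

section PPolynomials

lemma IsAdditivePolynomial.eval_add {k : Type*} [Field k] {p : ℕ} [Fact p.Prime] [CharP k p]
    {f : k[X]} (hf : IsAdditivePolynomial p f) (x y : k) :
    f.eval (x + y) = f.eval x + f.eval y := by
  obtain ⟨n, c, rfl⟩ := hf
  simp only [eval_finsetSum, eval_mul, eval_C, eval_pow, eval_X, ← Finset.sum_add_distrib,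
    add_pow_char_pow, mul_add]

lemma IsAdditivePolynomial.eval_sub {k : Type*} [Field k] {p : ℕ} [Fact p.Prime] [CharP k p]
    {f : k[X]} (hf : IsAdditivePolynomial p f) (x y : k) :
    f.eval (x - y) = f.eval x - f.eval y := by
  rw [eq_sub_iff_add_eq, ← hf.eval_add, sub_add_cancel]

lemma IsAdditivePolynomial.coeff_eq_zero {k : Type*} [Field k] {p : ℕ}
    {f : k[X]} (hf : IsAdditivePolynomial p f) {m : ℕ} (hm : ∀ i, m ≠ p ^ i) : f.coeff m = 0 := by
  obtain ⟨n, c, rfl⟩ := hf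
  rw [finsetSum_coeff]
  refine Finset.sum_eq_zero fun i _ => ?_
  rw [coeff_C_mul, coeff_X_pow, if_neg (hm i), mul_zero]

/-- The criterion by coefficients is what passes to `f ^ p - c ^ (p - 1) f` and what descends from a
field to a subfield. -/
lemma isAdditivePolynomial_of_coeff {k : Type*} [Field k] {p : ℕ} (hp : 1 < p)
    {f : k[X]} (hf : ∀ m, (∀ i, m ≠ p ^ i) → f.coeff m = 0) : IsAdditivePolynomial p f := by
  -- The degree is a safe bound for the exponents: if `i` exceeds it, then so does `p ^ i > i`.
  refine ⟨f.natDegree, fun i => f.coeff (p ^ i), ?_⟩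
  ext m
  rw [finsetSum_coeff]
  simp only [coeff_C_mul, coeff_X_pow]
  by_cases h : ∃ i, m = p ^ i
  · obtain ⟨i, rfl⟩ := h
    have hinj : ∀ j, p ^ i = p ^ j ↔ i = j := fun j => (Nat.pow_right_injective hp).eq_iff
    simp only [hinj, mul_ite, mul_one, mul_zero, Finset.sum_ite_eq, Finset.mem_range]
    split_ifs with h
    · rfl
    · refine coeff_eq_zero_of_natDegree_lt (lt_of_lt_of_le ?_ (Nat.lt_pow_self hp).le)
      omega
  · push Not at h
    rw [hf m h, Finset.sum_eq_zero]
    intro i _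
    rw [if_neg (h i), mul_zero]

/-- Every finite additive subgroup of a field of characteristic `p` is the zero set of a monic
additive polynomial whose degree is the order of the group. -/
theorem exists_additive_polynomial {N : Type*} [Field N] {p : ℕ} [Fact p.Prime] [CharP N p]
    [Algebra (ZMod p) N] (V : Submodule (ZMod p) N) (hV : V.FG) :
    ∃ f : N[X], IsAdditivePolynomial p f ∧ f.Monic ∧ f.natDegree = p ^ Module.finrank (ZMod p) V ∧
      ∀ x, f.eval x = 0 ↔ x ∈ V := by
  classical
  have hp : p.Prime := Fact.out
  obtain ⟨s, rfl⟩ := hV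
  induction s using Finset.induction_on with
  | empty =>
    refine ⟨X, ⟨0, fun _ => 1, by simp⟩, monic_X, ?_, by simp⟩
    rw [Finset.coe_empty, Submodule.span_empty, finrank_bot, natDegree_X, pow_zero]
  | insert w s hw ih =>
    obtain ⟨f, hf, hm, hd, hr⟩ := ih
    rw [Finset.coe_insert, Submodule.span_insert]
    set V := Submodule.span (ZMod p) (s : Set N)
    by_cases hwV : w ∈ V
    · have : Submodule.span (ZMod p) {w} ⊔ V = V := by
        rw [sup_eq_right, Submodule.span_singleton_le_iff_mem]
        exact hwV
      rw [this]
      exact ⟨f, hf, hm, hd, hr⟩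
    have hc : f.eval w ≠ 0 := fun h => hwV ((hr w).1 h)
    set c := f.eval w
    have hfin : Module.Finite (ZMod p) V := Module.Finite.span_finset _ s
    have hpos : 0 < f.natDegree := by rw [hd]; exact pow_pos hp.pos _
    have hw0 : w ≠ 0 := by
      rintro rfl
      exact hwV V.zero_mem
    have hlt : (C (c ^ (p - 1)) * f).natDegree < (f ^ p).natDegree := by
      rw [natDegree_C_mul (pow_ne_zero _ hc), natDegree_pow]
      nlinarith [hp.one_lt]
    have hdisj : Disjoint (Submodule.span (ZMod p) {w}) V := by
      rw [disjoint_comm, Submodule.disjoint_span_singleton' hw0]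
      exact hwV
    -- Up to the scaling by `c = f w`, this is `y ^ p - y` evaluated at `y = f x / c`. Its zeros are
    -- the `x` with `f x` in `𝔽_p c`, that is, the elements of `V + 𝔽_p w`.
    refine ⟨f ^ p - C (c ^ (p - 1)) * f, ?_, ?_, ?_, ?_⟩
    · obtain ⟨n, b, rfl⟩ := hf
      refine isAdditivePolynomial_of_coeff hp.one_lt fun m hm => ?_
      rw [sum_pow_char, coeff_sub, finsetSum_coeff, coeff_C_mul, finsetSum_coeff]
      rw [Finset.sum_eq_zero, Finset.sum_eq_zero]
      · simp
      · intro i _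
        rw [coeff_C_mul, coeff_X_pow, if_neg (hm i), mul_zero]
      · intro i _
        rw [mul_pow, ← pow_mul, ← C_pow, coeff_C_mul, coeff_X_pow, if_neg, mul_zero]
        rw [← pow_succ]
        exact hm (i + 1)
    · refine (hm.pow p).sub_of_left ?_
      exact degree_lt_degree hlt
    · rw [natDegree_sub_eq_left_of_natDegree_lt hlt, natDegree_pow, hd]
      have h1 := Submodule.finrank_sup_add_finrank_inf_eq (Submodule.span (ZMod p) {w}) V
      rw [hdisj.eq_bot, finrank_bot, add_zero, finrank_span_singleton hw0] at h1
      rw [h1, pow_add, pow_one]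
    · intro x
      have key : (f ^ p - C (c ^ (p - 1)) * f).eval x = 0 ↔ (f.eval x / c) ^ p = f.eval x / c := by
        rw [eval_sub, eval_pow, eval_mul, eval_C, sub_eq_zero, div_pow, div_eq_div_iff
          (pow_ne_zero _ hc) hc]
        obtain ⟨q, rfl⟩ : ∃ q, p = q + 1 := ⟨p - 1, by have := hp.one_lt; omega⟩
        rw [Nat.add_sub_cancel, pow_succ c q, ← mul_assoc, mul_left_inj' hc]
        rw [mul_comm (c ^ q)]
      have hlin : ∀ (j : ZMod p) (y : N), f.eval (j • y) = j • f.eval y := fun j y =>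
        ZMod.map_smul (AddMonoidHom.mk' (fun z => f.eval z) hf.eval_add) j y
      rw [key, Submodule.mem_sup]
      constructor
      · intro h
        have hmem : f.eval x / c ∈ (⊥ : Subfield N) := (Subfield.mem_bot_iff_pow_eq_self N p).2 h
        rw [← ZMod.fieldRange_castHom_eq_bot p] at hmem
        obtain ⟨j, hj⟩ := hmem
        have hj' : f.eval x = j • c := by
          rw [Algebra.smul_def, Subsingleton.elim (algebraMap (ZMod p) N) (ZMod.castHom dvd_rfl N),
            hj, div_mul_cancel₀ _ hc]
        refine ⟨j • w, Submodule.smul_mem _ _ (Submodule.mem_span_singleton_self w), x - j • w,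
          (hr _).1 ?_, by abel⟩
        rw [hf.eval_sub, hlin, hj', sub_self]
      · rintro ⟨y, hy, z, hz, rfl⟩
        obtain ⟨j, rfl⟩ := Submodule.mem_span_singleton.1 hy
        rw [hf.eval_add, (hr z).2 hz, add_zero, hlin, Algebra.smul_def,
          mul_div_cancel_right₀ _ hc, ← map_pow, ZMod.pow_card]

/-- A field over which every `p`-polynomial has a zero has no finite Galois extension of degree
divisible by `p`. -/
theorem PPolynomialsHaveZeros.not_dvd_finrank_of_isGalois {k N : Type*} [Field k] [Field N]
    [Algebra k N] [FiniteDimensional k N] [IsGalois k N] {p : ℕ} [Fact p.Prime] [CharP k p]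
    (hk : PPolynomialsHaveZeros k p) : ¬ p ∣ Module.finrank k N := by
  classical
  intro hdvd
  have hp : p.Prime := Fact.out
  have hN : CharP N p := charP_of_injective_algebraMap (algebraMap k N).injective p
  let : Algebra (ZMod p) N := ZMod.algebra N p
  let : Algebra (ZMod p) k := ZMod.algebra k p
  have : IsScalarTower (ZMod p) k N := IsScalarTower.of_algebraMap_eq' (Subsingleton.elim _ _)
  -- Let `V` be the `𝔽_p`-span of all `σ θ - θ` and `f` its additive polynomial. Since `V` is Galois
  -- stable, `f` has coefficients in `k`; since `f` kills `σ θ - θ`, also `f θ` lies in `k`. The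
  -- hypothesis gives `x` in `k` with `f x = f θ`, so `x ∈ θ + V`. Expanding `x` in the normal basis
  -- will give a contradiction.
  set θ : N := IsGalois.normalBasis k N 1
  have hli : LinearIndependent (ZMod p) fun σ : N ≃ₐ[k] N => σ θ := by
    have h1 := (IsGalois.normalBasis k N).linearIndependent
    have h2 : ⇑(IsGalois.normalBasis k N) = fun σ : N ≃ₐ[k] N => σ θ :=
      funext fun σ => IsGalois.normalBasis_apply σ
    rw [h2] at h1
    exact h1.restrict_scalars' (ZMod p)
  let V : Submodule (ZMod p) N :=
    Submodule.span (ZMod p) (Set.range fun σ : N ≃ₐ[k] N => σ θ - θ)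
  have hVfg : V.FG := Submodule.fg_span (Set.finite_range _)
  obtain ⟨f, hadd, hmonic, hdeg, hroot⟩ := exists_additive_polynomial V hVfg
  have hsmul : ∀ (τ : N ≃ₐ[k] N) (j : ZMod p) (y : N), τ (j • y) = j • τ y := fun τ j y =>
    ZMod.map_smul τ j y
  have hVstab : ∀ (τ : N ≃ₐ[k] N) (x : N), x ∈ V → τ x ∈ V := by
    intro τ x hx
    induction hx using Submodule.span_induction with
    | mem x hx =>
      obtain ⟨σ, rfl⟩ := hx
      have : τ (σ θ - θ) = ((τ * σ) θ - θ) - (τ θ - θ) := by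
        rw [map_sub, AlgEquiv.mul_apply]; ring
      rw [this]
      exact V.sub_mem (Submodule.subset_span ⟨_, rfl⟩) (Submodule.subset_span ⟨_, rfl⟩)
    | zero => rw [map_zero]; exact V.zero_mem
    | add x y _ _ hx hy => rw [map_add]; exact V.add_mem hx hy
    | smul j x _ hx => rw [hsmul]; exact V.smul_mem j hx
  have hmap : ∀ τ : N ≃ₐ[k] N, f.map (τ : N →+* N) = f := by
    intro τ
    have hfinV : Module.Finite (ZMod p) V := Module.Finite.iff_fg.2 hVfg
    have hfinV' : Finite V := Module.finite_of_finite (ZMod p)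
    have hcard : Nat.card V = f.natDegree := by
      rw [hdeg, Module.natCard_eq_pow_finrank (K := ZMod p), Nat.card_zmod]
    have hfs : (V : Set N).Finite := hfinV'
    -- Both polynomials are monic of degree `|V|` and vanish on `V`.
    refine Polynomial.eq_of_degree_sub_lt_of_eval_finset_eq hfs.toFinset ?_ ?_
    · have hc : (hfs.toFinset.card : WithBot ℕ) = f.degree := by
        rw [degree_eq_natDegree hmonic.ne_zero, ← hcard, ← Set.ncard_eq_toFinset_card _ hfs]
        rfl
      rw [hc]
      have h1 : (f.map (τ : N →+* N)).degree = f.degree := degree_map _ _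
      rw [← h1]
      refine degree_sub_lt_left h1 ((hmonic.map _).ne_zero) ?_
      rw [(hmonic.map _).leadingCoeff, hmonic.leadingCoeff]
    · intro x hx
      rw [Set.Finite.mem_toFinset] at hx
      rw [(hroot x).2 hx]
      have hx' := hVstab τ.symm x hx
      have h2 := (hroot _).2 hx'
      have h3 : (f.map (τ : N →+* N)).eval ((τ : N →+* N) (τ.symm x)) = (τ : N →+* N) 0 := by
        rw [eval_map_apply, h2]
      simpa using h3
  have hmemk : ∀ y : N, (∀ τ : N ≃ₐ[k] N, τ y = y) → ∃ b : k, algebraMap k N b = y := fun y hy =>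
    (IsGalois.mem_range_algebraMap_iff_fixed y).2 hy
  have hlift : f ∈ Polynomial.lifts (algebraMap k N) := by
    rw [Polynomial.lifts_iff_coeff_lifts]
    intro m
    refine hmemk _ fun τ => ?_
    have := congrArg (fun g => g.coeff m) (hmap τ)
    simpa using this
  obtain ⟨g, hg⟩ := (Polynomial.mem_lifts f).1 hlift
  have hgadd : IsAdditivePolynomial p g := by
    refine isAdditivePolynomial_of_coeff hp.one_lt fun m hm => ?_
    apply (algebraMap k N).injective
    rw [map_zero, ← coeff_map, hg]
    exact hadd.coeff_eq_zero hm
  have hg0 : g ≠ 0 := by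
    rintro rfl
    rw [Polynomial.map_zero] at hg
    exact hmonic.ne_zero hg.symm
  obtain ⟨b, hb⟩ := hmemk (f.eval θ) fun τ => by
    have h1 : f.eval (τ θ - θ) = 0 := (hroot _).2 (Submodule.subset_span ⟨τ, rfl⟩)
    rw [hadd.eval_sub, sub_eq_zero] at h1
    have h2 : (f.map (τ : N →+* N)).eval (τ θ) = τ (f.eval θ) := eval_map_apply (τ : N →+* N) θ
    rw [hmap] at h2
    exact h2.symm.trans h1
  obtain ⟨x, hx⟩ := hk g (-b) hgadd hg0
  have hx' : f.eval (algebraMap k N x) = f.eval θ := by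
    rw [IsRoot, eval_add, eval_C, add_neg_eq_zero] at hx
    rw [← hg, eval_map_apply, hx, hb, hg]
  have hxV : algebraMap k N x - θ ∈ V := by
    rw [← hroot, hadd.eval_sub, hx', sub_self]
  -- elements of `V` are combinations of the conjugates of `θ` with coefficient sum zero
  have hcomb : ∀ y ∈ V, ∃ c : (N ≃ₐ[k] N) → ZMod p, ∑ σ, c σ = 0 ∧ y = ∑ σ, c σ • σ θ := by
    intro y hy
    induction hy using Submodule.span_induction with
    | mem x hx =>
      obtain ⟨σ, rfl⟩ := hx
      refine ⟨Pi.single σ 1 - Pi.single 1 1, ?_, ?_⟩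
      · simp
      · simp [sub_smul, Pi.single_apply]
    | zero => exact ⟨0, by simp, by simp⟩
    | add x y _ _ hx hy =>
      obtain ⟨c, hc, rfl⟩ := hx
      obtain ⟨d, hd, rfl⟩ := hy
      exact ⟨c + d, by simp [Finset.sum_add_distrib, hc, hd],
        by simp [Finset.sum_add_distrib, add_smul]⟩
    | smul j x _ hx =>
      obtain ⟨c, hc, rfl⟩ := hx
      exact ⟨j • c, by simp [← Finset.mul_sum, hc], by simp [Finset.smul_sum, mul_smul]⟩
  obtain ⟨c, hc0, hc⟩ := hcomb _ hxV
  -- The coefficients of `x = θ + (x - θ)` in the normal basis have sum `1`. As `x` is Galois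
  -- invariant they are all equal, so their sum is a multiple of the group order, which is `0` in
  -- `𝔽_p`.
  set d : (N ≃ₐ[k] N) → ZMod p := c + Pi.single 1 1 with hd
  have hd1 : ∑ σ, d σ = 1 := by simp [hd, Finset.sum_add_distrib, hc0]
  have hdx : algebraMap k N x = ∑ σ, d σ • σ θ := by
    have : ∑ σ, d σ • σ θ = ∑ σ, c σ • σ θ + θ := by
      simp [hd, add_smul, Finset.sum_add_distrib, Pi.single_apply]
    rw [this, ← hc, sub_add_cancel]
  have hconst : ∀ τ, d τ = d 1 := by
    intro τ
    have h1 : ∑ σ, d (τ * σ) • (τ * σ) θ = ∑ σ, d σ • (τ * σ) θ := by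
      rw [Fintype.sum_equiv (Equiv.mulLeft τ) (fun σ => d (τ * σ) • (τ * σ) θ)
        (fun σ => d σ • σ θ) (fun σ => rfl), ← hdx]
      rw [← τ.commutes x, hdx, map_sum]
      exact Finset.sum_congr rfl fun σ _ => hsmul τ _ _
    have h2 : LinearIndependent (ZMod p) fun σ : N ≃ₐ[k] N => (τ * σ) θ :=
      hli.comp _ (Equiv.mulLeft τ).injective
    have h3 : ∑ σ, (d (τ * σ) - d σ) • (τ * σ) θ = 0 := by
      simp only [sub_smul, Finset.sum_sub_distrib, h1, sub_self]
    have h4 := Fintype.linearIndependent_iff.1 h2 _ h3 1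
    rwa [mul_one, sub_eq_zero] at h4
  have : (∑ σ, d σ) = 0 := by
    rw [Finset.sum_congr rfl fun σ _ => hconst σ, Finset.sum_const, Finset.card_univ,
      ← Nat.card_eq_fintype_card, IsGalois.card_aut_eq_finrank, nsmul_eq_mul,
      (CharP.cast_eq_zero_iff (ZMod p) p _).2 hdvd, zero_mul]
  rw [hd1] at this
  exact one_ne_zero this

/-- A field over which every `p`-polynomial has a zero has no finite separable extension of degree
divisible by `p`. -/
theorem PPolynomialsHaveZeros.not_dvd_finrank {k F : Type*} [Field k] [Field F]
    [Algebra k F] [FiniteDimensional k F] [Algebra.IsSeparable k F] {p : ℕ} [Fact p.Prime]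
    [CharP k p] (hk : PPolynomialsHaveZeros k p) : ¬ p ∣ Module.finrank k F := by
  intro h
  -- The Galois closure of `F`; its degree is a multiple of that of `F`.
  let N := IntermediateField.normalClosure k F (SeparableClosure F)
  have hsep : Algebra.IsSeparable k (SeparableClosure F) := Algebra.IsSeparable.trans k F _
  have hclos : IsSepClosure k (SeparableClosure F) :=
    ⟨IsSepClosure.sep_closed F, hsep⟩
  have hgal : IsGalois k (SeparableClosure F) := inferInstance
  refine hk.not_dvd_finrank_of_isGalois (N := N) (h.trans ?_)
  let : Algebra F N := normalClosure.algebra k F (SeparableClosure F)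
  exact Dvd.intro _ (Module.finrank_mul_finrank k F N)

lemma PPolynomialsHaveZeros.exists_pow_eq {k : Type*} [Field k] {p : ℕ} [Fact p.Prime]
    (hk : PPolynomialsHaveZeros k p) (a : k) : ∃ b : k, b ^ p = a := by
  have hadd : IsAdditivePolynomial p (X ^ p : k[X]) := by
    refine ⟨1, fun i => if i = 1 then 1 else 0, ?_⟩
    simp
  obtain ⟨x, hx⟩ := hk (X ^ p) (-a) hadd (pow_ne_zero _ X_ne_zero)
  refine ⟨x, ?_⟩
  simpa [IsRoot, add_neg_eq_zero] using hx

end PPolynomials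

/-! ### Integral closure of a henselian valuation ring -/

section Henselian

/-- If `x` is a zero of a polynomial over an integrally closed local ring one of whose coefficients
is a unit, then `x` or its inverse lies in the ring. -/
lemma mem_or_inv_mem_of_aeval_eq_zero {D E : Type*} [CommRing D] [IsLocalRing D] [Field E]
    [Algebra D E] [FaithfulSMul D E] [IsIntegrallyClosedIn D E] (x : E) (n : ℕ) (f : D[X])
    (hn : f.natDegree ≤ n) (hf : aeval x f = 0) (hu : ∃ i, IsUnit (f.coeff i)) :
    (∃ b : D, algebraMap D E b = x) ∨ ∃ b : D, algebraMap D E b = x⁻¹ := by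
  induction n generalizing f with
  | zero =>
    obtain ⟨i, hi⟩ := hu
    have h0 : i = 0 := by
      by_contra h
      rw [coeff_eq_zero_of_natDegree_lt (by omega)] at hi
      exact not_isUnit_zero hi
    subst h0
    rw [eq_C_of_natDegree_le_zero hn, aeval_C] at hf
    exact absurd hf (hi.map (algebraMap D E)).ne_zero
  | succ m ih =>
    have hint : IsIntegral D (f.coeff (m + 1) • x) := by
      rcases hn.lt_or_eq with h | h
      · rw [coeff_eq_zero_of_natDegree_lt h, zero_smul]
        exact isIntegral_zero
      · rw [← h]
        exact isIntegral_leadingCoeff_smul f x hf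
    obtain ⟨b, hb⟩ := IsIntegrallyClosedIn.isIntegral_iff.1 hint
    set c := f.coeff (m + 1) with hc
    rw [Algebra.smul_def] at hb
    by_cases hcu : IsUnit c
    · obtain ⟨d, hd⟩ := hcu.exists_left_inv
      refine Or.inl ⟨d * b, ?_⟩
      rw [map_mul, hb, ← mul_assoc, ← map_mul, hd, map_one, one_mul]
    by_cases hbu : IsUnit b
    · obtain ⟨d, hd⟩ := hbu.exists_left_inv
      refine Or.inr ⟨d * c, ?_⟩
      refine eq_inv_of_mul_eq_one_left ?_
      rw [map_mul, mul_assoc, ← hb, ← map_mul, hd, map_one]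
    -- With `b = c x` the top term `c x ^ (m + 1)` equals `b x ^ m`, which lowers the degree. A unit
    -- coefficient survives: it is not `c`, and adding the nonunit `b` does not destroy it.
    set g : D[X] := f - C c * X ^ (m + 1) + C b * X ^ m with hg
    refine ih g ?_ ?_ ?_
    · rw [natDegree_le_iff_coeff_eq_zero]
      intro N hN
      rcases eq_or_ne N (m + 1) with rfl | hN'
      · simp [hg, hc, coeff_X_pow]
      · have : f.coeff N = 0 := coeff_eq_zero_of_natDegree_lt (by omega)
        simp only [hg, coeff_add, coeff_sub, this, coeff_C_mul, coeff_X_pow, hN', if_false]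
        rw [if_neg (by omega)]
        simp
    · simp only [hg, map_add, map_sub, hf, map_mul, aeval_C, map_pow, aeval_X, hb]
      ring
    · obtain ⟨i, hi⟩ := hu
      have him : i ≠ m + 1 := by
        rintro rfl
        exact hcu hi
      refine ⟨i, ?_⟩
      have hgi : g.coeff i = f.coeff i + (if i = m then b else 0) := by
        simp [hg, coeff_X_pow, him]
      rw [hgi]
      split_ifs
      · by_contra hcon
        have := (maximalIdeal D).sub_mem hcon hbu
        rw [add_sub_cancel_right] at this
        exact this hi
      · simpa using hi

/-- Every algebraic element is a zero of a polynomial over the valuation ring with some coefficient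
equal to `1`. -/
lemma exists_aeval_eq_zero_coeff_eq_one {K E : Type*} [Field K] [Field E] [Algebra K E]
    (A : ValuationSubring K) {x : E} (hx : IsAlgebraic K x) :
    ∃ f : A[X], aeval x f = 0 ∧ ∃ i, f.coeff i = 1 := by
  obtain ⟨f, hf0, hf⟩ := hx
  obtain ⟨i, hi, hmax⟩ := f.support.exists_max_image (fun i => A.valuation (f.coeff i))
    (support_nonempty.2 hf0)
  have hci : f.coeff i ≠ 0 := mem_support_iff.1 hi
  set g := C (f.coeff i)⁻¹ * f with hg
  have hlift : g ∈ Polynomial.lifts (algebraMap A K) := by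
    rw [Polynomial.lifts_iff_coeff_lifts]
    intro j
    have : g.coeff j ∈ A := by
      rw [hg, coeff_C_mul, ← ValuationSubring.valuation_le_one_iff, map_mul, map_inv₀]
      by_cases hj : f.coeff j = 0
      · simp [hj]
      · have := hmax j (mem_support_iff.2 hj)
        rw [inv_mul_le_iff₀ (by simpa [zero_lt_iff] using hci), mul_one]
        exact this
    exact ⟨⟨_, this⟩, rfl⟩
  obtain ⟨q, hq⟩ := (Polynomial.mem_lifts g).1 hlift
  refine ⟨q, ?_, i, ?_⟩
  · rw [← aeval_map_algebraMap K, hq, hg, map_mul, hf, mul_zero]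
  · apply FaithfulSMul.algebraMap_injective A K
    rw [← coeff_map, hq, hg, coeff_C_mul, inv_mul_cancel₀ hci, map_one]

variable {K E : Type*} [Field K] [Field E] [Algebra K E]

/-- The minimal polynomial of an element of a finite Galois extension is the product of the
`X - c` over the conjugates `c`. -/
lemma minpoly_map_eq_prod [FiniteDimensional K E] [IsGalois K E] [DecidableEq E] (a : E) :
    (minpoly K a).map (algebraMap K E) =
      ∏ c ∈ Finset.univ.image (fun σ : E ≃ₐ[K] E => σ a), (X - C c) := by
  have hint : IsIntegral K a := Algebra.IsIntegral.isIntegral _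
  have hspl := Normal.splits (F := K) (K := E) inferInstance a
  have hsep : (minpoly K a).Separable := Algebra.IsSeparable.isSeparable K a
  have hnd := nodup_roots (hsep.map (f := algebraMap K E))
  have hroots : ((minpoly K a).map (algebraMap K E)).roots.toFinset =
      Finset.univ.image (fun σ : E ≃ₐ[K] E => σ a) := by
    ext x
    rw [Multiset.mem_toFinset, mem_roots ((minpoly.monic hint).map _).ne_zero, Finset.mem_image]
    constructor
    · intro hx
      rw [IsRoot, eval_map_algebraMap] at hx
      obtain ⟨σ, hσ⟩ := minpoly.exists_algEquiv_of_root' hint.isAlgebraic hx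
      exact ⟨σ, Finset.mem_univ _, hσ⟩
    · rintro ⟨σ, -, rfl⟩
      rw [IsRoot, eval_map_algebraMap]
      change aeval (σ.toAlgHom a) (minpoly K a) = 0
      rw [aeval_algHom_apply, minpoly.aeval, map_zero]
  rw [hspl.eq_prod_roots_of_monic ((minpoly.monic hint).map _), ← hroots, Finset.prod,
    Multiset.toFinset_val, hnd.dedup]

set_option maxHeartbeats 1000000 in
/-- The integral closure of a henselian valuation ring in a finite Galois extension is local. -/
theorem eq_of_isMaximal_integralClosure [FiniteDimensional K E] [IsGalois K E]
    (A : ValuationSubring K) [HenselianLocalRing A]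
    (m₁ m₂ : Ideal (integralClosure A E)) [m₁.IsMaximal] [m₂.IsMaximal] : m₁ = m₂ := by
  classical
  have hDE : IsFractionRing (integralClosure A E) E :=
    integralClosure.isFractionRing_of_finite_extension K E
  have hsm : SMulCommClass (E ≃ₐ[K] E) A E := by
    refine ⟨fun σ a x => ?_⟩
    simp only [Algebra.smul_def, AlgEquiv.smul_def, map_mul]
    rw [IsScalarTower.algebraMap_apply A K E, AlgEquiv.commutes]
  have hinv : Algebra.IsInvariant A (integralClosure A E) (E ≃ₐ[K] E) := by
    refine ⟨fun x hx => ?_⟩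
    have h1 : ∀ σ : E ≃ₐ[K] E, σ (x : E) = x := fun σ => congrArg Subtype.val (hx σ)
    obtain ⟨a, ha⟩ := (IsGalois.mem_range_algebraMap_iff_fixed (F := K) (x : E)).2 h1
    have h2 : IsIntegral A a := by
      refine (isIntegral_algebraMap_iff (algebraMap K E).injective).1 ?_
      rw [ha]
      exact x.2
    obtain ⟨b, hb⟩ := IsIntegrallyClosed.isIntegral_iff.1 h2
    refine ⟨b, Subtype.ext ?_⟩
    rw [← ha, ← hb]
    rfl
  have hunder : ∀ m : Ideal (integralClosure A E), m.IsMaximal → m.under A = maximalIdeal A :=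
    fun m hm =>
    IsLocalRing.eq_maximalIdeal (Ideal.isMaximal_comap_of_isIntegral_of_isMaximal (R := A) m)
  have htrans : ∀ m : Ideal (integralClosure A E), m.IsMaximal → ∃ σ : E ≃ₐ[K] E, m = σ • m₁ :=
    fun m hm =>
    Algebra.IsInvariant.exists_smul_of_under_eq A (integralClosure A E) (E ≃ₐ[K] E) m₁ m
      ((hunder _ inferInstance).trans (hunder m hm).symm)
  -- All maximal ideals are conjugate. The Chinese-remainder type element `a` constructed below is
  -- `1` modulo `m₁`, lies in every other conjugate of `m₁`, and is fixed by the stabilizer of `m₁`.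
  -- Its conjugates `≠ a` then lie in `m₁`, so its minimal polynomial reduces to `(X - 1) X ^ r`.
  -- Hensel's Lemma lifts the simple root `1`, whence `a ∈ A`; but `a` is in `m₂` and not in `m₁`,
  -- and both lie over the maximal ideal of `A`.
  by_contra hne
  have hmaxσ : ∀ σ : E ≃ₐ[K] E, (σ • m₁).IsMaximal := fun σ => by
    rw [Ideal.pointwise_smul_eq_comap]
    exact Ideal.comap_isMaximal_of_equiv _
  -- an element of all conjugates of `m₁` other than `m₁` that is not in `m₁`
  have hex : ∀ σ : E ≃ₐ[K] E, ∃ x : (integralClosure A E), x ∉ m₁ ∧ (σ • m₁ ≠ m₁ → x ∈ σ • m₁) := by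
    intro σ
    by_cases h : σ • m₁ = m₁
    · exact ⟨1, (Ideal.ne_top_iff_one _).1 (Ideal.IsPrime.ne_top inferInstance),
        fun h' => absurd h h'⟩
    · have : ¬ σ • m₁ ≤ m₁ := fun hle =>
        h ((hmaxσ σ).eq_of_le (Ideal.IsPrime.ne_top inferInstance) hle)
      obtain ⟨x, hx, hx'⟩ := SetLike.not_le_iff_exists.1 this
      exact ⟨x, hx', fun _ => hx⟩
  choose y hy1 hy2 using hex
  have hprod : ∏ σ, y σ ∉ m₁ := fun h => by
    obtain ⟨σ, -, hσ⟩ := (Ideal.IsPrime.prod_mem_iff (p := m₁)).1 h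
    exact hy1 σ hσ
  obtain ⟨z, hz⟩ := Ideal.Quotient.exists_inv (I := m₁)
    (a := Ideal.Quotient.mk m₁ (∏ σ, y σ)) (by rwa [Ne, Ideal.Quotient.eq_zero_iff_mem])
  obtain ⟨z, rfl⟩ := Ideal.Quotient.mk_surjective z
  set w := (∏ σ, y σ) * z with hw
  have hw1 : w - 1 ∈ m₁ := by
    rw [← Ideal.Quotient.eq_zero_iff_mem, map_sub, hw, map_mul, hz, map_one, sub_self]
  have hw2 : ∀ σ : E ≃ₐ[K] E, σ • m₁ ≠ m₁ → w ∈ σ • m₁ := fun σ hσ =>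
    Ideal.mul_mem_right _ _ (Ideal.mem_of_dvd _
      (Finset.dvd_prod_of_mem y (Finset.mem_univ σ)) (hy2 σ hσ))
  -- make it invariant under the stabilizer of `m₁`
  let H := MulAction.stabilizer (E ≃ₐ[K] E) m₁
  set a : integralClosure A E := ∏ h : H, (h : E ≃ₐ[K] E) • w with ha
  have ha1 : a - 1 ∈ m₁ := by
    rw [← Ideal.Quotient.eq_zero_iff_mem, map_sub, ha, map_prod, map_one, sub_eq_zero]
    refine Finset.prod_eq_one fun h _ => ?_
    rw [← map_one (Ideal.Quotient.mk m₁), ← sub_eq_zero, ← map_sub, Ideal.Quotient.eq_zero_iff_mem]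
    have h1 : (h : E ≃ₐ[K] E) • (w - 1) ∈ (h : E ≃ₐ[K] E) • m₁ :=
      Ideal.smul_mem_pointwise_smul _ _ _ hw1
    rwa [MulAction.mem_stabilizer_iff.1 h.2, smul_sub, smul_one] at h1
  have ha2 : ∀ σ : E ≃ₐ[K] E, σ • m₁ ≠ m₁ → a ∈ σ • m₁ := fun σ hσ => by
    refine Ideal.mem_of_dvd _ (Finset.dvd_prod_of_mem _ (Finset.mem_univ (1 : H))) ?_
    simpa using hw2 σ hσ
  have ha3 : ∀ σ : E ≃ₐ[K] E, σ • m₁ = m₁ → σ • a = a := fun σ hσ => by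
    rw [ha, Finset.smul_prod']
    let σ' : H := ⟨σ, hσ⟩
    exact Fintype.prod_equiv (Equiv.mulLeft σ') _ _ fun h => (mul_smul σ (h : E ≃ₐ[K] E) w).symm
  have ha4 : ∀ σ : E ≃ₐ[K] E, σ • a ≠ a → σ • a ∈ m₁ := fun σ hσ => by
    have h1 : σ⁻¹ • m₁ ≠ m₁ := fun h => hσ (ha3 σ (inv_smul_eq_iff.1 h).symm)
    have h2 : σ • a ∈ σ • σ⁻¹ • m₁ := Ideal.smul_mem_pointwise_smul _ _ _ (ha2 _ h1)
    rwa [smul_inv_smul] at h2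
  have hA : IsIntegral A (a : E) := a.2
  set f := minpoly A (a : E) with hf
  have hfK : f.map (algebraMap A K) = minpoly K (a : E) :=
    (minpoly.isIntegrallyClosed_eq_field_fractions' K hA).symm
  let s : Finset (integralClosure A E) := (Finset.univ.image fun σ : E ≃ₐ[K] E => σ • a).erase a
  have has : a ∉ s := Finset.notMem_erase _ _
  have hs : ∀ c ∈ s, c ∈ m₁ := fun c hc => by
    obtain ⟨hc1, hc2⟩ := Finset.mem_erase.1 hc
    obtain ⟨σ, -, rfl⟩ := Finset.mem_image.1 hc2
    exact ha4 σ hc1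
  have hfD : f.map (algebraMap A (integralClosure A E)) = (X - C a) * ∏ c ∈ s, (X - C c) := by
    have h1 : (X - C a) * ∏ c ∈ s, (X - C c) =
        ∏ c ∈ Finset.univ.image (fun σ : E ≃ₐ[K] E => σ • a), (X - C c) :=
      Finset.mul_prod_erase _ (fun c => X - C c)
        (Finset.mem_image.2 ⟨1, Finset.mem_univ _, one_smul _ a⟩)
    rw [h1]
    apply Polynomial.map_injective (algebraMap (integralClosure A E) E)
      (FaithfulSMul.algebraMap_injective _ _)
    rw [Polynomial.map_map, ← IsScalarTower.algebraMap_eq, IsScalarTower.algebraMap_eq A K E,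
      ← Polynomial.map_map, hfK, Polynomial.map_prod]
    simp only [Polynomial.map_sub, Polynomial.map_X, Polynomial.map_C]
    rw [minpoly_map_eq_prod]
    rw [← Finset.prod_image (s := Finset.univ.image (fun σ : E ≃ₐ[K] E => σ • a))
      (g := algebraMap (integralClosure A E) E) (f := fun x => X - C x)
      (fun x _ y _ h => FaithfulSMul.algebraMap_injective _ _ h), Finset.image_image]
    rfl
  obtain ⟨κ, _, π, hπ⟩ : ∃ (κ : Type _) (_ : Field κ) (π : integralClosure A E →+* κ),
      ∀ x, π x = 0 ↔ x ∈ m₁ :=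
    ⟨_, Ideal.Quotient.field m₁, Ideal.Quotient.mk m₁, fun x => Ideal.Quotient.eq_zero_iff_mem⟩
  have hπa : π a = 1 := by
    rw [← map_one π, ← sub_eq_zero, ← map_sub]
    exact (hπ _).2 ha1
  have hfπ : f.map (π.comp (algebraMap A (integralClosure A E))) = (X - 1) * X ^ s.card := by
    rw [← Polynomial.map_map, hfD, Polynomial.map_mul, Polynomial.map_prod]
    simp only [Polynomial.map_sub, Polynomial.map_X, Polynomial.map_C, hπa, map_one]
    congr 1
    rw [← Finset.prod_const]
    refine Finset.prod_congr rfl fun c hc => ?_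
    rw [(hπ c).2 (hs c hc), map_zero, sub_zero]
  have hker : ∀ x : A, x ∈ maximalIdeal A ↔ π (algebraMap A (integralClosure A E) x) = 0 := by
    intro x
    rw [← hunder m₁ inferInstance]
    exact (hπ _).symm
  have hev : ∀ (g : A[X]), π (algebraMap A (integralClosure A E) (g.eval 1)) =
      (g.map (π.comp (algebraMap A (integralClosure A E)))).eval 1 := by
    intro g
    have := eval_map_apply (p := g) (π.comp (algebraMap A (integralClosure A E))) 1
    rw [map_one] at this
    exact this.symm
  obtain ⟨r, hr, -⟩ := HenselianLocalRing.is_henselian f (minpoly.monic hA) 1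
    (by rw [hker, hev, hfπ]; simp)
    (by
      rw [← notMem_maximalIdeal, hker, hev, ← derivative_map, hfπ]
      rw [derivative_mul, eval_add, eval_mul, eval_mul]
      simp)
  -- `f` is irreducible with a root, so `a` lies in the base ring
  have hrK : (minpoly K (a : E)).IsRoot (algebraMap A K r) := by
    rw [← hfK, IsRoot, eval_map_apply, hr, map_zero]
  have haK : algebraMap K E (algebraMap A K r) = a :=
    minpoly.root (Algebra.IsIntegral.isIntegral (a : E)) hrK
  have har : algebraMap A (integralClosure A E) r = a := Subtype.ext haK
  obtain ⟨σ, hσ⟩ := htrans m₂ inferInstance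
  have h1 : a ∈ m₂ := by
    rw [hσ]
    exact ha2 σ fun h => hne (hσ.trans h).symm
  have h2 : r ∈ maximalIdeal A := by
    rw [← hunder m₂ inferInstance]
    change algebraMap A (integralClosure A E) r ∈ m₂
    rwa [har]
  rw [hker, har, hπa] at h2
  exact one_ne_zero h2

end Henselian

/-! ### Galois invariance of the valuation ring over a henselian field -/

section Stability

variable {K E : Type*} [Field K] [Field E] [Algebra K E]

lemma comap_comap_algebraMap (K F : Type*) {E : Type*} [Field K] [Field F] [Field E] [Algebra K F]
    [Algebra F E] [Algebra K E] [IsScalarTower K F E] (B : ValuationSubring E) :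
    (B.comap (algebraMap F E)).comap (algebraMap K F) = B.comap (algebraMap K E) := by
  ext x
  simp only [ValuationSubring.mem_comap, ← IsScalarTower.algebraMap_apply]

lemma mem_of_isIntegral {B : ValuationSubring E} {x : E}
    (hx : IsIntegral (B.comap (algebraMap K E)) x) : x ∈ B := by
  let : Algebra (B.comap (algebraMap K E)) B := (restrictHom K B).toAlgebra
  have : IsScalarTower (B.comap (algebraMap K E)) B E := IsScalarTower.of_algebraMap_eq fun _ => rfl
  have h2 : IsIntegral B x := hx.tower_top
  obtain ⟨b, rfl⟩ := IsIntegrallyClosed.isIntegral_iff.1 h2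
  exact b.2

/-- Over a henselian field, the automorphisms of a finite Galois extension preserve the valuation
ring. -/
theorem algEquiv_mem_of_isGalois [FiniteDimensional K E] [IsGalois K E] {B : ValuationSubring E}
    (hB : IsHenselian (B.comap (algebraMap K E))) (σ : E ≃ₐ[K] E) {x : E} (hx : x ∈ B) :
    σ x ∈ B := by
  set A := B.comap (algebraMap K E) with hA
  have hHens : HenselianLocalRing A := hB
  have hloc : IsLocalRing (integralClosure A E) :=
    IsLocalRing.of_unique_max_ideal (by
      obtain ⟨m, hm⟩ := Ideal.exists_maximal (integralClosure A E)
      exact ⟨m, hm, fun m' hm' => eq_of_isMaximal_integralClosure A m' m⟩)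
  have hint : ∀ b : integralClosure A E, σ b ∈ B := fun b => by
    refine mem_of_isIntegral (K := K) ?_
    have h1 : IsIntegral A (b : E) := b.2
    exact h1.map (σ.toAlgHom.restrictScalars A)
  -- The integral closure is local and integrally closed, so it contains `x` or `x⁻¹`; moreover its
  -- image under `σ` is integral over `A` and hence contained in `B`.
  obtain ⟨f, hf, i, hi⟩ := exists_aeval_eq_zero_coeff_eq_one A (Algebra.IsAlgebraic.isAlgebraic x)
  rcases mem_or_inv_mem_of_aeval_eq_zero (D := integralClosure A E) x _
    (f.map (algebraMap A (integralClosure A E))) le_rfl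
    (by rw [aeval_map_algebraMap]; exact hf) ⟨i, by rw [coeff_map, hi, map_one]; exact isUnit_one⟩
    with ⟨b, hb⟩ | ⟨b, hb⟩
  · rw [← hb]
    exact hint b
  · rcases eq_or_ne x 0 with rfl | hx0
    · simp
    by_cases hbu : IsUnit b
    · obtain ⟨d, hd⟩ := hbu.exists_right_inv
      have : x = d := by
        have h1 : (b : E) * d = 1 := congrArg Subtype.val hd
        have h2 : (b : E) = x⁻¹ := hb
        rw [h2] at h1
        exact (eq_of_inv_mul_eq_one h1)
      rw [this]
      exact hint d
    · exfalso
      -- Remaining case: `b = x⁻¹` is a nonunit of the integral closure. Its only maximal ideal is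
      -- the contraction of that of `B`, so `b` would be a nonunit of `B`, against `x ∈ B`.
      have hle : ∀ y : integralClosure A E, (y : E) ∈ B := fun y => mem_of_isIntegral (K := K) y.2
      let ψ : integralClosure A E →+* B :=
        { toFun := fun y => ⟨y, hle y⟩
          map_one' := rfl
          map_mul' := fun _ _ => rfl
          map_zero' := rfl
          map_add' := fun _ _ => rfl }
      let : Algebra A B := (restrictHom K B).toAlgebra
      have hker : (RingHom.ker ((residue B).comp ψ)).IsMaximal := by
        have hprime : (RingHom.ker ((residue B).comp ψ)).IsPrime := RingHom.ker_isPrime _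
        refine Ideal.isMaximal_of_isIntegral_of_isMaximal_comap (R := A) _ ?_
        have : (RingHom.ker ((residue B).comp ψ)).comap (algebraMap A (integralClosure A E)) =
            maximalIdeal A := by
          ext a
          rw [Ideal.mem_comap, RingHom.mem_ker, ← residue_eq_zero_iff]
          rw [← map_eq_zero_iff (residueMap K B) (residueMap K B).injective]
          rfl
        rw [this]
        infer_instance
      have h1 : b ∈ RingHom.ker ((residue B).comp ψ) := by
        rw [IsLocalRing.eq_maximalIdeal hker]
        exact hbu
      rw [RingHom.mem_ker, RingHom.comp_apply, residue_eq_zero_iff] at h1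
      refine h1 (IsUnit.of_mul_eq_one (⟨x, hx⟩ : B) (Subtype.ext ?_))
      change (b : E) * x = 1
      have h2 : (b : E) = x⁻¹ := hb
      rw [h2, inv_mul_cancel₀ hx0]

/-- A finite set of separable elements of a normal extension lies in a finite Galois extension. -/
lemma exists_finite_galois [Normal K E] {s : Set E} (hs : s.Finite)
    (hsep : ∀ x ∈ s, IsSeparable K x) :
    ∃ N : IntermediateField K E, FiniteDimensional K N ∧ IsGalois K N ∧ s ⊆ N ∧
      ∀ M : IntermediateField K E, Normal K M → s ⊆ M → N ≤ M := by
  have hs' : Finite s := hs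
  have hfin : FiniteDimensional K (IntermediateField.adjoin K s) :=
    IntermediateField.finiteDimensional_adjoin fun x _ => Algebra.IsIntegral.isIntegral x
  have h1 : Algebra.IsSeparable K (IntermediateField.adjoin K s) :=
    (IntermediateField.isSeparable_adjoin_iff_isSeparable K E).2 hsep
  let N := IntermediateField.normalClosure K (IntermediateField.adjoin K s) E
  have hle : N ≤ separableClosure K E := by
    rw [normalClosure_le_iff]
    rintro φ _ ⟨x, rfl⟩
    change φ x ∈ separableClosure K E
    rw [mem_separableClosure_iff]
    exact (Algebra.IsSeparable.isSeparable K x).map φ φ.injective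
  have hNsep : Algebra.IsSeparable K N := (le_separableClosure_iff K E N).1 hle
  refine ⟨N, inferInstance, ⟨⟩, ?_, ?_⟩
  · exact (IntermediateField.subset_adjoin K s).trans (IntermediateField.le_normalClosure _)
  · intro M hM hsM
    rw [IntermediateField.normalClosure_le_iff_of_normal]
    exact IntermediateField.adjoin_le_iff.2 hsM

/-- Over a henselian field, the automorphisms of a normal extension preserve the valuation ring. -/
theorem IsHenselian.algEquiv_mem [Normal K E] {B : ValuationSubring E}
    (hB : IsHenselian (B.comap (algebraMap K E))) (σ : E ≃ₐ[K] E) {x : E} (hx : x ∈ B) :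
    σ x ∈ B := by
  obtain ⟨q, hq⟩ := ExpChar.exists K
  -- Some `q`-power of `x` is separable and thus lies in a finite Galois extension; membership in a
  -- valuation ring can be tested on powers.
  obtain ⟨n, hn⟩ := IsPurelyInseparable.pow_mem (separableClosure K E) q x
  have : ExpChar (separableClosure K E) q := inferInstance
  obtain ⟨y, hy⟩ := hn
  have hy' : IsSeparable K (x ^ q ^ n) := by
    rw [← hy, ← mem_separableClosure_iff]
    exact y.2
  obtain ⟨N, hN1, hN2, hN3, -⟩ := exists_finite_galois (K := K) (Set.finite_singleton (x ^ q ^ n))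
    (by rintro _ rfl; exact hy')
  have hmem : x ^ q ^ n ∈ N := hN3 rfl
  have h1 : (⟨x ^ q ^ n, hmem⟩ : N) ∈ B.comap (algebraMap N E) := pow_mem hx _
  have h2 := algEquiv_mem_of_isGalois (K := K) (B := B.comap (algebraMap N E))
    (by rw [comap_comap_algebraMap]; exact hB) (σ.restrictNormal N) h1
  rw [ValuationSubring.mem_comap, AlgEquiv.restrictNormal_commutes] at h2
  have h3 : (σ x) ^ q ^ n ∈ B := by simpa using h2
  rw [← ValuationSubring.valuation_le_one_iff, map_pow] at h3
  rw [← ValuationSubring.valuation_le_one_iff]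
  exact (pow_le_one_iff_of_nonneg zero_le (pow_ne_zero _ (expChar_pos K q).ne')).1 h3

end Stability

/-! ### Ramification and inertia groups -/

section Automorphisms

variable {K E : Type*} [Field K] [Field E] [Algebra K E] {B : ValuationSubring E}

/-- The finitely many conjugates of `a` are permuted by `σ`. In infinite extensions this replaces
finiteness of the order of `σ`. -/
lemma exists_pow_apply_eq [Algebra.IsAlgebraic K E] (σ : E ≃ₐ[K] E) (a : E) :
    ∃ n, 0 < n ∧ (σ ^ n) a = a := by
  have hfin : Finite ((minpoly K a).rootSet E) := inferInstance
  have hmem : ∀ n : ℕ, (σ ^ n) a ∈ (minpoly K a).rootSet E := fun n => by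
    rw [mem_rootSet]
    refine ⟨minpoly.ne_zero (Algebra.IsIntegral.isIntegral a), ?_⟩
    change aeval ((σ ^ n).toAlgHom a) (minpoly K a) = 0
    rw [aeval_algHom_apply, minpoly.aeval, map_zero]
  obtain ⟨i, j, hij, h⟩ := Finite.exists_ne_map_eq_of_infinite
    fun n : ℕ => (⟨(σ ^ n) a, hmem n⟩ : (minpoly K a).rootSet E)
  have h' : (σ ^ i) a = (σ ^ j) a := congrArg Subtype.val h
  wlog hlt : i < j generalizing i j
  · exact this j i hij.symm h.symm h'.symm (lt_of_le_of_ne (not_lt.1 hlt) hij.symm)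
  refine ⟨j - i, by omega, ?_⟩
  apply (σ ^ i).injective
  rw [← AlgEquiv.mul_apply, ← pow_add, h', Nat.add_sub_cancel' hlt.le]

/-- All automorphisms preserve the valuation ring. -/
def Stable (K : Type*) {E : Type*} [Field K] [Field E] [Algebra K E] (B : ValuationSubring E) :
    Prop := ∀ (σ : E ≃ₐ[K] E) (x : E), x ∈ B → σ x ∈ B

lemma IsHenselian.stable [Normal K E] (hB : IsHenselian (B.comap (algebraMap K E))) :
    Stable K B := fun σ _ hx => hB.algEquiv_mem σ hx

lemma Stable.comap_eq (h : Stable K B) (σ : E ≃ₐ[K] E) : B.comap (σ : E →+* E) = B := by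
  ext x
  rw [ValuationSubring.mem_comap]
  refine ⟨fun hx => ?_, fun hx => h σ x hx⟩
  have := h σ.symm _ hx
  simpa using this

lemma Stable.valuation_lt_iff (h : Stable K B) (σ : E ≃ₐ[K] E) {x y : E} :
    B.valuation (σ x) < B.valuation (σ y) ↔ B.valuation x < B.valuation y := by
  have := comap_valuation_lt_iff (B := B) (σ : E →+* E) (x := x) (y := y)
  rw [h.comap_eq] at this
  exact this.symm

lemma Stable.sim_iff (h : Stable K B) (σ : E ≃ₐ[K] E) {x y : E} :
    Sim B (σ x) (σ y) ↔ Sim B x y := by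
  rw [Sim, ← map_sub, h.valuation_lt_iff, Sim]

/-- If `σ` lowered the value of `a`, the values would strictly decrease along the orbit of `a`,
which returns to `a`. -/
lemma Stable.valuation_eq [Algebra.IsAlgebraic K E] (h : Stable K B) (σ : E ≃ₐ[K] E) (a : E) :
    B.valuation (σ a) = B.valuation a := by
  have key : ∀ σ : E ≃ₐ[K] E, ¬ B.valuation (σ a) < B.valuation a := by
    intro σ hlt
    obtain ⟨n, hn, hna⟩ := exists_pow_apply_eq σ a
    have : ∀ m : ℕ, 0 < m → B.valuation ((σ ^ m) a) < B.valuation a := by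
      intro m hm
      induction m, hm using Nat.le_induction with
      | base => simpa using hlt
      | succ m hm ih =>
        rw [pow_succ', AlgEquiv.mul_apply]
        exact ((h.valuation_lt_iff σ).2 ih).trans hlt
    have := this n hn
    rw [hna] at this
    exact lt_irrefl _ this
  refine le_antisymm (not_lt.1 fun hlt => key σ⁻¹ ?_) (not_lt.1 (key σ))
  have h1 := (h.valuation_lt_iff σ⁻¹).2 hlt
  have e : (σ⁻¹ : E ≃ₐ[K] E) (σ a) = a := σ.symm_apply_apply a
  rwa [e] at h1

/-- The definition tests only elements of the valuation ring; the relation is compatible with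
inverses, so all nonzero elements are covered. -/
lemma mem_ramificationGroup_iff {σ : E ≃ₐ[K] E} :
    σ ∈ ramificationGroup K B ↔ ∀ a, a ≠ 0 → Sim B (σ a) a := by
  constructor
  · intro h a ha
    rcases B.mem_or_inv_mem a with h1 | h1
    · exact h a h1 ha
    · have h2 : Sim B (σ a⁻¹) a⁻¹ := h a⁻¹ h1 (inv_ne_zero ha)
      rw [map_inv₀] at h2
      simpa using h2.inv
  · intro h a _ ha
    exact h a ha

/-- An element of the ramification group fixes every element on which it has finite order prime to
the residue characteristic. -/
theorem apply_eq_of_mem_ramificationGroup {σ : E ≃ₐ[K] E} (hσ : σ ∈ ramificationGroup K B) {ℓ : ℕ}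
    (hℓ : ¬ residueChar B ∣ ℓ) {a : E} (ha : (σ ^ ℓ) a = a) : σ a = a := by
  have hv := valuation_natCast_eq_one hℓ
  have hℓ0 : (ℓ : E) ≠ 0 := by
    intro h0
    rw [h0, map_zero] at hv
    exact zero_ne_one hv
  set c := ∑ i ∈ Finset.range ℓ, (σ ^ i) a with hc
  have hpow : ∀ (i : ℕ) (b : E), b ≠ 0 → Sim B ((σ ^ i) b) b := fun i b hb =>
    mem_ramificationGroup_iff.1 (pow_mem hσ i) b hb
  have hσc : σ c = c := by
    rw [hc, map_sum]
    have h1 : ∀ i, σ ((σ ^ i) a) = (σ ^ (i + 1)) a := fun i => by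
      rw [pow_succ', AlgEquiv.mul_apply]
    simp only [h1]
    have h2 := Finset.sum_range_succ (fun i => (σ ^ i) a) ℓ
    rw [Finset.sum_range_succ', ha] at h2
    simpa using h2
  have hσic : ∀ i : ℕ, (σ ^ i) c = c := fun i => by
    induction i with
    | zero => rfl
    | succ i ih => rw [pow_succ, AlgEquiv.mul_apply, hσc, ih]
  -- The element `b` has orbit sum zero, while all `(σ ^ i) b ~ b` and `ℓ` is a unit, so the sum
  -- would have the value of `b`. Hence `b = 0`, and `a = c / ℓ` is fixed.
  set b := (ℓ : E) * a - c with hb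
  have hsum : ∑ i ∈ Finset.range ℓ, (σ ^ i) b = 0 := by
    simp only [hb, map_sub, map_mul, map_natCast, hσic, Finset.sum_sub_distrib,
      ← Finset.mul_sum, ← hc, Finset.sum_const, Finset.card_range, nsmul_eq_mul, sub_self]
  have hb0 : b = 0 := by
    by_contra hb0
    have hvb : 0 < B.valuation b := by simpa [zero_lt_iff] using hb0
    have h1 : B.valuation (∑ i ∈ Finset.range ℓ, ((σ ^ i) b - b)) < B.valuation b :=
      Valuation.map_sum_lt B.valuation hvb.ne' fun i _ => hpow i b hb0
    rw [Finset.sum_sub_distrib, hsum, zero_sub, Finset.sum_const, Finset.card_range, nsmul_eq_mul,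
      Valuation.map_neg, map_mul, hv, one_mul] at h1
    exact lt_irrefl _ h1
  rw [hb, sub_eq_zero] at hb0
  apply mul_left_cancel₀ hℓ0
  rw [hb0, ← hσc, ← hb0, map_mul, map_natCast]

/-- In residue characteristic zero, the ramification group is trivial. -/
lemma ramificationGroup_eq_bot [Algebra.IsAlgebraic K E] (hp : residueChar B = 0) :
    ramificationGroup K B = ⊥ := by
  rw [eq_bot_iff]
  intro σ hσ
  rw [Subgroup.mem_bot]
  ext a
  obtain ⟨n, hn, ha⟩ := exists_pow_apply_eq σ a
  exact apply_eq_of_mem_ramificationGroup hσ (by rw [hp, zero_dvd_iff]; exact hn.ne') ha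

variable (K B) in
/-- The inertia group, as a set of automorphisms. -/
def IsInertial (σ : E ≃ₐ[K] E) : Prop := ∀ u, B.valuation u = 1 → Sim B (σ u) u

/-- The quotient `(σ ^ n) a / a` has value `1`, so the inertial `σ` fixes it up to a one-unit. Thus
the cocycle `n ↦ (σ ^ n) a / a` is multiplicative up to one-units. -/
lemma IsInertial.sim_pow [Algebra.IsAlgebraic K E] (hst : Stable K B) {σ : E ≃ₐ[K] E}
    (hσ : IsInertial K B σ) (n : ℕ) {a : E} (ha : a ≠ 0) :
    Sim B ((σ ^ n) a) ((σ a / a) ^ n * a) := by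
  have hσa : σ a ≠ 0 := by simpa using ha
  induction n with
  | zero => simpa using Sim.refl (B := B) ha
  | succ n ih =>
    set w := (σ ^ n) a / a with hw
    have hvw : B.valuation w = 1 := by
      rw [hw, map_div₀, hst.valuation_eq, div_self]
      simpa using ha
    have h1 : (σ ^ (n + 1)) a = σ w * σ a := by
      rw [pow_succ', AlgEquiv.mul_apply, ← map_mul, hw, div_mul_cancel₀ _ ha]
    rw [h1]
    refine ((hσ w hvw).mul (Sim.refl hσa)).trans ?_
    have h2 := ih.mul (Sim.refl (B := B) (div_ne_zero hσa ha))
    have e1 : (σ ^ n) a * (σ a / a) = w * σ a := by rw [hw]; field_simp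
    have e2 : (σ a / a) ^ n * a * (σ a / a) = (σ a / a) ^ (n + 1) * a := by ring
    rwa [e1, e2] at h2

lemma IsInertial.sim_one_of_pow [Algebra.IsAlgebraic K E] (hst : Stable K B) {σ : E ≃ₐ[K] E}
    (hσ : IsInertial K B σ) {n : ℕ} {a : E} (h : Sim B ((σ ^ n) a) a) :
    Sim B ((σ a / a) ^ n) 1 := by
  have ha := h.ne_zero
  have h1 := (hσ.sim_pow hst n ha).symm.trans h
  have := h1.div (Sim.refl (B := B) ha)
  rwa [mul_div_cancel_right₀ _ ha, div_self ha] at this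

/-- Since Frobenius is injective on the residue field, `(σ a / a) ^ p ^ k ~ 1` already gives `σ a ~
a`: modulo ramification, inertia has no `p`-torsion. -/
lemma IsInertial.mem_ramificationGroup [Algebra.IsAlgebraic K E] (hst : Stable K B)
    (hp : (residueChar B).Prime) {σ : E ≃ₐ[K] E} (hσ : IsInertial K B σ) {k : ℕ}
    (h : σ ^ residueChar B ^ k ∈ ramificationGroup K B) : σ ∈ ramificationGroup K B := by
  rw [mem_ramificationGroup_iff] at h ⊢
  intro a ha
  have h1 := hσ.sim_one_of_pow hst (h a ha)
  rw [← sim_one_iff ha]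
  refine Sim.of_pow_residueChar_pow hp one_ne_zero k ?_
  rwa [one_pow]

lemma isInertial_of_mem_ramificationGroup {σ : E ≃ₐ[K] E} (hσ : σ ∈ ramificationGroup K B) :
    IsInertial K B σ := fun u hu => mem_ramificationGroup_iff.1 hσ u (by
  rintro rfl
  simp at hu)

end Automorphisms

/-! ### Lifting inertial and ramification automorphisms -/

section Lifting

variable {K S : Type*} [Field K] [Field S] [Algebra K S] {B : ValuationSubring S}

/-- The action of the Galois group on a stable valuation ring. -/
@[reducible]
def Stable.mulSemiringAction (h : Stable K B) : MulSemiringAction (S ≃ₐ[K] S) B where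
  smul g x := ⟨g x, h g x x.2⟩
  one_smul _ := rfl
  mul_smul _ _ _ := rfl
  smul_zero g := Subtype.ext (map_zero g)
  smul_add g x y := Subtype.ext (map_add g (x : S) y)
  smul_one g := Subtype.ext (map_one g)
  smul_mul g x y := Subtype.ext (map_mul g (x : S) y)

lemma mem_nonunits_iff_valuation {x : B} : x ∈ maximalIdeal B ↔ B.valuation (x : S) < 1 :=
  B.valuation_lt_one_iff x

/-- If an automorphism acts trivially on the residue field of `K`, then its action on the residue
field is also induced by an automorphism over `K`. -/
lemma exists_algEquiv_sim [IsGalois K S] (hst : Stable K B) (σ : S ≃+* S)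
    (hσ : ∀ x, x ∈ B ↔ σ x ∈ B)
    (hK : ∀ x : K, B.valuation (algebraMap K S x) = 1 →
      Sim B (σ (algebraMap K S x)) (algebraMap K S x)) :
    ∃ g : S ≃ₐ[K] S, ∀ u, B.valuation u = 1 → Sim B (g u) (σ u) := by
  let A := B.comap (algebraMap K S)
  let _ : Algebra A B := (restrictHom K B).toAlgebra
  let _ : MulSemiringAction (S ≃ₐ[K] S) B := hst.mulSemiringAction
  have _ : SMulCommClass (S ≃ₐ[K] S) A B := ⟨fun g a x => by
    refine Subtype.ext ?_
    change g (algebraMap K S a * x) = algebraMap K S a * g x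
    rw [map_mul, AlgEquiv.commutes]⟩
  have hinv : Algebra.IsInvariant A B (S ≃ₐ[K] S) := ⟨fun b hb => by
    obtain ⟨a, ha⟩ := (InfiniteGalois.mem_range_algebraMap_iff_fixed (k := K) (b : S)).2
      fun g => congrArg Subtype.val (hb g)
    refine ⟨⟨a, ?_⟩, Subtype.ext ha⟩
    rw [ValuationSubring.mem_comap, ha]
    exact b.2⟩
  -- Stabilizers are open, so the action on the discrete ring `B` is continuous. This allows the use
  -- of the surjectivity of the decomposition group onto the residual automorphisms for profinite
  -- groups.
  let _ : TopologicalSpace B := ⊥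
  have _ : DiscreteTopology B := ⟨rfl⟩
  have _ : ContinuousSMul (S ≃ₐ[K] S) B := by
    rw [continuousSMul_iff_stabilizer_isOpen]
    intro b
    have := stabilizer_isOpen_of_isIntegral (K := K) (b : S)
    convert this using 1
    ext g
    exact Subtype.ext_iff
  have hover : (maximalIdeal B).LiesOver (maximalIdeal A) := ⟨by
    ext a
    rw [Ideal.mem_comap, mem_nonunits_iff_valuation, mem_nonunits_iff_valuation]
    exact comap_valuation_lt_one_iff _⟩
  let e : B ≃+* B :=
    { toFun := fun x => ⟨σ x, (hσ x).1 x.2⟩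
      invFun := fun x => ⟨σ.symm x, (hσ _).2 (by simp)⟩
      left_inv := fun x => Subtype.ext (by simp)
      right_inv := fun x => Subtype.ext (by simp)
      map_mul' := fun x y => Subtype.ext (map_mul σ (x : S) y)
      map_add' := fun x y => Subtype.ext (map_add σ (x : S) y) }
  have hmap : maximalIdeal B = (maximalIdeal B).map (e : B →+* B) := by
    have := (Ideal.map_comap_of_equiv (I := maximalIdeal B) e)
    refine (IsLocalRing.eq_maximalIdeal ?_).symm
    exact Ideal.map_isMaximal_of_equiv e
  let ē : (B ⧸ maximalIdeal B) ≃+* (B ⧸ maximalIdeal B) :=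
    Ideal.quotientEquiv _ _ e hmap
  let ε : (B ⧸ maximalIdeal B) ≃ₐ[A ⧸ maximalIdeal A] (B ⧸ maximalIdeal B) :=
    AlgEquiv.ofRingEquiv (f := ē) (by
      intro a
      obtain ⟨a, rfl⟩ := Ideal.Quotient.mk_surjective a
      change Ideal.Quotient.mk _ (e (restrictHom K B a)) =
        Ideal.Quotient.mk _ (restrictHom K B a)
      rw [Ideal.Quotient.eq, mem_nonunits_iff_valuation]
      change B.valuation (σ (algebraMap K S a) - algebraMap K S a) < 1
      have ha : B.valuation (algebraMap K S a) ≤ 1 := (B.valuation_le_one_iff _).2 a.2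
      rcases ha.lt_or_eq with h1 | h1
      · refine Valuation.map_sub_lt B.valuation ?_ h1
        have h2 : e (restrictHom K B a) ∈ maximalIdeal B := by
          rw [hmap]
          exact Ideal.mem_map_of_mem (e : B →+* B) (mem_nonunits_iff_valuation.2 h1)
        exact mem_nonunits_iff_valuation.1 h2
      · have := hK a h1
        rwa [Sim, h1] at this)
  obtain ⟨g, hg⟩ := Ideal.Quotient.stabilizerHom_surjective_of_profinite (G := S ≃ₐ[K] S)
    (maximalIdeal A) (maximalIdeal B) ε
  refine ⟨g, fun u hu => ?_⟩
  have h1 := DFunLike.congr_fun hg (Ideal.Quotient.mk _ ⟨u, mem_of_valuation_eq_one hu⟩)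
  have h2 : Ideal.Quotient.mk (maximalIdeal B) ((g : S ≃ₐ[K] S) • ⟨u, mem_of_valuation_eq_one hu⟩) =
    Ideal.Quotient.mk (maximalIdeal B) (e ⟨u, mem_of_valuation_eq_one hu⟩) := h1
  rw [Ideal.Quotient.eq, mem_nonunits_iff_valuation] at h2
  have h3 : B.valuation (σ u) = 1 := by
    refine le_antisymm ((B.valuation_le_one_iff _).2 ((hσ u).1 (mem_of_valuation_eq_one hu))) ?_
    have : B.valuation u⁻¹ = 1 := by rw [map_inv₀, hu, inv_one]
    have h4 := (B.valuation_le_one_iff _).2 ((hσ _).1 (mem_of_valuation_eq_one this))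
    rw [map_inv₀, map_inv₀] at h4
    have hne : 0 < B.valuation (σ u) := by
      rw [zero_lt_iff, Ne, map_eq_zero, map_eq_zero]
      rintro rfl
      simp at hu
    exact (inv_le_one₀ hne).1 h4
  rw [Sim, h3]
  exact h2

lemma Stable.restrictScalars {F : Type*} [Field F] [Algebra K F] [Algebra F S] [IsScalarTower K F S]
    (hst : Stable K B) : Stable F B := fun σ x hx => hst (σ.restrictScalars K) x hx

lemma Stable.of_isScalarTower {F : Type*} [Field F] [Algebra K F] [Algebra F S]
    [IsScalarTower K F S] [Normal K S] [Normal K F] (hst : Stable K B) :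
    Stable K (B.comap (algebraMap F S)) := fun τ x hx => by
  have := hst (τ.liftNormal S) _ hx
  rwa [AlgEquiv.liftNormal_commutes] at this

/-- Inertial automorphisms of normal subextensions lift to inertial automorphisms. -/
theorem exists_isInertial_lift [IsGalois K S] (hst : Stable K B) {E : Type*} [Field E]
    [Algebra K E] [Algebra E S] [IsScalarTower K E S] [Normal K E] {τ : E ≃ₐ[K] E}
    (hτ : IsInertial K (B.comap (algebraMap E S)) τ) :
    ∃ σ : S ≃ₐ[K] S, IsInertial K B σ ∧ ∀ x : E, σ (algebraMap E S x) = algebraMap E S (τ x) := by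
  have hgal : IsGalois E S := IsGalois.tower_top_of_isGalois K E S
  set σ := τ.liftNormal S
  have hσE : ∀ x : E, σ (algebraMap E S x) = algebraMap E S (τ x) := fun x =>
    AlgEquiv.liftNormal_commutes τ S x
  -- An arbitrary lift `σ` of `τ` acts trivially on the residue field of `E`, so its residual action
  -- on `S` is that of some `g` over `E`; then `g⁻¹ σ` is an inertial lift.
  obtain ⟨g, hg⟩ := exists_algEquiv_sim (K := E) hst.restrictScalars (σ : S ≃+* S)
    (fun x => ⟨hst σ x, fun hx => by simpa using hst σ.symm _ hx⟩)
    (fun x hx => by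
      change Sim B (σ (algebraMap E S x)) (algebraMap E S x)
      rw [hσE]
      exact (sim_comap_iff _).1 (hτ x ((comap_valuation_eq_one_iff _).2 hx)))
  let g' : S ≃ₐ[K] S := g.restrictScalars K
  refine ⟨g'⁻¹ * σ, fun u hu => ?_, fun x => ?_⟩
  · rw [← hst.sim_iff g', AlgEquiv.mul_apply]
    have : g' ((g'⁻¹ : S ≃ₐ[K] S) (σ u)) = σ u := g'.apply_symm_apply _
    rw [this]
    exact (hg u hu).symm
  · rw [AlgEquiv.mul_apply, hσE]
    change g'.symm _ = _
    rw [AlgEquiv.symm_apply_eq]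
    exact (g.commutes (τ x)).symm

/-- The ramification group of a finite Galois subextension is the image of the ramification
group. -/
theorem exists_mem_ramificationGroup_lift [IsGalois K S] (hst : Stable K B)
    {E : Type*} [Field E] [Algebra K E] [Algebra E S] [IsScalarTower K E S] [FiniteDimensional K E]
    [Normal K E] {τ : E ≃ₐ[K] E}
    (hτ : τ ∈ ramificationGroup K (B.comap (algebraMap E S))) :
    ∃ ρ ∈ ramificationGroup K B, ∀ x : E, ρ (algebraMap E S x) = algebraMap E S (τ x) := by
  classical
  have hpE : residueChar (B.comap (algebraMap E S)) = residueChar B := residueChar_comap E B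
  rcases residueChar_prime_or_zero (B := B) with hp | hp
  swap
  · rw [ramificationGroup_eq_bot (hpE.trans hp), Subgroup.mem_bot] at hτ
    exact ⟨1, one_mem _, fun x => by rw [hτ]; rfl⟩
  set p := residueChar B
  obtain ⟨σ, hσ, hσE⟩ := exists_isInertial_lift hst (isInertial_of_mem_ramificationGroup hτ)
  have hσn : ∀ (n : ℕ) (x : E), (σ ^ n) (algebraMap E S x) = algebraMap E S ((τ ^ n) x) :=
    fun n x => by
    induction n with
    | zero => rfl
    | succ n ih => rw [pow_succ', pow_succ', AlgEquiv.mul_apply, AlgEquiv.mul_apply, ih, hσE]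
  -- The order of `τ` is a power of `p`, because elements of the ramification group have no part of
  -- order prime to `p`.
  obtain ⟨j, hj⟩ : ∃ j, τ ^ p ^ j = 1 := by
    obtain ⟨k, m, hm, hkm⟩ := Nat.exists_eq_pow_mul_and_not_dvd (orderOf_pos τ).ne' _ hp.ne_one
    refine ⟨k, ?_⟩
    ext x
    refine (apply_eq_of_mem_ramificationGroup (pow_mem hτ _) (ℓ := m) ?_ ?_)
    · rwa [hpE]
    · rw [← pow_mul, ← hkm, pow_orderOf_eq_one]
      rfl
  -- It remains to remove the prime-to-`p` part of the inertial lift `σ`. On each `a`, the residue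
  -- of `σ a / a` has an order `m` prime to `p`, so `σ ^ N` acts on `a` like a ramification element
  -- when `m ∣ N`; and `σ ^ N` still lifts `τ` when `N ≡ 1` modulo `p ^ j`.
  have hm : ∀ a : S, ∃ m : ℕ, ¬ p ∣ m ∧ (a ≠ 0 → Sim B ((σ a / a) ^ m) 1) := by
    intro a
    obtain ⟨n, hn, hna⟩ := exists_pow_apply_eq σ a
    obtain ⟨k, m, hm, rfl⟩ := Nat.exists_eq_pow_mul_and_not_dvd hn.ne' _ hp.ne_one
    refine ⟨m, hm, fun ha => ?_⟩
    refine Sim.of_pow_residueChar_pow hp one_ne_zero k ?_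
    rw [one_pow, ← pow_mul, mul_comm m]
    refine hσ.sim_one_of_pow hst ?_
    rw [hna]
    exact Sim.refl ha
  choose m hmp hma using hm
  have hN : ∀ s : Finset S, ∃ N : ℕ, N ≡ 1 [MOD p ^ j] ∧ ∀ a ∈ s, m a ∣ N := by
    intro s
    have hco : Nat.Coprime (p ^ j) (∏ a ∈ s, m a) :=
      Nat.Coprime.pow_left _ (Nat.Coprime.prod_right fun a _ =>
        (Nat.Prime.coprime_iff_not_dvd hp).2 (hmp a))
    obtain ⟨N, h1, h2⟩ := Nat.chineseRemainder hco 1 0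
    exact ⟨N, h1, fun a ha => (Finset.dvd_prod_of_mem m ha).trans (Nat.modEq_zero_iff_dvd.1 h2)⟩
  choose N hN1 hN2 using hN
  -- The exponent `N s` serves only the finite set `s`. By compactness of the Galois group the `σ ^
  -- N s` have a limit `ρ`, which on each given element agrees with `σ ^ N s` for arbitrarily large
  -- `s`.
  let U : Ultrafilter (S ≃ₐ[K] S) :=
    Ultrafilter.of (Filter.map (fun s : Finset S => σ ^ N s) Filter.atTop)
  have hU : (U : Filter (S ≃ₐ[K] S)) ≤ Filter.map (fun s : Finset S => σ ^ N s) Filter.atTop :=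
    Ultrafilter.of_le _
  obtain ⟨ρ, -, hρ⟩ := isCompact_univ.ultrafilter_le_nhds U (by simp)
  have hev : ∀ a : S, ∀ᶠ g : S ≃ₐ[K] S in U, g a = ρ a := fun a => by
    refine hρ (mem_nhds_iff.2 ⟨_, fun g hg => ?_,
      (stabilizer_isOpen_of_isIntegral (K := K) a).leftCoset ρ, ⟨1, one_mem _, mul_one ρ⟩⟩)
    obtain ⟨h, hh, rfl⟩ := hg
    change ρ (h a) = ρ a
    rw [show h a = a from hh]
  refine ⟨ρ, mem_ramificationGroup_iff.2 fun a ha => ?_, fun x => ?_⟩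
  · have h1 : ∀ᶠ g : S ≃ₐ[K] S in U, Sim B (g a) a := by
      refine hU ?_
      rw [Filter.mem_map]
      filter_upwards [Filter.eventually_ge_atTop ({a} : Finset S)] with s hs
      obtain ⟨d, hd⟩ := hN2 s a (hs (Finset.mem_singleton_self a))
      have h2 := hσ.sim_pow hst (N s) ha
      have h3 := (hma a ha).pow d
      rw [one_pow, ← pow_mul, ← hd] at h3
      have h4 := h3.mul (Sim.refl (B := B) ha)
      rw [one_mul] at h4
      exact h2.trans h4
    obtain ⟨g, hg1, hg2⟩ := (h1.and (hev a)).exists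
    rwa [hg2] at hg1
  · have h1 : ∀ᶠ g : S ≃ₐ[K] S in U, g (algebraMap E S x) = algebraMap E S (τ x) := by
      refine hU ?_
      rw [Filter.mem_map]
      refine Filter.Eventually.of_forall fun s => ?_
      change (σ ^ N s) (algebraMap E S x) = algebraMap E S (τ x)
      rw [hσn]
      have : τ ^ N s = τ ^ 1 :=
        pow_eq_pow_iff_modEq.2 ((hN1 s).of_dvd (orderOf_dvd_of_pow_eq_one hj))
      rw [this, pow_one]
    obtain ⟨g, hg1, hg2⟩ := (h1.and (hev (algebraMap E S x))).exists
    rw [← hg2, hg1]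

end Lifting

/-! ### The fundamental inequality -/

section FundamentalInequality

variable (K : Type*) {E : Type*} [Field K] [Field E] [Algebra K E] (B : ValuationSubring E)

/-- The residue field extension. -/
@[reducible]
noncomputable def residueAlgebra :
    Algebra (ResidueField (B.comap (algebraMap K E))) (ResidueField B) :=
  (residueMap K B).toAlgebra

/-- The elements whose value lies in the value group of `K`. -/
noncomputable def valueUnits : Subgroup Eˣ :=
  (valueSubgroup K B).comap (Units.map (B.valuation : E →* B.ValueGroup))

variable {K B} in
lemma mem_valueUnits {x : Eˣ} :
    x ∈ valueUnits K B ↔ ∃ k : K, k ≠ 0 ∧ B.valuation (algebraMap K E k) = B.valuation (x : E) := by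
  rw [valueUnits, Subgroup.mem_comap, valueSubgroup, MonoidHom.mem_range]
  constructor
  · rintro ⟨k, hk⟩
    exact ⟨k, k.ne_zero, congrArg Units.val hk⟩
  · rintro ⟨k, hk, h⟩
    exact ⟨Units.mk0 k hk, Units.ext h⟩

lemma units_map_valuation_surjective :
    Function.Surjective (Units.map (B.valuation : E →* B.ValueGroup)) := by
  intro γ
  obtain ⟨x, hx⟩ := B.valuation_surjective (γ : B.ValueGroup)
  have hx0 : x ≠ 0 := by
    rintro rfl
    rw [map_zero] at hx
    exact γ.ne_zero hx.symm
  exact ⟨Units.mk0 x hx0, Units.ext hx⟩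

/-- Taking preimages in the units of `E` keeps the index and lets cosets be represented by field
elements. -/
lemma ramificationIndex_eq : ramificationIndex K B = (valueUnits K B).index :=
  (Subgroup.index_comap_of_surjective _ (units_map_valuation_surjective B)).symm

variable {K B}

/-- The value of a combination of elements with independent residues. -/
lemma exists_valuation_sum_eq {κ : Type*} [Fintype κ] {y : κ → B}
    (hy : letI := residueAlgebra K B
      LinearIndependent (ResidueField (B.comap (algebraMap K E))) fun k => residue B (y k))
    {c : κ → K} (hc : c ≠ 0) :
    ∃ a : K, a ≠ 0 ∧ B.valuation (∑ k, algebraMap K E (c k) * y k) =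
      B.valuation (algebraMap K E a) := by
  classical
  let _ := residueAlgebra K B
  obtain ⟨k₁, hk₁⟩ := Function.ne_iff.1 hc
  obtain ⟨k₀, -, hmax⟩ := Finset.univ.exists_max_image
    (fun k => B.valuation (algebraMap K E (c k))) ⟨k₁, Finset.mem_univ k₁⟩
  have hk₀ : c k₀ ≠ 0 := by
    intro h0
    have := hmax k₁ (Finset.mem_univ _)
    rw [h0, map_zero, map_zero, le_zero_iff, map_eq_zero, map_eq_zero] at this
    exact hk₁ this
  refine ⟨c k₀, hk₀, ?_⟩
  have hmem : ∀ k, c k / c k₀ ∈ B.comap (algebraMap K E) := by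
    intro k
    rw [ValuationSubring.mem_comap, ← ValuationSubring.valuation_le_one_iff, map_div₀, map_div₀]
    exact div_le_one_of_le₀ (hmax k (Finset.mem_univ _)) zero_le
  -- After division by the coefficient of largest value all coefficients are integral and one of
  -- them is `1`, so independence makes the residue of the sum nonzero.
  let d : κ → B.comap (algebraMap K E) := fun k => ⟨c k / c k₀, hmem k⟩
  have hunit : IsUnit (∑ k, restrictHom K B (d k) * y k) := by
    rw [isUnit_iff_residue_ne_zero, map_sum]
    intro h0
    have h1 : ∑ k, residue _ (d k) • residue B (y k) = 0 := by
      rw [← h0]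
      refine Finset.sum_congr rfl fun k _ => ?_
      rw [Algebra.smul_def, map_mul]
      rfl
    have h2 := Fintype.linearIndependent_iff.1 hy _ h1 k₀
    have h3 : d k₀ = 1 := Subtype.ext (div_self hk₀)
    rw [h3, map_one] at h2
    exact one_ne_zero h2
  rw [ValuationSubring.valuation_eq_one_iff] at hunit
  have h4 : ∑ k, algebraMap K E (c k) * y k =
      algebraMap K E (c k₀) * ((∑ k, restrictHom K B (d k) * y k : B) : E) := by
    rw [AddSubmonoidClass.coe_finsetSum, Finset.mul_sum]
    refine Finset.sum_congr rfl fun k _ => ?_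
    change _ = _ * (algebraMap K E (c k / c k₀) * _)
    rw [← mul_assoc, ← map_mul, mul_div_cancel₀ _ hk₀]
  rw [h4, map_mul, hunit, mul_one]

/-- Products of elements with independent values and elements with independent residues are
linearly independent. -/
theorem linearIndependent_mul_of_residue {ι κ : Type*} [Fintype ι] [Fintype κ] {x : ι → Eˣ}
    (hx : ∀ i j, (x i)⁻¹ * x j ∈ valueUnits K B → i = j) {y : κ → B}
    (hy : letI := residueAlgebra K B
      LinearIndependent (ResidueField (B.comap (algebraMap K E))) fun k => residue B (y k)) :
    LinearIndependent K fun ik : ι × κ => (x ik.1 : E) * y ik.2 := by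
  classical
  rw [Fintype.linearIndependent_iff]
  intro c hc
  by_contra! hne
  obtain ⟨⟨i₁, k₁⟩, hne⟩ := hne
  set z : ι → E := fun i => ∑ k, algebraMap K E (c (i, k)) * y k with hz
  have hval : ∀ i, z i ≠ 0 → ∃ a : K, a ≠ 0 ∧ B.valuation (z i) = B.valuation (algebraMap K E a) :=
    fun i hi => exists_valuation_sum_eq hy (c := fun k => c (i, k)) (by
      intro h0
      refine hi (Finset.sum_eq_zero fun k _ => ?_)
      have : c (i, k) = 0 := congrFun h0 k
      rw [this, map_zero, zero_mul])
  have hsum : ∑ i, (x i : E) * z i = 0 := by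
    rw [← hc, Fintype.sum_prod_type]
    refine Finset.sum_congr rfl fun i _ => ?_
    rw [hz, Finset.mul_sum]
    refine Finset.sum_congr rfl fun k _ => ?_
    rw [Algebra.smul_def]
    ring
  have hz₁ : z i₁ ≠ 0 := by
    obtain ⟨a, ha, h⟩ := exists_valuation_sum_eq (K := K) hy (c := fun k => c (i₁, k))
      (fun h0 => hne (congrFun h0 k₁))
    intro h0
    change B.valuation (z i₁) = _ at h
    rw [h0, map_zero, eq_comm, map_eq_zero, map_eq_zero] at h
    exact ha h
  obtain ⟨i₀, -, hmax⟩ := Finset.univ.exists_max_image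
    (fun i => B.valuation ((x i : E) * z i)) ⟨i₁, Finset.mem_univ i₁⟩
  have hz₀ : z i₀ ≠ 0 := by
    intro h0
    have := hmax i₁ (Finset.mem_univ _)
    rw [h0, mul_zero, map_zero, le_zero_iff, map_eq_zero] at this
    exact mul_ne_zero (x i₁).ne_zero hz₁ this
  have hpos : B.valuation ((x i₀ : E) * z i₀) ≠ 0 := by
    rw [Ne, map_eq_zero]
    exact mul_ne_zero (x i₀).ne_zero hz₀
  -- Each nonzero `z i` has its value in `vK`, so the nonzero terms `x i * z i` have values in
  -- different cosets of `vK`. The maximum is therefore strict, and the sum cannot vanish.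
  have hlt : ∀ i ∈ Finset.univ.erase i₀,
      B.valuation ((x i : E) * z i) < B.valuation ((x i₀ : E) * z i₀) := by
    intro i hi
    refine lt_of_le_of_ne (hmax i (Finset.mem_univ _)) fun heq => ?_
    have hzi : z i ≠ 0 := by
      intro h0
      rw [h0, mul_zero, map_zero] at heq
      exact hpos heq.symm
    refine Finset.ne_of_mem_erase hi (hx i i₀ ?_)
    obtain ⟨a, ha, hva⟩ := hval i hzi
    obtain ⟨b, hb, hvb⟩ := hval i₀ hz₀
    rw [mem_valueUnits]
    refine ⟨a / b, div_ne_zero ha hb, ?_⟩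
    rw [map_mul, map_mul, hva, hvb] at heq
    rw [map_div₀, map_div₀, Units.val_mul, Units.val_inv_eq_inv_val, map_mul, map_inv₀,
      div_eq_iff (by simpa using hb), mul_assoc, ← heq, ← mul_assoc, inv_mul_cancel₀, one_mul]
    simp
  have h1 := Valuation.map_sum_lt B.valuation hpos hlt
  rw [← Finset.add_sum_erase _ _ (Finset.mem_univ i₀)] at hsum
  rw [eq_neg_of_add_eq_zero_right hsum, Valuation.map_neg] at h1
  exact lt_irrefl _ h1

variable (K B)

/-- Stated for finite sets of cosets and finite independent families, because the finiteness of the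
ramification index and of the residue degree is deduced from it. -/
lemma card_mul_card_le_finrank [FiniteDimensional K E] {m : ℕ} (t : Finset (Eˣ ⧸ valueUnits K B))
    {y : Fin m → ResidueField B}
    (hy : letI := residueAlgebra K B
      LinearIndependent (ResidueField (B.comap (algebraMap K E))) y) :
    t.card * m ≤ Module.finrank K E := by
  let _ := residueAlgebra K B
  choose y' hy' using fun k => residue_surjective (R := B) (y k)
  have hli := linearIndependent_mul_of_residue (K := K) (B := B)
    (x := fun i : t => (i : Eˣ ⧸ valueUnits K B).out)
    (fun i j hij => by
      have := QuotientGroup.eq.2 hij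
      rw [QuotientGroup.out_eq', QuotientGroup.out_eq'] at this
      exact Subtype.ext this)
    (y := y') (by simpa only [hy'] using hy)
  simpa using hli.fintype_card_le_finrank

lemma residue_finiteDimensional [FiniteDimensional K E] :
    letI := residueAlgebra K B
    FiniteDimensional (ResidueField (B.comap (algebraMap K E))) (ResidueField B) := by
  let _ := residueAlgebra K B
  have h : Module.rank (ResidueField (B.comap (algebraMap K E))) (ResidueField B) ≤
      Module.finrank K E := by
    refine rank_le fun s hs => ?_
    have h1 := card_mul_card_le_finrank K B {1} (y := fun i => (s.equivFin.symm i : ResidueField B))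
      (hs.comp _ s.equivFin.symm.injective)
    simpa using h1
  exact Module.rank_lt_aleph0_iff.1 (h.trans_lt Cardinal.natCast_lt_aleph0)

lemma finite_quotient_valueUnits [FiniteDimensional K E] : Finite (Eˣ ⧸ valueUnits K B) := by
  by_contra h
  rw [not_finite_iff_infinite] at h
  obtain ⟨t, ht⟩ := Infinite.exists_subset_card_eq (Eˣ ⧸ valueUnits K B) (Module.finrank K E + 1)
  let _ := residueAlgebra K B
  have := card_mul_card_le_finrank K B t (m := 1) (y := fun _ => 1)
    (LinearIndependent.of_subsingleton 0 one_ne_zero)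
  omega

lemma ramificationIndex_pos [FiniteDimensional K E] : 0 < ramificationIndex K B := by
  have := finite_quotient_valueUnits K B
  rw [ramificationIndex_eq]
  exact Nat.card_pos

lemma inertiaDegree_pos [FiniteDimensional K E] : 0 < inertiaDegree K B := by
  let _ := residueAlgebra K B
  have := residue_finiteDimensional K B
  exact Module.finrank_pos (R := ResidueField (B.comap (algebraMap K E))) (M := ResidueField B)

/-- The fundamental inequality. -/
theorem ramificationIndex_mul_inertiaDegree_le [FiniteDimensional K E] :
    ramificationIndex K B * inertiaDegree K B ≤ Module.finrank K E := by
  let _ := residueAlgebra K B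
  have := residue_finiteDimensional K B
  have := finite_quotient_valueUnits K B
  have := Fintype.ofFinite (Eˣ ⧸ valueUnits K B)
  have h := card_mul_card_le_finrank K B Finset.univ
    (Module.finBasis (ResidueField (B.comap (algebraMap K E))) (ResidueField B)).linearIndependent
  rw [Finset.card_univ, ← Nat.card_eq_fintype_card] at h
  rw [ramificationIndex_eq]
  exact h

end FundamentalInequality

/-! ### Ramification index, inertia degree and tameness in towers -/

section Tower

variable (K F : Type*) {E : Type*} [Field K] [Field F] [Field E] [Algebra K F] [Algebra F E]
  [Algebra K E] [IsScalarTower K F E] (B : ValuationSubring E)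

/-- Restricting the valuation in two steps or in one gives equal rings, but not definitionally; this
transports degrees along such an equality. -/
lemma finrank_residue_congr {k : Type*} [Field k] {A₁ A₂ : ValuationSubring K} (h : A₁ = A₂)
    (ψ₁ : ResidueField A₁ →+* k) (ψ₂ : ResidueField A₂ →+* k)
    (hψ : ∀ x (h₁ : x ∈ A₁) (h₂ : x ∈ A₂),
      ψ₁ (residue A₁ ⟨x, h₁⟩) = ψ₂ (residue A₂ ⟨x, h₂⟩)) :
    (letI := ψ₁.toAlgebra; Module.finrank (ResidueField A₁) k) =
      (letI := ψ₂.toAlgebra; Module.finrank (ResidueField A₂) k) := by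
  subst h
  have : ψ₁ = ψ₂ := by
    ext x
    obtain ⟨x, rfl⟩ := residue_surjective x
    exact hψ x x.2 x.2
  subst this
  rfl

lemma isSeparable_residue_congr {k : Type*} [Field k] {A₁ A₂ : ValuationSubring K} (h : A₁ = A₂)
    (ψ₁ : ResidueField A₁ →+* k) (ψ₂ : ResidueField A₂ →+* k)
    (hψ : ∀ x (h₁ : x ∈ A₁) (h₂ : x ∈ A₂),
      ψ₁ (residue A₁ ⟨x, h₁⟩) = ψ₂ (residue A₂ ⟨x, h₂⟩)) :
    (letI := ψ₁.toAlgebra; Algebra.IsSeparable (ResidueField A₁) k) ↔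
      (letI := ψ₂.toAlgebra; Algebra.IsSeparable (ResidueField A₂) k) := by
  subst h
  have : ψ₁ = ψ₂ := by
    ext x
    obtain ⟨x, rfl⟩ := residue_surjective x
    exact hψ x x.2 x.2
  subst this
  rfl

lemma residueMap_comp_residue (x : K) (h₁ : x ∈ (B.comap (algebraMap F E)).comap (algebraMap K F))
    (h₂ : x ∈ B.comap (algebraMap K E)) :
    ((residueMap F B).comp (residueMap K (B.comap (algebraMap F E)))) (residue _ ⟨x, h₁⟩) =
      residueMap K B (residue _ ⟨x, h₂⟩) := by
  change residue B _ = residue B _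
  congr 1
  exact Subtype.ext (IsScalarTower.algebraMap_apply K F E x).symm

theorem inertiaDegree_mul_inertiaDegree :
    inertiaDegree K (B.comap (algebraMap F E)) * inertiaDegree F B = inertiaDegree K B := by
  unfold inertiaDegree
  rw [← finrank_residue_congr K (comap_comap_algebraMap K F B)
    ((residueMap F B).comp (residueMap K (B.comap (algebraMap F E)))) (residueMap K B)
    (residueMap_comp_residue K F B)]
  let _ := (residueMap K (B.comap (algebraMap F E))).toAlgebra
  let _ := (residueMap F B).toAlgebra
  let _ := ((residueMap F B).comp (residueMap K (B.comap (algebraMap F E)))).toAlgebra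
  have : IsScalarTower (ResidueField ((B.comap (algebraMap F E)).comap (algebraMap K F)))
    (ResidueField (B.comap (algebraMap F E))) (ResidueField B) :=
    IsScalarTower.of_algebraMap_eq fun _ => rfl
  exact Module.finrank_mul_finrank _ _ _

lemma ResidueSeparable.tower_bot (h : ResidueSeparable K B) :
    ResidueSeparable K (B.comap (algebraMap F E)) := by
  unfold ResidueSeparable at *
  rw [← isSeparable_residue_congr K (comap_comap_algebraMap K F B)
    ((residueMap F B).comp (residueMap K (B.comap (algebraMap F E)))) (residueMap K B)
    (residueMap_comp_residue K F B)] at h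
  let _ := (residueMap K (B.comap (algebraMap F E))).toAlgebra
  let _ := (residueMap F B).toAlgebra
  let _ := ((residueMap F B).comp (residueMap K (B.comap (algebraMap F E)))).toAlgebra
  have : IsScalarTower (ResidueField ((B.comap (algebraMap F E)).comap (algebraMap K F)))
    (ResidueField (B.comap (algebraMap F E))) (ResidueField B) :=
    IsScalarTower.of_algebraMap_eq fun _ => rfl
  exact Algebra.isSeparable_tower_bot_of_isSeparable _ _ (ResidueField B)

/-- The elements of `E` with value in `vF` are the products of those with value in `vK` and of
elements of `F`. The second isomorphism theorem then identifies the index in `F` with a relative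
index in `E`. -/
theorem ramificationIndex_mul_ramificationIndex :
    ramificationIndex K (B.comap (algebraMap F E)) * ramificationIndex F B =
      ramificationIndex K B := by
  rw [ramificationIndex_eq, ramificationIndex_eq, ramificationIndex_eq]
  let φ : Fˣ →* Eˣ := Units.map (algebraMap F E : F →* E)
  have h1 : valueUnits K (B.comap (algebraMap F E)) = (valueUnits K B).comap φ := by
    ext x
    rw [Subgroup.mem_comap, mem_valueUnits, mem_valueUnits]
    refine exists_congr fun k => and_congr_right fun _ => ?_
    rw [comap_valuation_eq_iff, ← IsScalarTower.algebraMap_apply]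
    rfl
  have hle : valueUnits K B ≤ valueUnits F B := fun x hx => by
    obtain ⟨k, hk, hkx⟩ := mem_valueUnits.1 hx
    refine mem_valueUnits.2 ⟨algebraMap K F k, by simpa using hk, ?_⟩
    rw [← IsScalarTower.algebraMap_apply, hkx]
  have h2 : valueUnits F B = valueUnits K B ⊔ φ.range := by
    refine le_antisymm (fun x hx => ?_) (sup_le hle ?_)
    · obtain ⟨a, ha, hax⟩ := mem_valueUnits.1 hx
      let a' : Fˣ := Units.mk0 a ha
      have h3 : x * (φ a')⁻¹ ∈ valueUnits K B := by
        refine mem_valueUnits.2 ⟨1, one_ne_zero, ?_⟩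
        rw [map_one, map_one, Units.val_mul, Units.val_inv_eq_inv_val, map_mul, map_inv₀]
        change 1 = B.valuation (x : E) * (B.valuation (algebraMap F E a))⁻¹
        rw [hax, mul_inv_cancel₀]
        simp
      have h5 : φ a' ∈ φ.range := ⟨a', rfl⟩
      have h4 := Subgroup.mul_mem_sup h3 h5
      rwa [inv_mul_cancel_right] at h4
    · rintro _ ⟨a, rfl⟩
      exact mem_valueUnits.2 ⟨a, a.ne_zero, rfl⟩
  rw [← Subgroup.relIndex_mul_index hle, h1, Subgroup.index_comap, h2]
  congr 1
  rw [Subgroup.relIndex_sup_left]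

/-- Finite tame extensions of valued fields. -/
structure IsFiniteTame (K : Type*) {E : Type*} [Field K] [Field E] [Algebra K E]
    (B : ValuationSubring E) : Prop where
  coprime : 0 < residueChar B → (ramificationIndex K B).Coprime (residueChar B)
  separable : ResidueSeparable K B
  defectless : IsDefectless K B

theorem IsFiniteTame.tower_bot [FiniteDimensional K E] {B : ValuationSubring E}
    (h : IsFiniteTame K B) : IsFiniteTame K (B.comap (algebraMap F E)) where
  coprime hp := by
    rw [residueChar_comap] at hp ⊢
    exact (h.coprime hp).coprime_dvd_left
      (Dvd.intro _ (ramificationIndex_mul_ramificationIndex K F B))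
  separable := h.separable.tower_bot K F B
  -- The fundamental inequalities of the two steps multiply to an equality, so the lower one cannot
  -- be strict.
  defectless := by
    have : FiniteDimensional K F := FiniteDimensional.left K F E
    have : FiniteDimensional F E := FiniteDimensional.right K F E
    have h1 := ramificationIndex_mul_inertiaDegree_le K (B.comap (algebraMap F E))
    have h2 := ramificationIndex_mul_inertiaDegree_le F B
    have h3 : Module.finrank K E = _ := h.defectless
    rw [← ramificationIndex_mul_ramificationIndex K F, ← inertiaDegree_mul_inertiaDegree K F,
      ← Module.finrank_mul_finrank K F E, mul_mul_mul_comm] at h3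
    have h4 : 0 < Module.finrank F E := Module.finrank_pos
    refine le_antisymm ?_ h1
    by_contra! hlt
    exact absurd h3 (Nat.mul_lt_mul_of_lt_of_le hlt h2 h4).ne'

theorem IsFiniteTame.comap_algHom {K F E : Type*} [Field K] [Field F] [Field E] [Algebra K F]
    [Algebra K E] [FiniteDimensional K E] {B : ValuationSubring E} (h : IsFiniteTame K B)
    (φ : F →ₐ[K] E) : IsFiniteTame K (B.comap (φ : F →+* E)) := by
  let _ : Algebra F E := (φ : F →+* E).toAlgebra
  have : IsScalarTower K F E := IsScalarTower.of_algebraMap_eq fun x => (φ.commutes x).symm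
  exact h.tower_bot K F

end Tower

/-! ### Finite Galois extensions with trivial ramification group -/

section GaloisTame

variable {K E : Type*} [Field K] [Field E] [Algebra K E] {B : ValuationSubring E}

/-- The action of the Galois group on the residue field. -/
noncomputable def residueHom (hst : Stable K B) :
    letI := residueAlgebra K B
    (E ≃ₐ[K] E) →* (ResidueField B ≃ₐ[ResidueField (B.comap (algebraMap K E))] ResidueField B) :=
  letI := residueAlgebra K B
  letI := hst.mulSemiringAction
  haveI : SMulCommClass (E ≃ₐ[K] E) (ResidueField (B.comap (algebraMap K E))) (ResidueField B) :=
    ⟨fun g a x => by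
      obtain ⟨a, rfl⟩ := residue_surjective a
      obtain ⟨x, rfl⟩ := residue_surjective x
      rw [Algebra.smul_def, Algebra.smul_def, smul_mul']
      congr 1
      change residue B _ = residue B _
      congr 1
      exact Subtype.ext (g.commutes _)⟩
  MulSemiringAction.toAlgAut (E ≃ₐ[K] E) (ResidueField (B.comap (algebraMap K E))) (ResidueField B)

lemma residueHom_residue (hst : Stable K B) (σ : E ≃ₐ[K] E) (x : B) :
    residueHom hst σ (residue B x) = residue B ⟨σ x, hst σ x x.2⟩ := rfl

lemma mem_ker_residueHom_iff [Algebra.IsAlgebraic K E] (hst : Stable K B) {σ : E ≃ₐ[K] E} :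
    σ ∈ (residueHom hst).ker ↔ IsInertial K B σ := by
  let _ := residueAlgebra K B
  rw [MonoidHom.mem_ker]
  constructor
  · intro h u hu
    have h1 := DFunLike.congr_fun h (residue B ⟨u, mem_of_valuation_eq_one hu⟩)
    rw [residueHom_residue] at h1
    exact (sim_iff_residue_eq (a := ⟨σ u, hst σ u (mem_of_valuation_eq_one hu)⟩)
      (b := ⟨u, mem_of_valuation_eq_one hu⟩) ((B.valuation_eq_one_iff _).2 hu)).2 h1
  · intro h
    refine AlgEquiv.ext fun x => ?_
    obtain ⟨x, rfl⟩ := residue_surjective x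
    change _ = residue B x
    rw [residueHom_residue]
    by_cases hx : IsUnit x
    · exact (sim_iff_residue_eq (a := ⟨σ x, hst σ x x.2⟩) hx).1
        (h x ((B.valuation_eq_one_iff x).1 hx))
    · have h1 : residue B x = 0 := (residue_eq_zero_iff _).2 hx
      have h2 : ¬ IsUnit (⟨σ x, hst σ x x.2⟩ : B) := by
        rw [ValuationSubring.valuation_eq_one_iff, hst.valuation_eq,
          ← ValuationSubring.valuation_eq_one_iff]
        exact hx
      rw [h1]
      exact (residue_eq_zero_iff _).2 h2

variable [FiniteDimensional K E]

/-- The inertia group embeds into the group of characters of the value group, if the ramification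
group is trivial. -/
theorem card_ker_residueHom_le (hst : Stable K B) (hR : ramificationGroup K B = ⊥) :
    Nat.card (residueHom hst).ker ≤ ramificationIndex K B := by
  have hfinQ := finite_quotient_valueUnits K B
  have := Fintype.ofFinite (Eˣ ⧸ valueUnits K B)
  have hone : ∀ (σ : E ≃ₐ[K] E) (x : Eˣ), B.valuation (σ x / x) = 1 := fun σ x => by
    rw [map_div₀, hst.valuation_eq, div_self]
    simp
  let u : (E ≃ₐ[K] E) → Eˣ → B := fun σ x => ⟨σ x / x, mem_of_valuation_eq_one (hone σ x)⟩
  have hu : ∀ σ x, IsUnit (u σ x) := fun σ x => (B.valuation_eq_one_iff _).2 (hone σ x)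
  -- The character of `σ` is `x ↦ σ x / x` modulo the maximal ideal. For inertial `σ` it is trivial
  -- on elements with value in `vK`, since these are products of units and of elements of `K`.
  let χ₀ : (E ≃ₐ[K] E) → Eˣ →* (ResidueField B)ˣ := fun σ =>
    { toFun := fun x => Units.mk0 (residue B (u σ x)) (isUnit_iff_residue_ne_zero.1 (hu σ x))
      map_one' := by
        refine Units.ext ?_
        change residue B (u σ 1) = 1
        rw [← map_one (residue B)]
        congr 1
        refine Subtype.ext ?_
        change σ ((1 : Eˣ) : E) / ((1 : Eˣ) : E) = 1
        simp
      map_mul' := fun x y => by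
        refine Units.ext ?_
        change residue B (u σ (x * y)) = residue B (u σ x) * residue B (u σ y)
        rw [← map_mul]
        congr 1
        refine Subtype.ext ?_
        change σ ((x * y : Eˣ) : E) / ((x * y : Eˣ) : E) = σ x / x * (σ y / y)
        rw [Units.val_mul, map_mul, mul_div_mul_comm] }
  have hχ₀ : ∀ σ : (residueHom hst).ker, valueUnits K B ≤ (χ₀ σ).ker := by
    rintro ⟨σ, hσ⟩ x hx
    rw [mem_ker_residueHom_iff] at hσ
    obtain ⟨k, hk, hkx⟩ := mem_valueUnits.1 hx
    rw [MonoidHom.mem_ker]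
    refine Units.ext ?_
    change residue B (u σ x) = 1
    rw [← map_one (residue B), ← sim_iff_residue_eq isUnit_one]
    change Sim B (σ x / x) 1
    rw [sim_one_iff x.ne_zero]
    have hk' : algebraMap K E k ≠ 0 := by simpa using hk
    have h1 : B.valuation ((x : E) / algebraMap K E k) = 1 := by
      rw [map_div₀, hkx, div_self]
      simp
    have h2 := (hσ _ h1).mul (Sim.refl (B := B) hk')
    rw [map_div₀, AlgEquiv.commutes, div_mul_cancel₀ _ hk', div_mul_cancel₀ _ hk'] at h2
    exact h2
  let χ : (residueHom hst).ker → (Eˣ ⧸ valueUnits K B →* ResidueField B) := fun σ =>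
    (Units.coeHom (ResidueField B)).comp (QuotientGroup.lift _ (χ₀ σ) (hχ₀ σ))
  have hχ : ∀ (σ : (residueHom hst).ker) (x : Eˣ), χ σ (x : Eˣ ⧸ valueUnits K B) =
      residue B (u σ x) := fun _ _ => rfl
  have hinj : Function.Injective χ := by
    intro σ τ h
    refine Subtype.ext ?_
    -- Equal characters mean `σ a ~ τ a` for all `a ≠ 0`.
    have hmem : (τ : E ≃ₐ[K] E)⁻¹ * σ ∈ ramificationGroup K B := by
      rw [mem_ramificationGroup_iff]
      intro a ha
      have h1 := DFunLike.congr_fun h ((Units.mk0 a ha : Eˣ) : Eˣ ⧸ valueUnits K B)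
      rw [hχ, hχ, ← sim_iff_residue_eq (hu _ _)] at h1
      change Sim B ((σ : E ≃ₐ[K] E) a / a) ((τ : E ≃ₐ[K] E) a / a) at h1
      have h2 := h1.mul (Sim.refl (B := B) ha)
      rw [div_mul_cancel₀ _ ha, div_mul_cancel₀ _ ha] at h2
      rw [← hst.sim_iff (τ : E ≃ₐ[K] E), AlgEquiv.mul_apply]
      have h3 : (τ : E ≃ₐ[K] E) ((τ : E ≃ₐ[K] E)⁻¹ ((σ : E ≃ₐ[K] E) a)) = (σ : E ≃ₐ[K] E) a :=
        (τ : E ≃ₐ[K] E).apply_symm_apply _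
      rwa [h3]
    rw [hR, Subgroup.mem_bot] at hmem
    exact (inv_mul_eq_one.1 hmem).symm
  -- By Dedekind, distinct characters are linearly independent functions on a set with `(vE : vK)`
  -- elements, which bounds their number.
  have hli := (linearIndependent_monoidHom (Eˣ ⧸ valueUnits K B) (ResidueField B)).comp χ hinj
  have := Fintype.ofFinite (residueHom hst).ker
  have hle := hli.fintype_card_le_finrank
  rw [Module.finrank_fintype_fun_eq_card, ← Nat.card_eq_fintype_card,
    ← Nat.card_eq_fintype_card] at hle
  rw [ramificationIndex_eq]
  exact hle

/-- A finite Galois extension with trivial ramification group is tame. -/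
theorem isFiniteTame_of_ramificationGroup_eq_bot [IsGalois K E] (hst : Stable K B)
    (hR : ramificationGroup K B = ⊥) : IsFiniteTame K B := by
  let _ := residueAlgebra K B
  have hfin := residue_finiteDimensional K B
  have he := ramificationIndex_pos K B
  have hf := inertiaDegree_pos K B
  have hef := ramificationIndex_mul_inertiaDegree_le K B
  have hI := card_ker_residueHom_le hst hR
  -- The order `[E : K]` of the group is the product of the orders of image and kernel, bounded by
  -- `f` and `e` respectively. As `e f ≤ [E : K]`, both bounds are equalities.
  have hG : Nat.card (residueHom hst).range * Nat.card (residueHom hst).ker =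
      Module.finrank K E := by
    rw [← IsGalois.card_aut_eq_finrank, mul_comm]
    rw [← Subgroup.index_ker]
    exact Subgroup.card_mul_index _
  have hfix := IntermediateField.finrank_fixedField_eq_card (residueHom hst).range
  have hmul := Module.finrank_mul_finrank (ResidueField (B.comap (algebraMap K E)))
    (IntermediateField.fixedField (residueHom hst).range) (ResidueField B)
  have hfdef : inertiaDegree K B =
    Module.finrank (ResidueField (B.comap (algebraMap K E))) (ResidueField B) := rfl
  rw [hfix, ← hfdef] at hmul
  have hle : Nat.card (residueHom hst).range ≤ inertiaDegree K B :=
    Nat.le_of_dvd hf (Dvd.intro_left _ hmul)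
  have hpos : 0 < Nat.card (residueHom hst).ker := Nat.card_pos
  have h1 : Nat.card (residueHom hst).range = inertiaDegree K B := by
    refine le_antisymm hle ?_
    by_contra! hlt
    have := Nat.mul_lt_mul_of_lt_of_le hlt hI he
    rw [hG, mul_comm] at this
    omega
  have h2 : Nat.card (residueHom hst).ker = ramificationIndex K B := by
    refine le_antisymm hI ?_
    by_contra! hlt
    have := Nat.mul_lt_mul_of_le_of_lt hle hlt hf
    rw [hG, mul_comm] at this
    omega
  refine ⟨fun hp => ?_, ?_, ?_⟩
  · have hp' : (residueChar B).Prime := residueChar_prime_or_zero.resolve_right hp.ne'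
    rw [← h2, Nat.coprime_comm, Nat.Prime.coprime_iff_not_dvd hp']
    intro hdvd
    have : Fact (residueChar B).Prime := ⟨hp'⟩
    -- Otherwise Cauchy's theorem gives an inertial element of order `p`, which must lie in the
    -- trivial ramification group.
    obtain ⟨σ, hσ⟩ := exists_prime_orderOf_dvd_card' (residueChar B) hdvd
    have h3 : (σ : E ≃ₐ[K] E) ∈ ramificationGroup K B := by
      refine IsInertial.mem_ramificationGroup hst hp' ((mem_ker_residueHom_iff hst).1 σ.2)
        (k := 1) ?_
      have h4 : σ ^ residueChar B = 1 := by rw [← hσ, pow_orderOf_eq_one]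
      have h5 : (σ : E ≃ₐ[K] E) ^ residueChar B = 1 := congrArg Subtype.val h4
      rw [pow_one, h5]
      exact one_mem _
    rw [hR, Subgroup.mem_bot] at h3
    have h6 : σ = 1 := Subtype.ext h3
    rw [h6, orderOf_one] at hσ
    exact hp'.one_lt.ne hσ
  · have hgal : IsGalois (ResidueField (B.comap (algebraMap K E))) (ResidueField B) := by
      refine IsGalois.of_card_aut_eq_finrank _ _ (le_antisymm ?_ ?_)
      · rw [Nat.card_eq_fintype_card]
        exact AlgEquiv.card_le
      · rw [← hfdef, ← h1]
        exact Subgroup.card_le_card_group _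
    exact hgal.to_isSeparable
  · rw [IsDefectless, ← hG, h1, h2, mul_comm]

end GaloisTame

/-! ### The absolute ramification field -/

section AbsoluteRamification

variable {K Ω : Type*} [Field K] [Field Ω] [Algebra K Ω] {C : ValuationSubring Ω}

lemma residueChar_eq_of_charP {q : ℕ} (hq : q.Prime) [CharP Ω q] : residueChar C = q := by
  have : CharP C q := (RingHom.charP_iff C.subtype Subtype.val_injective q).2 inferInstance
  exact ringChar.eq_iff.2 (CharP.of_ringHom_of_ne_zero (residue C) q hq.ne_zero)

lemma Sim.of_pow_expChar_pow {q : ℕ} [ExpChar Ω q] {a b : Ω} (hb : b ≠ 0) (n : ℕ)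
    (h : Sim C (a ^ q ^ n) (b ^ q ^ n)) : Sim C a b := by
  rcases ‹ExpChar Ω q› with _ | hq
  · simpa using h
  · have hq2 := residueChar_eq_of_charP (C := C) hq
    rw [← hq2] at h
    exact Sim.of_pow_residueChar_pow (hq2 ▸ hq) hb n h

lemma restrictNormal_mem_ramificationGroup {S : Type*} [Field S] [Algebra K S] [Algebra S Ω]
    [IsScalarTower K S Ω] [Normal K S] {σ : Ω ≃ₐ[K] Ω} (hσ : σ ∈ ramificationGroup K C) :
    σ.restrictNormal S ∈ ramificationGroup K (C.comap (algebraMap S Ω)) := by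
  rw [mem_ramificationGroup_iff] at hσ ⊢
  intro a ha
  rw [sim_comap_iff, AlgEquiv.restrictNormal_commutes]
  exact hσ _ (by simpa using ha)

lemma Stable.conj_mem_ramificationGroup (hst : Stable K C) (σ : Ω ≃ₐ[K] Ω) {ρ : Ω ≃ₐ[K] Ω}
    (hρ : ρ ∈ ramificationGroup K C) : σ⁻¹ * ρ * σ ∈ ramificationGroup K C := by
  rw [mem_ramificationGroup_iff] at hρ ⊢
  intro a ha
  have h := hρ (σ a) (by simpa using ha)
  rw [← hst.sim_iff σ⁻¹] at h
  have e : σ⁻¹ (σ a) = a := σ.symm_apply_apply a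
  rw [e] at h
  exact h

variable [Normal K Ω]

/-- A power of `a` with exponent a power of the characteristic exponent is separable, and `~` can be
cancelled from such powers. This allows passage between the separable and the algebraic closure. -/
lemma mem_ramificationGroup_of_forall_separable {σ : Ω ≃ₐ[K] Ω}
    (h : ∀ a, a ≠ 0 → IsSeparable K a → Sim C (σ a) a) : σ ∈ ramificationGroup K C := by
  rw [mem_ramificationGroup_iff]
  intro a ha
  obtain ⟨q, hq⟩ := ExpChar.exists K
  obtain ⟨n, y, hy⟩ := IsPurelyInseparable.pow_mem (separableClosure K Ω) q a
  have : ExpChar Ω q := expChar_of_injective_algebraMap (algebraMap K Ω).injective q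
  refine Sim.of_pow_expChar_pow (q := q) ha n ?_
  rw [← map_pow]
  refine h _ (pow_ne_zero _ ha) ?_
  rw [← hy]
  exact mem_separableClosure_iff.1 y.2

/-- Restriction to the separable closure and lifting from it respect ramification groups; afterwards
only automorphisms of `Ω` are needed. -/
theorem mem_absoluteRamificationField_iff {x : Ω} : x ∈ absoluteRamificationField K C ↔
    IsSeparable K x ∧ ∀ σ ∈ ramificationGroup K C, σ x = x := by
  set S := separableClosure K Ω
  constructor
  · intro h
    have hx : x ∈ S := IntermediateField.lift_le _ h
    refine ⟨mem_separableClosure_iff.1 hx, fun σ hσ => ?_⟩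
    have h1 : (⟨x, hx⟩ : S) ∈ IntermediateField.fixedField
        (ramificationGroup K (C.comap (algebraMap S Ω))) := (IntermediateField.mem_lift _).1 h
    rw [IntermediateField.mem_fixedField_iff] at h1
    have h2 := h1 _ (restrictNormal_mem_ramificationGroup hσ)
    have h3 := AlgEquiv.restrictNormal_commutes σ S ⟨x, hx⟩
    rw [h2] at h3
    exact h3.symm
  · rintro ⟨hsep, h⟩
    have hx : x ∈ S := mem_separableClosure_iff.2 hsep
    refine (IntermediateField.mem_lift (⟨x, hx⟩ : S)).2 ?_
    rw [IntermediateField.mem_fixedField_iff]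
    intro τ hτ
    rw [mem_ramificationGroup_iff] at hτ
    have hmem : τ.liftNormal Ω ∈ ramificationGroup K C := by
      refine mem_ramificationGroup_of_forall_separable fun a ha has => ?_
      have h4 := hτ ⟨a, mem_separableClosure_iff.2 has⟩ (by simpa [Subtype.ext_iff] using ha)
      rw [sim_comap_iff, ← AlgEquiv.liftNormal_commutes] at h4
      exact h4
    have h5 := h _ hmem
    have h6 := AlgEquiv.liftNormal_commutes τ Ω (⟨x, hx⟩ : S)
    apply Subtype.ext
    exact h6.symm.trans h5

lemma Stable.normal_absoluteRamificationField (hst : Stable K C) :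
    Normal K (absoluteRamificationField K C) := by
  rw [IntermediateField.normal_iff_forall_map_le']
  rintro σ _ ⟨x, hx, rfl⟩
  have hx := mem_absoluteRamificationField_iff.1 hx
  refine mem_absoluteRamificationField_iff.2 ⟨?_, fun ρ hρ => ?_⟩
  · have := hx.1
    unfold IsSeparable at *
    have h2 : minpoly K (σ x) = minpoly K x := minpoly.algEquiv_eq σ x
    exact h2 ▸ this
  · have h := hx.2 _ (hst.conj_mem_ramificationGroup σ hρ)
    have h2 := congrArg σ h
    have e : ∀ y, σ (σ⁻¹ y) = y := fun y => σ.apply_symm_apply y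
    have h3 : σ ((σ⁻¹ * ρ * σ) x) = ρ (σ x) := e _
    rw [h3] at h2
    exact h2

/-- Elements of the ramification group of a finite Galois subextension lift to the ramification
group. -/
lemma Stable.exists_mem_ramificationGroup_lift (hst : Stable K C) (N : IntermediateField K Ω)
    [FiniteDimensional K N] [IsGalois K N] {τ : N ≃ₐ[K] N}
    (hτ : τ ∈ ramificationGroup K (C.comap (algebraMap N Ω))) :
    ∃ ρ ∈ ramificationGroup K C, ∀ x : N, ρ x = τ x := by
  set S := separableClosure K Ω
  have hNS : N ≤ S := le_separableClosure K Ω N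
  let _ : Algebra N S := (IntermediateField.inclusion hNS).toAlgebra
  have : IsScalarTower K N S := IsScalarTower.of_algebraMap_eq fun _ => rfl
  have : IsScalarTower N S Ω := IsScalarTower.of_algebraMap_eq fun _ => rfl
  rw [← comap_comap_algebraMap N S C] at hτ
  have hS : Stable K (C.comap (algebraMap S Ω)) := hst.of_isScalarTower
  obtain ⟨ρ, hρ, h⟩ := ValuedField.exists_mem_ramificationGroup_lift hS hτ
  refine ⟨ρ.liftNormal Ω, ?_, fun x => ?_⟩
  · refine mem_ramificationGroup_of_forall_separable fun a ha has => ?_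
    have h4 := mem_ramificationGroup_iff.1 hρ ⟨a, mem_separableClosure_iff.2 has⟩
      (by simpa [Subtype.ext_iff] using ha)
    rw [sim_comap_iff, ← AlgEquiv.liftNormal_commutes] at h4
    exact h4
  · have h5 := AlgEquiv.liftNormal_commutes ρ Ω (algebraMap N S x)
    rw [h x] at h5
    exact h5

lemma Stable.ramificationGroup_eq_bot_of_le (hst : Stable K C) {N : IntermediateField K Ω}
    [FiniteDimensional K N] [IsGalois K N] (hN : N ≤ absoluteRamificationField K C) :
    ramificationGroup K (C.comap (algebraMap N Ω)) = ⊥ := by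
  rw [eq_bot_iff]
  intro τ hτ
  obtain ⟨ρ, hρ, h⟩ := hst.exists_mem_ramificationGroup_lift N hτ
  rw [Subgroup.mem_bot]
  ext x
  exact (h x).symm.trans ((mem_absoluteRamificationField_iff.1 (hN x.2)).2 ρ hρ)

/-- An automorphism that fixes the absolute ramification field lies in the ramification group. -/
theorem mem_ramificationGroup_of_fixes {σ : Ω ≃ₐ[K] Ω}
    (h : ∀ x ∈ absoluteRamificationField K C, σ x = x) : σ ∈ ramificationGroup K C := by
  refine mem_ramificationGroup_of_forall_separable fun a ha has => ?_
  obtain ⟨N, _, _, haN, -⟩ := exists_finite_galois (K := K) (s := {a}) (Set.finite_singleton a)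
    (by rintro _ rfl; exact has)
  -- The fixed field of `H` in `N` lies in the absolute ramification field, so `σ` fixes it. The
  -- finite Galois correspondence puts the restriction of `σ` into `H`, without any closedness
  -- argument for the ramification group.
  set H := (ramificationGroup K C).map (AlgEquiv.restrictNormalHom N)
  have h1 : σ.restrictNormal N ∈ (IntermediateField.fixedField H).fixingSubgroup := by
    rw [IntermediateField.mem_fixingSubgroup_iff]
    intro x hx
    rw [IntermediateField.mem_fixedField_iff] at hx
    apply Subtype.ext
    refine (AlgEquiv.restrictNormal_commutes σ N x).trans (h x ?_)
    refine mem_absoluteRamificationField_iff.2 ⟨?_, fun ρ hρ => ?_⟩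
    · exact mem_separableClosure_iff.1 (le_separableClosure K Ω N x.2)
    · have h2 := hx _ (Subgroup.mem_map_of_mem _ hρ)
      exact (AlgEquiv.restrictNormal_commutes ρ N x).symm.trans (congrArg Subtype.val h2)
  rw [IntermediateField.fixingSubgroup_fixedField] at h1
  obtain ⟨ρ, hρ, hρσ⟩ := h1
  have haN' : a ∈ N := haN rfl
  have h3 := AlgEquiv.restrictNormal_commutes ρ N ⟨a, haN'⟩
  have h4 := AlgEquiv.restrictNormal_commutes σ N ⟨a, haN'⟩
  have h5 : ρ a = σ a := by
    refine h3.symm.trans (Eq.trans ?_ h4)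
    exact congrArg (fun τ : N ≃ₐ[K] N => algebraMap N Ω (τ ⟨a, haN'⟩)) hρσ
  rw [← h5]
  exact mem_ramificationGroup_iff.1 hρ a ha

lemma exists_finite_galois_le {Z : IntermediateField K Ω} [Normal K Z] [Algebra.IsSeparable K Z]
    {F : IntermediateField K Ω} [FiniteDimensional K F] (hF : F ≤ Z) :
    ∃ N : IntermediateField K Ω, FiniteDimensional K N ∧ IsGalois K N ∧ F ≤ N ∧ N ≤ Z := by
  obtain ⟨s, hs⟩ := IntermediateField.fg_def.1 (F.fg_of_fg_toSubalgebra
    (Subalgebra.fg_of_fg_toSubmodule (Module.Finite.iff_fg.1 ‹FiniteDimensional K F›)))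
  have hsF : s ⊆ F := by
    rw [← hs.2]
    exact IntermediateField.subset_adjoin K s
  obtain ⟨N, h1, h2, h3, h4⟩ := exists_finite_galois (K := K) hs.1 (fun x hx =>
    mem_separableClosure_iff.1 (le_separableClosure K Ω Z (hF (hsF hx))))
  refine ⟨N, h1, h2, ?_, h4 Z inferInstance (hsF.trans hF)⟩
  rw [← hs.2, IntermediateField.adjoin_le_iff]
  exact h3

lemma isSeparable_absoluteRamificationField :
    Algebra.IsSeparable K (absoluteRamificationField K C) :=
  ⟨fun x => (isSeparable_map_iff (absoluteRamificationField K C).val Subtype.val_injective).1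
    (mem_absoluteRamificationField_iff.1 x.2).1⟩

/-- Finite extensions inside of the absolute ramification field are tame. -/
theorem Stable.isFiniteTame_of_forall_mem (hst : Stable K C) {F : Type*} [Field F] [Algebra K F]
    [FiniteDimensional K F] (φ : F →ₐ[K] Ω) (hφ : ∀ x, φ x ∈ absoluteRamificationField K C) :
    IsFiniteTame K (C.comap (φ : F →+* Ω)) := by
  have := hst.normal_absoluteRamificationField
  have := isSeparable_absoluteRamificationField (K := K) (C := C)
  have hφ' : φ.fieldRange ≤ absoluteRamificationField K C := by
    rintro _ ⟨x, rfl⟩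
    exact hφ x
  have : FiniteDimensional K φ.fieldRange :=
    Module.Finite.equiv (AlgEquiv.ofInjectiveField φ).toLinearEquiv
  obtain ⟨N, _, _, hFN, hNZ⟩ := exists_finite_galois_le hφ'
  have h := isFiniteTame_of_ramificationGroup_eq_bot (K := K) (E := N)
    (hst.of_isScalarTower) (hst.ramificationGroup_eq_bot_of_le hNZ)
  exact h.comap_algHom ((IntermediateField.inclusion hFN).comp
    (AlgEquiv.ofInjectiveField φ).toAlgHom)

end AbsoluteRamification

/-! ### Hensel's Lemma from Galois invariance -/

section HenselsLemma

lemma residue_eval_eq {R : Type*} [CommRing R] [IsLocalRing R] (f : R[X]) {r a : R}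
    (h : r - a ∈ maximalIdeal R) : residue R (f.eval r) = residue R (f.eval a) := by
  have h2 : residue R r = residue R a := by
    rw [← sub_eq_zero, ← map_sub]
    exact (residue_eq_zero_iff _).2 h
  have h3 : ∀ x : R, residue R (f.eval x) = (f.map (residue R)).eval (residue R x) := fun x => by
    rw [eval_map, eval₂_at_apply]
  rw [h3, h2, ← h3]

/-- By Taylor expansion, `0 = (s - r) (f' r + c (s - r))`, and the second factor is a unit because
it is congruent to `f' a`. -/
lemma eq_of_isRoot_of_sub_mem {R : Type*} [CommRing R] [IsLocalRing R] {f : R[X]} {a r s : R}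
    (hr : f.IsRoot r) (hs : f.IsRoot s) (hra : r - a ∈ maximalIdeal R)
    (hsa : s - a ∈ maximalIdeal R) (h : IsUnit (f.derivative.eval a)) : r = s := by
  obtain ⟨c, hc⟩ := f.binomExpansion r (s - r)
  have hsr : s - r ∈ maximalIdeal R := by
    have := sub_mem hsa hra
    rwa [sub_sub_sub_cancel_right] at this
  rw [add_sub_cancel, hs.eq_zero, hr.eq_zero, zero_add] at hc
  have hc' : 0 = (f.derivative.eval r + c * (s - r)) * (s - r) := by
    rw [hc]; ring
  have hu : IsUnit (f.derivative.eval r + c * (s - r)) := by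
    rw [← residue_ne_zero_iff_isUnit] at h ⊢
    have h1 : residue R (c * (s - r)) = 0 := (residue_eq_zero_iff _).2 (Ideal.mul_mem_left _ _ hsr)
    rw [map_add, h1, add_zero, residue_eval_eq _ hra]
    exact h
  have := hu.mul_right_eq_zero.1 hc'.symm
  exact (sub_eq_zero.1 this).symm

variable {K Ω : Type*} [Field K] [Field Ω] [Algebra K Ω] {C : ValuationSubring Ω}

/-- The product of all `a - r`, `r` a root, has value below `1`, hence so does one factor. -/
lemma exists_isRoot_sub_mem_of_isAlgClosed [IsAlgClosed Ω] {f : C[X]} (hf : f.Monic) {a : C}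
    (h : f.eval a ∈ maximalIdeal C) : ∃ r : C, f.IsRoot r ∧ r - a ∈ maximalIdeal C := by
  set g : Polynomial Ω := f.map C.subtype with hg
  have hgm : g.Monic := hf.map _
  have hsp : g.Splits := IsAlgClosed.splits g
  have hev : C.valuation (g.eval (a : Ω)) < 1 := by
    have : g.eval (a : Ω) = (f.eval a : C) := by
      rw [hg, eval_map]
      exact (hom_eval₂ f (RingHom.id C) C.subtype a).symm
    rw [this]
    exact mem_nonunits_iff_valuation.1 h
  rw [hsp.eval_eq_prod_roots_of_monic hgm] at hev
  have hex : ∃ r ∈ g.roots, C.valuation ((a : Ω) - r) < 1 := by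
    by_contra! hcon
    refine absurd hev (not_lt.2 ?_)
    rw [map_multiset_prod]
    refine Multiset.one_le_prod_of_one_le ?_
    intro y hy
    simp only [Multiset.mem_map] at hy
    obtain ⟨_, ⟨r, hr, rfl⟩, rfl⟩ := hy
    exact hcon r hr
  obtain ⟨r, hr, hlt⟩ := hex
  have hrC : r ∈ C := by
    have h1 : (a : Ω) - r ∈ C := (C.valuation_le_one_iff _).1 hlt.le
    have := sub_mem a.2 h1
    rwa [sub_sub_cancel] at this
  refine ⟨⟨r, hrC⟩, ?_, ?_⟩
  · have h2 := (mem_roots'.1 hr).2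
    apply Subtype.val_injective
    rw [IsRoot, hg, eval_map] at h2
    exact (hom_eval₂ f (RingHom.id C) C.subtype ⟨r, hrC⟩).trans h2
  · rw [mem_nonunits_iff_valuation]
    rw [Valuation.map_sub_swap] at hlt
    exact hlt

lemma isSeparable_of_aeval_derivative_ne_zero {f : K[X]} {x : Ω} (h0 : aeval x f = 0)
    (h1 : aeval x (derivative f) ≠ 0) : IsSeparable K x := by
  have hf : f ≠ 0 := by
    rintro rfl
    simp at h1
  have hx : IsIntegral K x := isAlgebraic_iff_isIntegral.1 ⟨f, hf, h0⟩
  rw [IsSeparable, separable_iff_derivative_ne_zero (minpoly.irreducible hx)]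
  intro h2
  obtain ⟨g, hg⟩ := minpoly.dvd K x h0
  refine h1 ?_
  rw [hg, derivative_mul, h2, zero_mul, zero_add, map_mul, minpoly.aeval, zero_mul]

lemma mem_range_of_forall_apply_eq [Normal K Ω] {x : Ω} (hsep : IsSeparable K x)
    (h : ∀ σ : Ω ≃ₐ[K] Ω, σ x = x) : x ∈ Set.range (algebraMap K Ω) := by
  have h1 : (⟨x, mem_separableClosure_iff.2 hsep⟩ : separableClosure K Ω) ∈
      Set.range (algebraMap K (separableClosure K Ω)) := by
    rw [InfiniteGalois.mem_range_algebraMap_iff_fixed]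
    intro τ
    apply Subtype.ext
    exact (AlgEquiv.liftNormal_commutes τ Ω _).symm.trans (h _)
  obtain ⟨k, hk⟩ := h1
  exact ⟨k, congrArg Subtype.val hk⟩

/-- If the valuation ring is stable under all automorphisms, then the base field is henselian. -/
theorem Stable.isHenselian [Normal K Ω] [IsAlgClosed Ω] (hst : Stable K C) :
    IsHenselian (C.comap (algebraMap K Ω)) where
  is_henselian f hf a h1 h2 := by
    set φ := restrictHom K C with hφ
    have hev : ∀ (h : (C.comap (algebraMap K Ω))[X]) x, (h.map φ).eval (φ x) = φ (h.eval x) :=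
      fun h x => by rw [eval_map, eval₂_at_apply]
    have hev' : ∀ (h : (C.comap (algebraMap K Ω))[X]) (r : C),
        aeval (r : Ω) (h.map (C.comap (algebraMap K Ω)).subtype) = ((h.map φ).eval r : C) := by
      intro h r
      rw [aeval_def, eval₂_map, eval_map]
      exact (hom_eval₂ h φ C.subtype r).symm
    have hmem : ∀ x, φ x ∈ maximalIdeal C ↔ x ∈ maximalIdeal (C.comap (algebraMap K Ω)) := by
      intro x
      rw [mem_maximalIdeal, mem_maximalIdeal, mem_nonunits_iff, mem_nonunits_iff,
        isUnit_map_iff]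
    have hga : (f.map φ).eval (φ a) ∈ maximalIdeal C := by
      rw [hev]
      exact (hmem _).2 h1
    have hgd : IsUnit ((f.map φ).derivative.eval (φ a)) := by
      rw [derivative_map, hev]
      exact h2.map _
    -- Every conjugate of the root `r` is a root with the same residue, so `r` is Galois invariant
    -- by uniqueness; being a simple root it is separable, hence it lies in `K`.
    obtain ⟨r, hr, hra⟩ := exists_isRoot_sub_mem_of_isAlgClosed (hf.map _) hga
    have hr0 : aeval (r : Ω) (f.map (C.comap (algebraMap K Ω)).subtype) = 0 := by
      rw [hev', hr.eq_zero]
      rfl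
    have hfix : ∀ σ : Ω ≃ₐ[K] Ω, σ (r : Ω) = r := by
      intro σ
      have h3 : (f.map φ).IsRoot ⟨σ r, hst σ r r.2⟩ := by
        apply Subtype.val_injective
        rw [← hev']
        change aeval (σ.toAlgHom (r : Ω)) _ = 0
        rw [aeval_algHom_apply, hr0, map_zero]
      have h4 : (⟨σ r, hst σ r r.2⟩ : C) - φ a ∈ maximalIdeal C := by
        rw [mem_nonunits_iff_valuation] at hra ⊢
        have h5 := (hst.valuation_lt_iff σ (x := r - algebraMap K Ω a) (y := 1)).2
          (by rw [map_one]; exact hra)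
        rw [map_one, map_one, map_sub, σ.commutes] at h5
        exact h5
      exact congrArg Subtype.val (eq_of_isRoot_of_sub_mem h3 hr h4 hra hgd)
    have hsep : IsSeparable K (r : Ω) := by
      refine isSeparable_of_aeval_derivative_ne_zero hr0 ?_
      rw [derivative_map, hev', ← derivative_map]
      have h6 : (f.map φ).derivative.eval r ≠ 0 := by
        intro h0
        have h6 := residue_eval_eq (f.map φ).derivative hra
        rw [h0, map_zero, eq_comm] at h6
        exact (residue_ne_zero_iff_isUnit _).2 hgd h6
      exact fun h0 => h6 (Subtype.val_injective h0)
    obtain ⟨k, hk⟩ := mem_range_of_forall_apply_eq hsep hfix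
    have hkC : k ∈ C.comap (algebraMap K Ω) := by
      rw [ValuationSubring.mem_comap, hk]
      exact r.2
    have hkr : φ ⟨k, hkC⟩ = r := Subtype.ext hk
    refine ⟨⟨k, hkC⟩, ?_, ?_⟩
    · have h7 := hr.eq_zero
      rw [← hkr, hev] at h7
      apply Subtype.val_injective
      apply (algebraMap K Ω).injective
      have h8 := congrArg Subtype.val h7
      exact h8.trans (map_zero _).symm
    · rw [← hmem, map_sub, hkr]
      exact hra

end HenselsLemma

/-! ### Tame extensions lie in the absolute ramification field -/

section Tame

lemma IsHenselian.exists_pow_eq {E : Type*} [Field E] {B : ValuationSubring E} (hB : IsHenselian B)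
    {m : ℕ} (hm : ¬ residueChar B ∣ m) {u : E} (hu : Sim B u 1) : ∃ w, Sim B w 1 ∧ w ^ m = u := by
  have hm0 : m ≠ 0 := by
    rintro rfl
    exact hm (dvd_zero _)
  have : HenselianLocalRing B := hB
  have huB : u ∈ B := mem_of_valuation_eq_one (by rw [hu.valuation_eq, map_one])
  have hmu : IsUnit ((m : B)) := (B.valuation_eq_one_iff _).2 (by
    simpa using valuation_natCast_eq_one hm)
  obtain ⟨w, hw, hw1⟩ := HenselianLocalRing.is_henselian (X ^ m - C (⟨u, huB⟩ : B))
    (monic_X_pow_sub_C _ hm0) 1 (by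
      rw [mem_nonunits_iff_valuation]
      have := sim_one_def.1 hu
      rw [Valuation.map_sub_swap] at this
      simpa using this) (by
      simpa [derivative_X_pow] using hmu)
  refine ⟨w, ?_, ?_⟩
  · rw [sim_one_def]
    exact mem_nonunits_iff_valuation.1 hw1
  · have h1 : w ^ m = ⟨u, huB⟩ := by simpa [sub_eq_zero] using hw
    exact congrArg Subtype.val h1

/-- Simple roots in the residue field extension lift, if the upper ring is henselian. -/
lemma exists_isRoot_of_isSeparable {A B : Type*} [CommRing A] [IsLocalRing A] [CommRing B]
    [HenselianLocalRing B] (φ : A →+* B) [IsLocalHom φ] {z : ResidueField B}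
    (hz : letI := (ResidueField.map φ).toAlgebra; IsSeparable (ResidueField A) z) :
    ∃ (f : A[X]) (y : B), residue B y = z ∧ (f.map φ).IsRoot y ∧
      IsUnit ((f.map φ).derivative.eval y) := by
  let _ := (ResidueField.map φ).toAlgebra
  obtain ⟨x, rfl⟩ := residue_surjective z
  have hint : IsIntegral (ResidueField A) (residue B x) := hz.isIntegral
  obtain ⟨f, hf, -, hfm⟩ := lifts_and_natDegree_eq_and_monic
    ((mem_lifts _).2 (map_surjective (residue A) residue_surjective
      (minpoly (ResidueField A) (residue B x)))) (minpoly.monic hint)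
  have key : ∀ h : A[X],
      residue B ((h.map φ).eval x) = aeval (residue B x) (h.map (residue A)) := by
    intro h
    rw [eval_map, hom_eval₂, aeval_def, eval₂_map]
    rfl
  have h1 : (f.map φ).eval x ∈ maximalIdeal B := by
    rw [← residue_eq_zero_iff, key, hf, minpoly.aeval]
  have h2 : residue B ((f.map φ).derivative.eval x) ≠ 0 := by
    rw [derivative_map, key, ← derivative_map, hf]
    exact Separable.aeval_derivative_ne_zero hz (minpoly.aeval _ _)
  obtain ⟨y, hy, hyx⟩ := HenselianLocalRing.is_henselian _ (hfm.map φ) x h1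
    ((residue_ne_zero_iff_isUnit _).1 h2)
  refine ⟨f, y, ?_, hy, ?_⟩
  · rw [← sub_eq_zero, ← map_sub]
    exact (residue_eq_zero_iff _).2 hyx
  · rwa [← residue_ne_zero_iff_isUnit, residue_eval_eq _ hyx]

variable {K Ω : Type*} [Field K] [Field Ω] [Algebra K Ω] {C : ValuationSubring Ω}

section Lift

variable {E : Type*} [Field E] [Algebra K E] [Algebra E Ω] [IsScalarTower K E Ω] [Normal K Ω]
  [Normal E Ω] [IsAlgClosed Ω]

/-- Elements of the residue field that are separable over the residue field of `K` lift to the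
absolute ramification field. -/
theorem Stable.exists_residue_eq_of_isSeparable (hst : Stable K C)
    {z : ResidueField (C.comap (algebraMap E Ω))}
    (hz : letI := residueAlgebra K (C.comap (algebraMap E Ω));
      IsSeparable (ResidueField ((C.comap (algebraMap E Ω)).comap (algebraMap K E))) z) :
    ∃ y : C.comap (algebraMap E Ω), residue _ y = z ∧
      algebraMap E Ω y ∈ absoluteRamificationField K C := by
  have hhen : HenselianLocalRing (C.comap (algebraMap E Ω)) :=
    (hst.restrictScalars (F := E)).isHenselian
  obtain ⟨f, y, hyz, hy, hu⟩ := exists_isRoot_of_isSeparable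
    (restrictHom K (C.comap (algebraMap E Ω))) hz
  refine ⟨y, hyz, ?_⟩
  have hev : ∀ (h : ((C.comap (algebraMap E Ω)).comap (algebraMap K E))[X]) (r : C),
      aeval (r : Ω) (h.map (ValuationSubring.subtype _)) =
        ((h.map ((restrictHom E C).comp (restrictHom K _))).eval r : C) := by
    intro h r
    rw [aeval_def, eval₂_map, eval_map]
    refine Eq.trans ?_ (hom_eval₂ h _ C.subtype r).symm
    congr 1
    ext x
    exact IsScalarTower.algebraMap_apply K E Ω x
  generalize restrictHom K (C.comap (algebraMap E Ω)) = φ at *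
  have hy' : (f.map ((restrictHom E C).comp φ)).IsRoot (restrictHom E C y) := by
    rw [← map_map]
    exact hy.map
  have hu' : IsUnit ((f.map ((restrictHom E C).comp φ)).derivative.eval (restrictHom E C y)) := by
    rw [← map_map, derivative_map, eval_map, eval₂_at_apply]
    exact hu.map _
  have h0 : aeval (algebraMap E Ω y) (f.map (ValuationSubring.subtype _)) = 0 := by
    refine (hev f (restrictHom E C y)).trans ?_
    rw [hy'.eq_zero]
    rfl
  refine mem_absoluteRamificationField_iff.2 ⟨?_, fun ρ hρ => ?_⟩
  · refine isSeparable_of_aeval_derivative_ne_zero h0 ?_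
    rw [derivative_map]
    intro h1
    have h2 := (hev _ (restrictHom E C y)).symm.trans h1
    rw [← derivative_map] at h2
    refine hu'.ne_zero (Subtype.val_injective h2)
  · rcases eq_or_ne (algebraMap E Ω y) 0 with hy0 | hy0
    · rw [hy0, map_zero]
    -- A ramification automorphism sends `y` to a root of the same polynomial with the same residue;
    -- uniqueness in Hensel's Lemma makes `y` fixed.
    have hsim := mem_ramificationGroup_iff.1 hρ _ hy0
    have hmem : ρ (algebraMap E Ω y) ∈ C := hst ρ _ y.2
    have h3 : (f.map ((restrictHom E C).comp φ)).IsRoot ⟨_, hmem⟩ := by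
      apply Subtype.val_injective
      rw [← hev]
      change aeval (ρ.toAlgHom (algebraMap E Ω y)) _ = 0
      rw [aeval_algHom_apply, h0, map_zero]
    refine congrArg Subtype.val (eq_of_isRoot_of_sub_mem h3 hy' (a := restrictHom E C y) ?_ ?_ hu')
    · rw [mem_nonunits_iff_valuation]
      exact lt_of_lt_of_le hsim ((C.valuation_le_one_iff _).2 y.2)
    · rw [sub_self]
      exact zero_mem _

/-- Finite tame extensions lie in the absolute ramification field. -/
theorem Stable.mem_absoluteRamificationField_of_isFiniteTame [FiniteDimensional K E]
    (hst : Stable K C) (h : IsFiniteTame K (C.comap (algebraMap E Ω))) (x : E) :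
    algebraMap E Ω x ∈ absoluteRamificationField K C := by
  set B := C.comap (algebraMap E Ω) with hB
  set Z := absoluteRamificationField K C with hZ
  set D : IntermediateField K E := Z.comap (IsScalarTower.toAlgHom K E Ω) with hD
  have hBh : IsHenselian B := (hst.restrictScalars (F := E)).isHenselian
  have hchar : residueChar B = residueChar C := residueChar_comap E C
  -- The aim is `D = E`. Residues of `E` are separable over `Kv`, so they lift into `D`.
  have hsurj : Function.Surjective (residueMap D B) := by
    intro z
    obtain ⟨y, hyz, hy⟩ := hst.exists_residue_eq_of_isSeparable (z := z)
      (h.separable.isSeparable' z)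
    have hyD : (y : E) ∈ D := hy
    exact ⟨residue _ ⟨⟨y, hyD⟩, y.2⟩, hyz⟩
  have hf : inertiaDegree D B = 1 := by
    let _ := residueAlgebra D B
    have e := LinearEquiv.ofBijective (Algebra.linearMap (ResidueField (B.comap (algebraMap D E)))
      (ResidueField B)) ⟨(residueMap D B).injective, hsurj⟩
    exact e.finrank_eq.symm.trans (Module.finrank_self _)
  set m := ramificationIndex K B with hm
  have hm0 : 0 < m := ramificationIndex_pos K B
  have hmp : ¬ residueChar B ∣ m := by
    intro hdvd
    rcases residueChar_prime_or_zero (B := B) with hp | hp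
    · have h1 := h.coprime hp.pos
      exact hp.one_lt.ne' (Nat.Coprime.eq_one_of_dvd h1.symm hdvd)
    · rw [hp, zero_dvd_iff] at hdvd
      exact hm0.ne' hdvd
  -- The value groups of `D` and `E` also agree: `a ^ m` has its value in `vK`, and `a` will be
  -- corrected by a one-unit to an element of `D`.
  have hindex : ∀ a : Eˣ, a ∈ valueUnits D B := by
    intro a
    have h1 : a ^ m ∈ valueUnits K B := by
      rw [hm, ramificationIndex_eq]
      exact Subgroup.pow_index_mem _ a
    obtain ⟨k, hk0, hk⟩ := mem_valueUnits.1 h1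
    have hkE : algebraMap K E k ≠ 0 := by simpa using hk0
    set u : E := (a : E) ^ m / algebraMap K E k with hu
    have huv : B.valuation u = 1 := by
      rw [hu, map_div₀, hk, Units.val_pow_eq_pow_val, div_self]
      simp
    obtain ⟨d, hd⟩ := hsurj (residue B ⟨u, mem_of_valuation_eq_one huv⟩)
    obtain ⟨d, rfl⟩ := residue_surjective d
    have hud : Sim B u (algebraMap D E d) := by
      refine ((sim_iff_residue_eq (a := restrictHom D B d)
        (b := ⟨u, mem_of_valuation_eq_one huv⟩) ?_).2 hd).symm
      exact (B.valuation_eq_one_iff _).2 huv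
    -- The one-unit `t` satisfies `t ^ m = u / d`, so `b = a / t` keeps the value of `a` and has `b
    -- ^ m = d k` in `D`.
    obtain ⟨t, ht1, ht⟩ := hBh.exists_pow_eq hmp ((sim_one_iff hud.ne_zero).2 hud)
    have ht0 : t ≠ 0 := ht1.ne_zero'
    set b : E := a / t with hb
    have hb0 : b ≠ 0 := div_ne_zero a.ne_zero ht0
    have hbm : b ^ m = algebraMap D E d * algebraMap K E k := by
      have := hud.ne_zero
      rw [hb, div_pow, ht, hu]
      field_simp
    have hbZ : b ^ m ∈ D := by
      rw [hbm]
      exact mul_mem (d : D).2 (D.algebraMap_mem k)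
    have hbD : b ∈ D := by
      have hbΩ : (algebraMap E Ω b) ^ m ∈ Z := by
        rw [← map_pow]
        exact hbZ
      have hbΩ0 : algebraMap E Ω b ≠ 0 := by simpa using hb0
      refine (mem_absoluteRamificationField_iff (x := algebraMap E Ω b)).2 ⟨?_, fun ρ hρ => ?_⟩
      · have := isSeparable_absoluteRamificationField (K := K) (C := C)
        refine IsSeparable.of_algebra_isSeparable_of_isSeparable K (E := Z) ?_
        have hmZ : (m : Z) ≠ 0 := by
          intro h0
          have h2 := valuation_natCast_eq_one hmp
          have h3 : (m : Ω) = 0 := by simpa using congrArg Subtype.val h0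
          have h4 : (m : E) = 0 := by
            apply (algebraMap E Ω).injective
            simpa using h3
          rw [h4, map_zero] at h2
          exact zero_ne_one h2
        have hc0 : (⟨_, hbΩ⟩ : Z) ≠ 0 := by
          intro h0
          exact pow_ne_zero m hbΩ0 (congrArg Subtype.val h0)
        refine (separable_X_pow_sub_C _ hmZ hc0).of_dvd (minpoly.dvd Z _ ?_)
        simp
      -- Here `ρ b ~ b` and both have the same `m`-th power; as `m` is prime to `p`, they coincide.
      · refine Sim.eq_of_pow_eq (B := C) (hchar ▸ hmp) (mem_ramificationGroup_iff.1 hρ _ hbΩ0) ?_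
        rw [← map_pow]
        exact (mem_absoluteRamificationField_iff.1 hbΩ).2 ρ hρ
    refine mem_valueUnits.2 ⟨⟨b, hbD⟩, by simpa [Subtype.ext_iff] using hb0, ?_⟩
    change B.valuation b = _
    rw [hb, map_div₀, ht1.valuation_eq, map_one, div_one]
  have he : ramificationIndex D B = 1 := by
    rw [ramificationIndex_eq, (Subgroup.eq_top_iff' _).2 hindex, Subgroup.index_top]
  -- Now `D` has the ramification index and inertia degree of `E` over `K`, so `[D : K] ≥ e f = [E :
  -- K]` by defectlessness of `E`.
  have h5 := ramificationIndex_mul_ramificationIndex K D B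
  have h6 := inertiaDegree_mul_inertiaDegree K D B
  have h7 := ramificationIndex_mul_inertiaDegree_le K (B.comap (algebraMap D E))
  have h8 := h.defectless
  rw [he, mul_one] at h5
  rw [hf, mul_one] at h6
  rw [h5, h6, ← h8] at h7
  have h9 : D = ⊤ := IntermediateField.eq_of_le_of_finrank_le le_top (by
    rwa [IntermediateField.finrank_top'])
  have h10 : x ∈ D := h9 ▸ IntermediateField.mem_top
  exact h10

end Lift

end Tame

/-! ### Immediate extensions -/

section Immediate

variable {L E : Type*} [Field L] [Field E] [Algebra L E] {B : ValuationSubring E}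

/-- An extension is immediate if every nonzero element is equivalent to an element of the base
field. -/
lemma isImmediate_of_forall_exists_sim (h : ∀ x : E, x ≠ 0 → ∃ y : L, Sim B x (algebraMap L E y)) :
    IsImmediate L B := by
  constructor
  · rw [eq_top_iff]
    rintro γ -
    obtain ⟨x, rfl⟩ := units_map_valuation_surjective B γ
    obtain ⟨y, hy⟩ := h x x.ne_zero
    have hy0 : y ≠ 0 := by
      rintro rfl
      exact hy.ne_zero (map_zero _)
    change x ∈ valueUnits L B
    exact mem_valueUnits.2 ⟨y, hy0, hy.valuation_eq.symm⟩
  · intro z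
    obtain ⟨x, rfl⟩ := residue_surjective z
    by_cases hx : residue B x = 0
    · exact ⟨0, by rw [map_zero, hx]⟩
    have hx0 : (x : E) ≠ 0 := by
      intro h0
      apply hx
      have : x = 0 := Subtype.ext h0
      rw [this, map_zero]
    obtain ⟨y, hy⟩ := h x hx0
    have hyB : y ∈ B.comap (algebraMap L E) := by
      rw [ValuationSubring.mem_comap, ← ValuationSubring.valuation_le_one_iff, ← hy.valuation_eq]
      exact (B.valuation_le_one_iff _).2 x.2
    refine ⟨residue _ ⟨y, hyB⟩, ?_⟩
    exact (sim_iff_residue_eq (a := restrictHom L B ⟨y, hyB⟩)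
      (isUnit_iff_residue_ne_zero.2 hx)).1 hy.symm

/-- Algebraic maximality, for extensions in an arbitrary universe. -/
theorem IsAlgebraicallyMaximal.surjective_algebraMap
    (hmax : IsAlgebraicallyMaximal (B.comap (algebraMap L E))) [Algebra.IsAlgebraic L E]
    (h : ∀ x : E, x ≠ 0 → ∃ y : L, Sim B x (algebraMap L E y)) :
    Function.Surjective (algebraMap L E) := by
  -- Algebraic maximality quantifies over the universe of `L`, so `E` is replaced by its image in an
  -- algebraic closure of `L` living there.
  let φ : E →ₐ[L] AlgebraicClosure L := IsAlgClosed.lift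
  let e : E ≃ₐ[L] φ.fieldRange := AlgEquiv.ofInjectiveField φ
  have hcomap : (B.comap (e.symm : φ.fieldRange →+* E)).comap (algebraMap L φ.fieldRange) =
      B.comap (algebraMap L E) := by
    ext x
    simp only [ValuationSubring.mem_comap]
    have : (e.symm : φ.fieldRange →+* E) (algebraMap L φ.fieldRange x) = algebraMap L E x :=
      e.symm.commutes x
    rw [this]
  have hs := hmax φ.fieldRange (B.comap (e.symm : φ.fieldRange →+* E)) hcomap
    (isImmediate_of_forall_exists_sim fun x hx => by
      obtain ⟨y, hy⟩ := h (e.symm x) (by simpa using hx)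
      refine ⟨y, ?_⟩
      rw [sim_comap_iff]
      have : (e.symm : φ.fieldRange →+* E) (algebraMap L φ.fieldRange y) = algebraMap L E y :=
        e.symm.commutes y
      rw [this]
      exact hy)
  intro x
  obtain ⟨y, hy⟩ := hs (e x)
  exact ⟨y, e.injective (by rw [e.commutes, hy])⟩

end Immediate

/-! ### Algebraically maximal Kaplansky fields -/

section Kaplansky

variable {L : Type*} [Field L] {A : ValuationSubring L}

lemma IsKaplansky.pPolynomialsHaveZeros (h : IsKaplansky A) (hp : (residueChar A).Prime) :
    PPolynomialsHaveZeros (ResidueField A) (residueChar A) ∧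
      ValueGroupDivisible A (residueChar A) := by
  rcases h with h | h
  · exact absurd h hp.ne_zero
  · exact h

/-- In a Kaplansky field, every element is a `p`-th power up to a one-unit. -/
lemma IsKaplansky.exists_sim_pow (h : IsKaplansky A) (hp : (residueChar A).Prime) {y : L}
    (hy : y ≠ 0) : ∃ z, Sim A (z ^ residueChar A) y := by
  obtain ⟨h1, h2⟩ := h.pPolynomialsHaveZeros hp
  have := Fact.mk hp
  obtain ⟨δ, hδ⟩ := h2 (Units.map (A.valuation : L →* A.ValueGroup) (Units.mk0 y hy))
  obtain ⟨w, rfl⟩ := units_map_valuation_surjective A δ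
  have hw : A.valuation (w : L) ^ residueChar A = A.valuation y := congrArg Units.val hδ
  have hy0 : A.valuation y ≠ 0 := by simpa using hy
  have hv : A.valuation (y / (w : L) ^ residueChar A) = 1 := by
    rw [map_div₀, map_pow, hw, div_self hy0]
  -- Divisibility of the value group has matched the values; perfectness of the residue field now
  -- matches the residue of the unit quotient.
  obtain ⟨c, hc⟩ := h1.exists_pow_eq (residue A ⟨_, mem_of_valuation_eq_one hv⟩)
  obtain ⟨c, rfl⟩ := residue_surjective c
  rw [← map_pow, ← sim_iff_residue_eq ((A.valuation_eq_one_iff _).2 hv)] at hc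
  refine ⟨c * w, ?_⟩
  have h3 := hc.mul (Sim.refl (B := A) (pow_ne_zero (residueChar A) w.ne_zero))
  have h4 : ((c ^ residueChar A : A) : L) = (c : L) ^ residueChar A := rfl
  rw [h4, ← mul_pow, div_mul_cancel₀ _ (pow_ne_zero _ w.ne_zero)] at h3
  exact h3

lemma IsKaplansky.exists_sim_pow_pow (h : IsKaplansky A) (hp : (residueChar A).Prime) (n : ℕ)
    {y : L} (hy : y ≠ 0) : ∃ z, Sim A (z ^ residueChar A ^ n) y := by
  induction n generalizing y with
  | zero => exact ⟨y, by simpa using Sim.refl (B := A) hy⟩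
  | succ n ih =>
    obtain ⟨w, hw⟩ := h.exists_sim_pow hp hy
    have hw0 : w ≠ 0 := by
      rintro rfl
      rw [zero_pow hp.ne_zero] at hw
      exact hw.ne_zero' rfl
    obtain ⟨z, hz⟩ := ih hw0
    refine ⟨z, ?_⟩
    rw [pow_succ, pow_mul]
    exact (hz.pow _).trans hw

variable {E : Type*} [Field E] [Algebra L E] {B : ValuationSubring E}

/-- Over a Kaplansky field, if a `p`-power of `x` is equivalent to an element of the base field,
then so is `x`. -/
lemma IsKaplansky.exists_sim_of_pow (h : IsKaplansky (B.comap (algebraMap L E)))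
    (hp : (residueChar B).Prime) {n : ℕ} {x : E} {y : L}
    (hxy : Sim B (x ^ residueChar B ^ n) (algebraMap L E y)) :
    ∃ z : L, Sim B x (algebraMap L E z) := by
  have hp' := hp
  rw [← residueChar_comap L B] at hp'
  have hy : y ≠ 0 := by
    rintro rfl
    exact hxy.ne_zero (map_zero _)
  obtain ⟨z, hz⟩ := h.exists_sim_pow_pow hp' n hy
  rw [residueChar_comap, sim_comap_iff, map_pow] at hz
  have h1 := hxy.trans hz.symm
  refine ⟨z, Sim.of_pow_residueChar_pow hp ?_ n h1⟩
  intro h0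
  rw [h0, zero_pow (pow_ne_zero _ hp.ne_zero)] at h1
  exact h1.ne_zero rfl

/-- An algebraically maximal Kaplansky field is perfect. -/
theorem IsAlgebraicallyMaximal.perfectField [IsAlgClosure L E]
    (hmax : IsAlgebraicallyMaximal (B.comap (algebraMap L E)))
    (h : IsKaplansky (B.comap (algebraMap L E))) : PerfectField L := by
  have : IsAlgClosed E := IsAlgClosure.isAlgClosed L
  obtain ⟨q, hq⟩ := ExpChar.exists L
  have hPE : PerfectField E := inferInstance
  refine perfectField_of_perfectClosure_eq_bot (F := L) (E := E) ?_
  rw [← comap_comap_algebraMap L (perfectClosure L E) B] at hmax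
  rw [eq_bot_iff]
  intro x hx
  -- The perfect closure is immediate: some `q`-power of `x` lies in `L`, and Kaplansky fields have
  -- `p`-power roots up to one-units. So it equals `L`.
  obtain ⟨y, hy⟩ := hmax.surjective_algebraMap (fun (x : perfectClosure L E) hx => by
    have hx0 : (x : E) ≠ 0 := by simpa using hx
    obtain ⟨n, y, hy⟩ := (mem_perfectClosure_iff_pow_mem (F := L) (E := E) q).1 x.2
    have hsim : Sim B ((x : E) ^ q ^ n) (algebraMap L E y) := by
      rw [hy]
      exact Sim.refl (pow_ne_zero _ hx0)
    have hqE : ExpChar E q := expChar_of_injective_algebraMap (algebraMap L E).injective q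
    have hz : ∃ z : L, Sim B (x : E) (algebraMap L E z) := by
      rcases hqE with _ | hq
      · exact ⟨y, by simpa using hsim⟩
      · have hq2 := residueChar_eq_of_charP (C := B) hq
        rw [← hq2] at hsim
        exact h.exists_sim_of_pow (hq2 ▸ hq) hsim
    obtain ⟨z, hz⟩ := hz
    exact ⟨z, (sim_comap_iff _).2 hz⟩) ⟨x, hx⟩
  exact IntermediateField.mem_bot.2 ⟨y, congrArg Subtype.val hy⟩

/-- Finite Galois extensions of Kaplansky fields have degree prime to `p` modulo ramification. -/
lemma IsKaplansky.not_dvd_index_ramificationGroup [FiniteDimensional L E]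
    (hst : Stable L B) (hp : (residueChar B).Prime) (h : IsKaplansky (B.comap (algebraMap L E))) :
    ¬ residueChar B ∣ (ramificationGroup L B).index := by
  have hnormal : (ramificationGroup L B).Normal := ⟨fun ρ hρ σ => by
    have := hst.conj_mem_ramificationGroup σ⁻¹ hρ
    rwa [inv_inv] at this⟩
  have := Fact.mk hp
  intro hdvd
  obtain ⟨g, hg⟩ := exists_prime_orderOf_dvd_card' (G := (E ≃ₐ[L] E) ⧸ ramificationGroup L B) _ hdvd
  obtain ⟨σ, rfl⟩ := QuotientGroup.mk_surjective g
  have hσp : σ ^ residueChar B ∈ ramificationGroup L B := by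
    rw [← QuotientGroup.eq_one_iff, QuotientGroup.mk_pow, ← hg, pow_orderOf_eq_one]
  have hσ : σ ∉ ramificationGroup L B := by
    intro h1
    rw [← QuotientGroup.eq_one_iff] at h1
    rw [h1, orderOf_one] at hg
    exact hp.one_lt.ne hg
  let _ := residueAlgebra L B
  -- An element of order `p` modulo ramification cannot be inertial, so it acts with order `p` on
  -- the residue field, and `p` divides the residue degree. That extension is separable, as the
  -- residue field of `L` is perfect, which contradicts the `p`-polynomial hypothesis.
  have hτ : residueHom hst σ ≠ 1 := by
    intro h1
    have h2 : IsInertial L B σ := (mem_ker_residueHom_iff hst).1 h1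
    exact hσ (h2.mem_ramificationGroup hst hp (k := 1) (by rwa [pow_one]))
  have hτp : residueHom hst σ ^ residueChar B = 1 := by
    rw [← map_pow]
    exact (mem_ker_residueHom_iff hst).2 (isInertial_of_mem_ramificationGroup hσp)
  have hord := orderOf_eq_prime hτp hτ
  have := residue_finiteDimensional L B
  have hdvd2 : residueChar B ∣
      Module.finrank (ResidueField (B.comap (algebraMap L E))) (ResidueField B) := by
    have h3 := IntermediateField.finrank_fixedField_eq_card (Subgroup.zpowers (residueHom hst σ))
    rw [Nat.card_zpowers, hord] at h3
    rw [← Module.finrank_mul_finrank _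
      (IntermediateField.fixedField (Subgroup.zpowers (residueHom hst σ))) (ResidueField B), h3]
    exact dvd_mul_left _ _
  rw [← residueChar_comap L B] at hp hdvd2
  have := Fact.mk hp
  obtain ⟨h4, -⟩ := h.pPolynomialsHaveZeros hp
  have : PerfectRing (ResidueField (B.comap (algebraMap L E)))
      (residueChar (B.comap (algebraMap L E))) :=
    have := ExpChar.prime (R := ResidueField (B.comap (algebraMap L E))) hp
    PerfectRing.ofSurjective _ _ fun a => h4.exists_pow_eq a
  have := ExpChar.prime (R := ResidueField (B.comap (algebraMap L E))) hp
  have : PerfectField (ResidueField (B.comap (algebraMap L E))) :=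
    PerfectRing.toPerfectField _ (residueChar (B.comap (algebraMap L E)))
  exact h4.not_dvd_finrank hdvd2

/-- Raising `σ` to the `p`-part of its order leaves a ramification element of order prime to `p`,
which fixes everything. -/
lemma isPGroup_ramificationGroup [FiniteDimensional L E] (hp : (residueChar B).Prime) :
    IsPGroup (residueChar B) (ramificationGroup L B) := by
  rintro ⟨σ, hσ⟩
  obtain ⟨k, m, hm, hkm⟩ := Nat.exists_eq_pow_mul_and_not_dvd (orderOf_pos σ).ne' _ hp.ne_one
  refine ⟨k, Subtype.ext ?_⟩
  ext a
  refine apply_eq_of_mem_ramificationGroup (pow_mem hσ _) hm ?_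
  rw [← pow_mul, ← hkm, pow_orderOf_eq_one, AlgEquiv.one_apply]

/-- Finite Galois extensions of algebraically maximal Kaplansky fields have trivial ramification
group. -/
theorem IsAlgebraicallyMaximal.ramificationGroup_eq_bot_of_finite [FiniteDimensional L E]
    [IsGalois L E]
    (hst : Stable L B) (hp : (residueChar B).Prime)
    (hmax : IsAlgebraicallyMaximal (B.comap (algebraMap L E)))
    (h : IsKaplansky (B.comap (algebraMap L E))) : ramificationGroup L B = ⊥ := by
  classical
  set R := ramificationGroup L B with hR
  have hnormal : R.Normal := ⟨fun ρ hρ σ => by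
    have := hst.conj_mem_ramificationGroup σ⁻¹ hρ
    rwa [inv_inv] at this⟩
  have := Fact.mk hp
  obtain ⟨n, hn⟩ := (IsPGroup.iff_card (p := residueChar B) (G := R)).1
    (isPGroup_ramificationGroup hp)
  have hcop : Nat.Coprime (Nat.card R) R.index := by
    rw [hn]
    exact Nat.Coprime.pow_left _ ((Nat.Prime.coprime_iff_not_dvd hp).2
      (h.not_dvd_index_ramificationGroup hst hp))
  -- Schur-Zassenhaus. The fixed field of the complement has degree `|R|`, a power of `p`, and will
  -- turn out to be immediate over `L`.
  obtain ⟨H, hH⟩ := Subgroup.exists_right_complement'_of_coprime hcop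
  set F := IntermediateField.fixedField H with hF
  have hcomap := comap_comap_algebraMap L F B
  have hsurj : Function.Surjective (algebraMap L F) := by
    rw [← hcomap] at hmax
    refine hmax.surjective_algebraMap fun x hx => ?_
    have hx0 : (x : E) ≠ 0 := by simpa using hx
    have := Fintype.ofFinite R
    -- This product is fixed by `R`, and by `H` because `H` normalizes `R` and fixes `x`; so it lies
    -- in `L`. Each factor is `~ x`, hence `y ~ x ^ p ^ n`, and Kaplansky's hypothesis extracts the
    -- root.
    set y : E := ∏ ρ : R, (ρ : E ≃ₐ[L] E) x with hy
    have hyfix : ∀ σ : E ≃ₐ[L] E, σ y = y := by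
      intro σ
      obtain ⟨⟨ρ, τ⟩, rfl⟩ := hH.2 σ
      have hτ : (τ : E ≃ₐ[L] E) y = y := by
        rw [hy, map_prod]
        refine Fintype.prod_equiv (MulAut.conjNormal (τ : E ≃ₐ[L] E)).toEquiv _ _ fun ρ => ?_
        have h2 : (τ : E ≃ₐ[L] E)⁻¹ (x : E) = x := by
          have := (IntermediateField.mem_fixedField_iff H (x : E)).1 x.2 _ (inv_mem τ.2)
          exact this
        change _ = (τ * ρ * τ⁻¹ : E ≃ₐ[L] E) (x : E)
        rw [AlgEquiv.mul_apply, AlgEquiv.mul_apply]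
        exact congrArg (fun z => (τ : E ≃ₐ[L] E) ((ρ : E ≃ₐ[L] E) z)) h2.symm
      have hρ : (ρ : E ≃ₐ[L] E) y = y := by
        rw [hy, map_prod]
        exact Fintype.prod_equiv (Equiv.mulLeft ρ) _ _ fun _ => rfl
      change (ρ : E ≃ₐ[L] E) ((τ : E ≃ₐ[L] E) y) = y
      rw [hτ, hρ]
    obtain ⟨k, hk⟩ := (IsGalois.mem_range_algebraMap_iff_fixed y).2 hyfix
    have hsim : Sim B y (x ^ residueChar B ^ n) := by
      have h1 := Sim.prod (B := B) Finset.univ (f := fun ρ : R => (ρ : E ≃ₐ[L] E) x)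
        (g := fun _ => (x : E)) fun ρ _ => mem_ramificationGroup_iff.1 ρ.2 x hx0
      rwa [Finset.prod_const, Finset.card_univ, ← Nat.card_eq_fintype_card, hn] at h1
    rw [← hk] at hsim
    obtain ⟨z, hz⟩ := h.exists_sim_of_pow hp hsim.symm
    refine ⟨z, ?_⟩
    rw [sim_comap_iff]
    exact hz
  have hFbot : F = ⊥ := by
    rw [eq_bot_iff]
    intro x hx
    obtain ⟨k, hk⟩ := hsurj ⟨x, hx⟩
    exact IntermediateField.mem_bot.2 ⟨k, congrArg Subtype.val hk⟩
  have hHtop : H = ⊤ := by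
    rw [← IntermediateField.fixingSubgroup_fixedField H, ← hF, hFbot,
      IntermediateField.fixingSubgroup_bot]
  have := hH.disjoint
  rw [hHtop, disjoint_top] at this
  exact this

/-- The absolute ramification group of an algebraically maximal Kaplansky field is trivial. -/
theorem IsAlgebraicallyMaximal.ramificationGroup_eq_bot [IsAlgClosure L E]
    (hst : Stable L B) (hmax : IsAlgebraicallyMaximal (B.comap (algebraMap L E)))
    (h : IsKaplansky (B.comap (algebraMap L E))) : ramificationGroup L B = ⊥ := by
  have := IsAlgClosure.normal L E
  have := IsAlgClosure.isAlgebraic (R := L) (K := E)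
  rcases residueChar_prime_or_zero (B := B) with hp | hp
  swap
  · exact ValuedField.ramificationGroup_eq_bot hp
  have := hmax.perfectField h
  rw [eq_bot_iff]
  intro σ hσ
  rw [Subgroup.mem_bot]
  ext a
  obtain ⟨N, _, _, haN, -⟩ := exists_finite_galois (K := L) (s := {a}) (Set.finite_singleton a)
    (by rintro x -; exact Algebra.IsSeparable.isSeparable L x)
  have h1 := restrictNormal_mem_ramificationGroup (S := N) hσ
  rw [IsAlgebraicallyMaximal.ramificationGroup_eq_bot_of_finite hst.of_isScalarTower
    (by rwa [residueChar_comap]) (by rwa [comap_comap_algebraMap])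
    (by rwa [comap_comap_algebraMap]), Subgroup.mem_bot] at h1
  have h2 := AlgEquiv.restrictNormal_commutes σ N ⟨a, haN rfl⟩
  rw [h1] at h2
  exact h2.symm

end Kaplansky

/-! ### Linear disjointness -/

section LinearDisjoint

variable {F Ω : Type*} [Field F] [Field Ω] [Algebra F Ω]

/-- A Galois extension is linearly disjoint from every algebraic extension that it intersects
trivially. -/
theorem linearDisjoint_of_inf_eq_bot [Normal F Ω] {M Z : IntermediateField F Ω} [IsGalois F Z]
    (h : M ⊓ Z = ⊥) : M.LinearDisjoint Z := by
  rw [IntermediateField.linearDisjoint_iff']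
  have key : ∀ S : Subalgebra F Ω, ∃ S' : IntermediateField F Ω, S'.toSubalgebra = S := fun S =>
    ⟨S.toIntermediateField fun x hx => S.inv_mem_of_algebraic (x := ⟨x, hx⟩)
      (Algebra.IsAlgebraic.isAlgebraic x), rfl⟩
  have hM : Algebra.IsIntegral F M.toSubalgebra := inferInstanceAs (Algebra.IsIntegral F M)
  have hZ : Algebra.IsIntegral F Z.toSubalgebra := inferInstanceAs (Algebra.IsIntegral F Z)
  refine Subalgebra.LinearDisjoint.of_linearDisjoint_finite fun A B hA hB _ _ => ?_
  obtain ⟨A, rfl⟩ := key A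
  obtain ⟨B, rfl⟩ := key B
  have hAf : FiniteDimensional F A := ‹Module.Finite F A.toSubalgebra›
  have hBf : FiniteDimensional F B := ‹Module.Finite F B.toSubalgebra›
  -- A finite subextension of `Z` is enlarged to a finite Galois one inside `Z`, for which trivial
  -- intersection suffices.
  obtain ⟨N, _, _, hBN, hNZ⟩ := exists_finite_galois_le (K := F) (Z := Z) (F := B) hB
  rw [← IntermediateField.linearDisjoint_iff']
  have h1 : N.LinearDisjoint A := IntermediateField.LinearDisjoint.of_inf_eq_bot (by
    rw [eq_bot_iff, ← h, inf_comm]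
    exact inf_le_inf hA hNZ)
  exact h1.symm.of_le_right hBN

/-- An `F`-basis of `Z` is an `A`-basis of `Ω`, and it stays independent over `M`. For `x ∈ M` the
expansion of `x` over `A` must therefore agree with `x` times the expansion of `1` over `F`; a
nonzero coefficient of `1` exhibits `x` in `A`. -/
lemma le_of_linearDisjoint_of_sup_eq_top {A M Z : IntermediateField F Ω} [Algebra.IsAlgebraic F Z]
    (hAM : A ≤ M) (hM : M.LinearDisjoint Z) (h : A ⊔ Z = ⊤) : M ≤ A := by
  intro x hx
  have hA : A.LinearDisjoint Z := hM.of_le_left hAM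
  have h' : A.toSubalgebra ⊔ Z.toSubalgebra = ⊤ := by
    rw [← IntermediateField.sup_toSubalgebra_of_isAlgebraic_right, h]
    rfl
  let b := Module.Basis.ofVectorSpace F Z
  let c := hA.basisOfBasisRight h' b
  have hb := hM.linearIndependent_right b.linearIndependent
  have hxc := c.linearCombination_repr x
  have h1b := b.linearCombination_repr 1
  have h1 : b.repr 1 ≠ 0 := by simp
  obtain ⟨i, hi⟩ := Finsupp.ne_iff.1 h1
  rw [Finsupp.coe_zero, Pi.zero_apply] at hi
  have e1 : Finsupp.linearCombination M (Z.val ∘ b)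
      ((c.repr x).mapRange (IntermediateField.inclusion hAM) (map_zero _)) = x := by
    rw [Finsupp.linearCombination_apply, Finsupp.sum_mapRange_index (by simp)]
    rw [Finsupp.linearCombination_apply] at hxc
    refine Eq.trans ?_ hxc
    refine Finsupp.sum_congr fun j _ => ?_
    rw [IntermediateField.LinearDisjoint.basisOfBasisRight_apply]
    rfl
  have e2 : Finsupp.linearCombination M (Z.val ∘ b)
      ((b.repr 1).mapRange (fun y => algebraMap F M y * ⟨x, hx⟩) (by simp)) = x := by
    rw [Finsupp.linearCombination_apply, Finsupp.sum_mapRange_index (by simp)]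
    rw [Finsupp.linearCombination_apply] at h1b
    have h2 := congrArg (fun z : Z => (z : Ω) * x) h1b
    simp only [Finsupp.sum, AddSubmonoidClass.coe_finsetSum, Finset.sum_mul,
      OneMemClass.coe_one, one_mul] at h2
    refine Eq.trans ?_ h2
    refine Finset.sum_congr rfl fun j _ => ?_
    change algebraMap F Ω _ * x * _ = _
    rw [Algebra.smul_def]
    change _ = algebraMap F Ω _ * _ * x
    rw [mul_right_comm]
    rfl
  have e3 := congrArg (fun g => (g i : Ω)) (hb (e1.trans e2.symm))
  simp only [Finsupp.mapRange_apply] at e3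
  have e4 : ((c.repr x i : A) : Ω) = algebraMap F Ω (b.repr 1 i) * x := e3
  have e5 : x = (c.repr x i : A) * (algebraMap F Ω (b.repr 1 i))⁻¹ := by
    have hi' : algebraMap F Ω (b.repr 1 i) ≠ 0 := by simpa using hi
    rw [e4]
    field_simp
  rw [e5]
  exact mul_mem (c.repr x i).2 (inv_mem (A.algebraMap_mem _))

end LinearDisjoint

/-! ### Descent of (K3) along residue field extensions -/

section Residue

/-- The separable minimal polynomial of a primitive element stays irreducible over the purely
inseparable extension `l`, so `l` has a separable extension of the same degree. -/
lemma PPolynomialsHaveZeros.not_dvd_finrank_of_isPurelyInseparable {k l F : Type*} [Field k]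
    [Field l] [Field F] [Algebra k l] [Algebra k F] [IsPurelyInseparable k l]
    [FiniteDimensional k F] [Algebra.IsSeparable k F] {p : ℕ} [Fact p.Prime] [CharP l p]
    (hl : PPolynomialsHaveZeros l p) : ¬ p ∣ Module.finrank k F := by
  obtain ⟨α, hα⟩ := Field.exists_primitive_element k F
  have hint : IsIntegral k α := Algebra.IsIntegral.isIntegral α
  have hsep : (minpoly k α).Separable := Algebra.IsSeparable.isSeparable k α
  have hirr := hsep.map_irreducible_of_isPurelyInseparable (E := l) (minpoly.irreducible hint)
  have hmon := (minpoly.monic hint).map (algebraMap k l)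
  have := Fact.mk hirr
  have hfin : FiniteDimensional l (AdjoinRoot ((minpoly k α).map (algebraMap k l))) :=
    (AdjoinRoot.powerBasis hirr.ne_zero).finite
  have : Algebra.IsSeparable l (AdjoinRoot ((minpoly k α).map (algebraMap k l))) := by
    have hroot : IsSeparable l (AdjoinRoot.root ((minpoly k α).map (algebraMap k l))) :=
      (hsep.map (f := algebraMap k l)).of_dvd (minpoly.dvd l _ (by
        rw [aeval_def]
        exact AdjoinRoot.eval₂_root _))
    refine ⟨fun x => mem_separableClosure_iff.1 ?_⟩
    have h1 : Algebra.adjoin l {AdjoinRoot.root ((minpoly k α).map (algebraMap k l))} ≤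
        (separableClosure l (AdjoinRoot ((minpoly k α).map (algebraMap k l)))).toSubalgebra := by
      rw [Algebra.adjoin_le_iff, Set.singleton_subset_iff]
      exact mem_separableClosure_iff.2 hroot
    rw [AdjoinRoot.adjoinRoot_eq_top] at h1
    exact h1 Algebra.mem_top
  have h1 := hl.not_dvd_finrank (F := AdjoinRoot ((minpoly k α).map (algebraMap k l)))
  rwa [(AdjoinRoot.powerBasis hirr.ne_zero).finrank, AdjoinRoot.powerBasis_dim, natDegree_map,
    ← IntermediateField.adjoin.finrank hint, hα, IntermediateField.finrank_top'] at h1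

/-- An algebraic equation normalized to have integral coefficients, one of them `1`, reduces to a
nonzero polynomial. -/
lemma residue_isAlgebraic {K E : Type*} [Field K] [Field E] [Algebra K E] [Algebra.IsAlgebraic K E]
    (B : ValuationSubring E) : letI := residueAlgebra K B
    Algebra.IsAlgebraic (ResidueField (B.comap (algebraMap K E))) (ResidueField B) := by
  let _ := residueAlgebra K B
  refine ⟨fun z => ?_⟩
  obtain ⟨x, rfl⟩ := residue_surjective z
  obtain ⟨f, hf, i, hi⟩ := exists_aeval_eq_zero_coeff_eq_one (B.comap (algebraMap K E))
    (Algebra.IsAlgebraic.isAlgebraic (R := K) (x : E))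
  refine ⟨f.map (residue _), fun h0 => ?_, ?_⟩
  · have := congrArg (fun g => coeff g i) h0
    simp [hi] at this
  · have h1 : (f.map (restrictHom K B)).eval x = 0 := by
      apply Subtype.val_injective
      rw [eval_map]
      exact (hom_eval₂ f _ B.subtype x).trans hf
    have h2 := congrArg (residue B) h1
    rw [eval_map, hom_eval₂, map_zero] at h2
    rw [aeval_def, eval₂_map]
    exact h2

end Residue

/-! ### Change of base field inside the absolute ramification field -/

section Tower

variable {K L Ω : Type*} [Field K] [Field L] [Field Ω] [Algebra K L] [Algebra L Ω] [Algebra K Ω]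
  [IsScalarTower K L Ω] [Normal K Ω] [Normal L Ω] {C : ValuationSubring Ω}

/-- The absolute ramification field does not change under extensions inside of it. -/
theorem mem_absoluteRamificationField_iff_of_le
    (h : ∀ x : L, algebraMap L Ω x ∈ absoluteRamificationField K C) {x : Ω} :
    x ∈ absoluteRamificationField L C ↔ x ∈ absoluteRamificationField K C := by
  have hsep : Algebra.IsSeparable K L := ⟨fun x =>
    (isSeparable_map_iff (IsScalarTower.toAlgHom K L Ω) (algebraMap L Ω).injective).1
      (mem_absoluteRamificationField_iff.1 (h x)).1⟩
  rw [mem_absoluteRamificationField_iff, mem_absoluteRamificationField_iff]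
  constructor
  · rintro ⟨h1, h2⟩
    refine ⟨IsSeparable.of_algebra_isSeparable_of_isSeparable K h1, fun ρ hρ => ?_⟩
    -- A ramification automorphism over `K` fixes `L`, as `L` lies in the absolute ramification
    -- field; so it is one over `L`.
    let ρ' : Ω ≃ₐ[L] Ω := AlgEquiv.ofRingEquiv (f := (ρ : Ω ≃+* Ω)) fun y =>
      (mem_absoluteRamificationField_iff.1 (h y)).2 ρ hρ
    exact h2 ρ' hρ
  · rintro ⟨h1, h2⟩
    exact ⟨h1.tower_top L, fun σ hσ => h2 (σ.restrictScalars K) hσ⟩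

end Tower

/-! ### The ingredients of the three assertions -/

section Kaplansky

variable {K L Ω : Type*} [Field K] [Field L] [Field Ω] [Algebra K L] [Algebra L Ω] [Algebra K Ω]
  [IsScalarTower K L Ω] [Algebra.IsAlgebraic K L] {C : ValuationSubring Ω}
  {Z₀ : IntermediateField K L}

section Tame

variable [Normal K Ω] [IsAlgClosed Ω]

theorem Stable.isTameExtension_inf (hst : Stable K C)
    (hZ₀ : ∀ x, x ∈ Z₀ ↔ algebraMap L Ω x ∈ absoluteRamificationField K C) :
    IsTameExtension K ((C.comap (algebraMap L Ω)).comap (algebraMap Z₀ L)) := by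
  have key : ∀ F : IntermediateField K Z₀, FiniteDimensional K F →
      IsFiniteTame K (((C.comap (algebraMap L Ω)).comap (algebraMap Z₀ L)).comap
        (algebraMap F Z₀)) := fun F _ =>
    hst.isFiniteTame_of_forall_mem
      ((IsScalarTower.toAlgHom K L Ω).comp (Z₀.val.comp F.val)) fun x => (hZ₀ _).1 (x : Z₀).2
  refine ⟨?_, inferInstance, fun F hF => ?_, fun F hF => (key F hF).separable,
    fun F hF => (key F hF).defectless⟩
  · rw [comap_comap_algebraMap, comap_comap_algebraMap]
    exact hst.isHenselian
  · have := (key F hF).coprime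
    rwa [residueChar_comap, ← residueChar_comap K] at this

/-- Tameness is a condition on finite subextensions, so each element is treated in the finite
extension that it generates. -/
theorem Stable.le_of_isTameExtension (hst : Stable K C)
    (hZ₀ : ∀ x, x ∈ Z₀ ↔ algebraMap L Ω x ∈ absoluteRamificationField K C)
    {F : IntermediateField K L}
    (hF : IsTameExtension K ((C.comap (algebraMap L Ω)).comap (algebraMap F L))) : F ≤ Z₀ := by
  intro x hx
  rw [hZ₀]
  let G : IntermediateField K F := IntermediateField.adjoin K {⟨x, hx⟩}
  have hG : FiniteDimensional K G := IntermediateField.adjoin.finiteDimensional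
    (Algebra.IsIntegral.isIntegral _)
  have : Normal G Ω := Normal.tower_top_of_normal K G Ω
  have htame : IsFiniteTame K (C.comap (algebraMap G Ω)) := by
    refine ⟨fun hp => ?_, hF.te2 G hG, hF.te3 G hG⟩
    have := hF.te1 G hG
    rw [residueChar_comap, residueChar_comap, residueChar_comap] at this
    rw [residueChar_comap] at hp ⊢
    exact this hp
  exact hst.mem_absoluteRamificationField_of_isFiniteTame htame
    ⟨⟨x, hx⟩, IntermediateField.mem_adjoin_simple_self K _⟩

end Tame

/-- An automorphism over `L` fixing the absolute ramification field of `K` is in the ramification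
group of `L`, which is trivial. Since `L` is perfect, `Ω` is Galois over `L`, and the Galois
correspondence applies. -/
theorem Stable.sup_absoluteRamificationField_eq_top [IsAlgClosure L Ω] (hst : Stable K C)
    (hmax : IsAlgebraicallyMaximal (C.comap (algebraMap L Ω)))
    (hKap : IsKaplansky (C.comap (algebraMap L Ω))) :
    (IsScalarTower.toAlgHom K L Ω).fieldRange ⊔ absoluteRamificationField K C = ⊤ := by
  have := IsAlgClosure.isAlgebraic (R := L) (K := Ω)
  have : IsAlgClosure K Ω :=
    ⟨IsAlgClosure.isAlgClosed L, Algebra.IsAlgebraic.trans K L Ω⟩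
  have := IsAlgClosure.normal K Ω
  have := IsAlgClosure.normal L Ω
  have := hmax.perfectField hKap
  have hgal : IsGalois L Ω := ⟨⟩
  set Z := absoluteRamificationField K C
  have h1 : (IntermediateField.adjoin L (Z : Set Ω)).fixingSubgroup = ⊥ := by
    rw [eq_bot_iff]
    intro σ hσ
    rw [IntermediateField.mem_fixingSubgroup_iff] at hσ
    have h2 : σ.restrictScalars K ∈ ramificationGroup K C := mem_ramificationGroup_of_fixes
      fun x hx => hσ x (IntermediateField.subset_adjoin L _ hx)
    -- The ramification condition involves only the action on `Ω`, not the base field.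
    have h3 : σ ∈ ramificationGroup L C := h2
    rwa [IsAlgebraicallyMaximal.ramificationGroup_eq_bot hst.restrictScalars hmax hKap] at h3
  have h2 := InfiniteGalois.fixedField_fixingSubgroup (IntermediateField.adjoin L (Z : Set Ω))
  rw [h1, IntermediateField.fixedField_bot] at h2
  rw [eq_top_iff]
  rintro x -
  have hx : x ∈ IntermediateField.adjoin L (Z : Set Ω) := h2 ▸ IntermediateField.mem_top
  induction hx using IntermediateField.adjoin_induction with
  | mem x hx => exact le_sup_right (a := (IsScalarTower.toAlgHom K L Ω).fieldRange) hx
  | algebraMap x => exact le_sup_left (b := Z) ⟨x, rfl⟩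
  | add x y _ _ hx hy => exact add_mem hx hy
  | inv x _ hx => exact inv_mem hx
  | mul x y _ _ hx hy => exact mul_mem hx hy

/-- If `K` is the intersection of `L` with its absolute ramification field, then the residue field
extension is purely inseparable. -/
theorem Stable.isPurelyInseparable_residue [Normal K Ω] [IsAlgClosed Ω] (hst : Stable K C)
    (h : ∀ x : L, algebraMap L Ω x ∈ absoluteRamificationField K C →
      x ∈ Set.range (algebraMap K L)) :
    letI := residueAlgebra K (C.comap (algebraMap L Ω))
    IsPurelyInseparable (ResidueField ((C.comap (algebraMap L Ω)).comap (algebraMap K L)))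
      (ResidueField (C.comap (algebraMap L Ω))) := by
  have : Normal L Ω := Normal.tower_top_of_normal K L Ω
  let _ := residueAlgebra K (C.comap (algebraMap L Ω))
  have := residue_isAlgebraic (K := K) (C.comap (algebraMap L Ω))
  refine ⟨inferInstance, fun z hz => ?_⟩
  obtain ⟨y, hyz, hy⟩ := hst.exists_residue_eq_of_isSeparable hz
  obtain ⟨k, hk⟩ := h y hy
  have hkA : k ∈ (C.comap (algebraMap L Ω)).comap (algebraMap K L) := by
    rw [ValuationSubring.mem_comap, hk]
    exact y.2
  refine ⟨residue _ ⟨k, hkA⟩, ?_⟩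
  rw [← hyz]
  exact congrArg (residue _) (Subtype.ext hk)

end Kaplansky

theorem IsKaplansky.k3_comap {K L : Type*} [Field K] [Field L] [Algebra K L]
    {A : ValuationSubring L} (hKap : IsKaplansky A)
    (hpi : letI := residueAlgebra K A
      IsPurelyInseparable (ResidueField (A.comap (algebraMap K L))) (ResidueField A)) :
    K3 (A.comap (algebraMap K L)) := by
  intro F _ _ _ _
  let _ := residueAlgebra K A
  rw [residueChar_comap]
  rcases residueChar_prime_or_zero (B := A) with hp | hp
  · have := Fact.mk hp
    exact (hKap.pPolynomialsHaveZeros hp).1.not_dvd_finrank_of_isPurelyInseparable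
  · rw [hp, zero_dvd_iff]
    exact Module.finrank_pos.ne'

end ValuedField

/-- `(L, A)` is an algebraically maximal Kaplansky field, `L|K` is algebraic with `K` henselian,
`Ω` is an algebraic closure of `L` (hence of `K`) and `C` an extension of the valuation to `Ω`;
`Z₀` is the intersection of `L` with the absolute ramification field of `K`. -/
theorem proposition3p2 {K L Ω : Type*} [Field K] [Field L] [Field Ω]
    [Algebra K L] [Algebra L Ω] [Algebra K Ω] [IsScalarTower K L Ω]
    [Algebra.IsAlgebraic K L] [IsAlgClosure L Ω]
    (A : ValuationSubring L) (C : ValuationSubring Ω) (hC : C.comap (algebraMap L Ω) = A)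
    (hmax : ValuedField.IsAlgebraicallyMaximal A) (hKap : ValuedField.IsKaplansky A)
    (hK : ValuedField.IsHenselian (A.comap (algebraMap K L)))
    (Z₀ : IntermediateField K L)
    (hZ₀ : Z₀ = (ValuedField.absoluteRamificationField K C).comap (IsScalarTower.toAlgHom K L Ω)) :
    Maximal (fun F : IntermediateField K L =>
        ValuedField.IsTameExtension K (A.comap (algebraMap F L))) Z₀ ∧
      Maximal (fun M : IntermediateField Z₀ Ω => ValuedField.IsPurelyWild Z₀ C M)
        (IsScalarTower.toAlgHom Z₀ L Ω).fieldRange ∧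
      ValuedField.K3 (A.comap (algebraMap Z₀ L)) := by
  subst hC
  have hmem : ∀ x, x ∈ Z₀ ↔ algebraMap L Ω x ∈ ValuedField.absoluteRamificationField K C := by
    subst hZ₀
    exact fun x => Iff.rfl
  have hLΩ : Algebra.IsAlgebraic L Ω := IsAlgClosure.isAlgebraic
  have hΩ : IsAlgClosed Ω := IsAlgClosure.isAlgClosed L
  have hKΩ : IsAlgClosure K Ω := ⟨hΩ, Algebra.IsAlgebraic.trans K L Ω⟩
  have hnormal : Normal K Ω := IsAlgClosure.normal K Ω
  have hnormal₀ : Normal Z₀ Ω := Normal.tower_top_of_normal K Z₀ Ω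
  rw [ValuedField.comap_comap_algebraMap] at hK
  have hst : ValuedField.Stable K C := hK.stable
  have hst₀ : ValuedField.Stable Z₀ C := hst.restrictScalars
  -- Since `Z₀` lies in the absolute ramification field of `K`, it has the same absolute
  -- ramification field, whose intersection with `L` is again `Z₀`.
  have hmem₀ : ∀ x : L, algebraMap L Ω x ∈ ValuedField.absoluteRamificationField Z₀ C →
      x ∈ Set.range (algebraMap Z₀ L) := fun x hx =>
    ⟨⟨x, (hmem x).2 ((ValuedField.mem_absoluteRamificationField_iff_of_le
      fun y : Z₀ => (hmem y).1 y.2).1 hx)⟩, rfl⟩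
  have hnormalZ := hst₀.normal_absoluteRamificationField
  have hsepZ := ValuedField.isSeparable_absoluteRamificationField (K := Z₀) (C := C)
  have hgalZ : IsGalois Z₀ (ValuedField.absoluteRamificationField Z₀ C) := ⟨⟩
  refine ⟨⟨hst.isTameExtension_inf hmem, fun F hF _ => hst.le_of_isTameExtension hmem hF⟩,
    ⟨⟨hst₀.isHenselian, inferInstance, ?_⟩, fun M hM hle => ?_⟩,
    hKap.k3_comap (hst₀.isPurelyInseparable_residue hmem₀)⟩
  · refine ValuedField.linearDisjoint_of_inf_eq_bot ?_
    rw [eq_bot_iff]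
    rintro _ ⟨⟨x, rfl⟩, hx⟩
    obtain ⟨y, hy⟩ := hmem₀ x hx
    refine IntermediateField.mem_bot.2 ⟨y, ?_⟩
    rw [IsScalarTower.algebraMap_apply Z₀ L Ω, hy]
    rfl
  -- Maximality: `L` and the absolute ramification field of `Z₀` generate `Ω`, so no larger field is
  -- linearly disjoint from the latter.
  · exact ValuedField.le_of_linearDisjoint_of_sup_eq_top hle hM.linearDisjoint
      (hst₀.sup_absoluteRamificationField_eq_top hmax hKap)
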